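/- **Theorem 3 (Generalized degenerate and semi-degenerate Darboux transformation).** Consider the Kaup–Newell (KN) system $$iq_t-q_{xx}-i(q^2r)_x=0,\qquad ir_t+r_{xx}-i(qr^2)_x=0$$ with Lax pair $\Psi_x=U\Psi$, $\Psi_t=V\Psi$, $U=i\sigma\lambda^2+Q\lambda$, $V=2i\sigma\lambda^4+2Q\lambda^3+iQ^2\sigma\lambda^2+(Q^3+iQ_x\sigma)\lambda$, where $\sigma=\mathrm{diag}(1,-1)$ and $Q=\begin{pmatrix}0&q\\ r&0\end{pmatrix}$. Let $\hbar\ge 1$, $n\ge 0$, $n_1,\dots,n_\hbar\ge 0$ and $N=2\hbar+2(n_1+\dots+n_\hbar)+2n$. Let $\lambda_1,\dots,\lambda_{2\hbar}$ (the pairs $(\lambda_1,\lambda_2),\dots,(\lambda_{2\hbar-1},\lambda_{2\hbar})$) and $\lambda_{N-2n+1},\dots,\lambda_N$ (the $2n$ free parameters) be complex numbers, called nodes. The $N$ rows are distributed over the nodes as follows: row $j\le 2\hbar$ belongs to $\lambda_j$ and has order $n_j=0$; if $s_l=2\hbar+2n_1+\dots+2n_{l-1}$ and $s_l<j\le s_l+2n_l$,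 then row $j$ belongs to $\lambda_{2l-1}$ for odd $j$ and to $\lambda_{2l}$ for even $j$ and has order $n_j=\left[\frac{j-s_l+1}{2}\right]$; row $j>N-2n$ belongs to $\lambda_j$ and has order $0$. (Below, $n_j$ with a row index $j$ is this order.) Write $\mu_j$ for the node of row $j$. Let $(q,r)$ be a smooth solution of the KN system on an open set $\Omega$ of the $(x,t)$-plane. For each node let $\Psi=(\phi,\varphi)^T$ be an eigenfunction of the Lax pair on $\Omega$, at that node if it is free; for $\lambda_1,\dots,\lambda_{2\hbar}$, let it be defined for all spectral parameters near the node, smooth in $(x,t,\lambda)$ and holomorphic in $\lambda$. Let $(\phi_j,\varphi_j)$ be the eigenfunction of the node of row $j$. For $1\le j,k\le N$ let $$M_{jk}(\lambda)=\begin{cases}\lambda^{N-k}\varphi_j(\lambda)&k\text{ odd}\\ \lambda^{N-k}\phi_j(\lambda)&k\text{ even}\end{cases},\quad P_{jk}(\lambda)=\begin{cases}\lambda^{N-k}\phi_j(\lambda)&k\text{ odd}\\ \lambda^{N-k}\varphi_j(\lambda)&k\text{ even}\end{cases},$$ $H_{j1}(\lambda)=\lambda^N\phi_j(\lambda)$,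 $W_{j1}(\lambda)=\lambda^N\varphi_j(\lambda)$, and $H_{jk}=M_{jk}$, $W_{jk}=P_{jk}$ for $k\ge2$. The $N$-fold Darboux transformation with spectral parameters $(\Lambda_1,\dots,\Lambda_N)$ is $$q[N]=\frac{|M|^2}{|P|^2}q+2i\frac{|M||H|}{|P|^2},\qquad r[N]=\frac{|P|^2}{|M|^2}r-2i\frac{|P||W|}{|M|^2}$$ with the matrices $M=(M_{jk}(\Lambda_j))$, and likewise $H$, $P$, $W$. Let $M',H',P',W'$ be the matrices with Taylor rows $$M'_{jk}=\frac1{n_j!}\frac{\partial^{n_j}}{\partial\epsilon^{n_j}}M_{jk}(\mu_j+\epsilon)\Big|_{\epsilon=0}\quad\text{(likewise }H',P',W'),$$ and let $$q_N=\frac{|M'|^2}{|P'|^2}q+2i\frac{|M'||H'|}{|P'|^2},\qquad r_N=\frac{|P'|^2}{|M'|^2}r-2i\frac{|P'||W'|}{|M'|^2}.$$ (In all four matrices the rows of order $0$, in particular the last $2n$ rows, are those of the $N$-fold transformation.) 1. *Limit.* Let $\Lambda_j\to\mu_j$ jointly for all rows with $n_j\ge 1$, while $\Lambda_j=\mu_j$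 for all rows of order $0$, in such a way that parameters $\Lambda_j$ of rows belonging to the same node are pairwise distinct. At every point of $\Omega$ where $|P'|\ne0$ one has $|P|\neq 0$ for all such $\Lambda$ close enough to $(\mu_1,\dots,\mu_N)$, and $q[N]\to q_N$; at every point where $|M'|\neq0$ one has $|M|\ne0$ for all such $\Lambda$ close enough, and $r[N]\to r_N$. 2. *New solution of the KN system.* $(q_N,r_N)$ is a smooth solution of the KN system on $\{(x,t)\in\Omega:|P'|\neq0,\ |M'|\ne0\}$. 3. *Reduction to the DNLS equation.* Suppose that $r=-q^*$ on $\Omega$ and that there is an involution of the set of nodes which preserves the number of rows of a node, sends a node with value $\lambda_c$ to one with value $-\lambda_c^*$, and is such that the eigenfunctions $(\phi,\varphi)$ of a node and $(\tilde\phi,\tilde\varphi)$ of its image satisfy $\tilde\phi(x,t,-\lambda^*)^*=\varphi(x,t,\lambda)$ wherever both are defined. Then $r_N=-q_N^*$, and $q_N$ is a smooth solution of the derivative nonlinear Schrödinger equation $iq_t-q_{xx}+i(q^2q^*)_x=0$, on $\{(x,t)\in\Omega:|P'|\neq0\}$. 4. *Higher-order hybrid-pattern solitons.* Let $q=r=0$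 with the eigenfunctions $\phi=e^{i(\lambda^2x+2\lambda^4t)}$, $\varphi=e^{-i(\lambda^2x+2\lambda^4t)}$, let the nodes be pairwise distinct, let $\lambda_{2l}=-\lambda_{2l-1}^*$ for $l=1,\dots,\hbar$, and let the $2n$ free parameters be purely imaginary. Then $|P'|\ne0$ at $(x,t)=(0,0)$, and $q_N=2i|M'||H'|/|P'|^2$ is a smooth solution of the derivative nonlinear Schrödinger equation on $\{(x,t)\in\mathbb R^2:|P'|\neq0\}$ (the higher-order hybrid-pattern soliton, without a periodic background for $n=0$ and on an $n$-periodic background for $n\ne0$). -/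

import Mathlib

open scoped ContDiff Matrix Topology

noncomputable section

namespace KaupNewell

/-! ### The Kaup-Newell system, the derivative NLS equation and the Lax pair -/

/-- `(q, r)` is a smooth solution on `Ω` of the Kaup-Newell system
`i q_t - q_xx - i (q² r)_x = 0`, `i r_t + r_xx - i (q r²)_x = 0`.
Points of the plane are written `p = (x, t)`. -/
def IsKNSolutionOn (q r : ℝ → ℝ → ℂ) (Ω : Set (ℝ × ℝ)) : Prop :=
  ContDiffOn ℝ ∞ (fun p : ℝ × ℝ => q p.1 p.2) Ω ∧
  ContDiffOn ℝ ∞ (fun p : ℝ × ℝ => r p.1 p.2) Ω ∧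
  ∀ x t : ℝ, (x, t) ∈ Ω →
    Complex.I * deriv (fun s => q x s) t - deriv (deriv (fun y => q y t)) x
        - Complex.I * deriv (fun y => q y t ^ 2 * r y t) x = 0 ∧
    Complex.I * deriv (fun s => r x s) t + deriv (deriv (fun y => r y t)) x
        - Complex.I * deriv (fun y => q y t * r y t ^ 2) x = 0

/-- `q` is a smooth solution on `Ω` of the derivative nonlinear Schrödinger equation
`i q_t - q_xx + i (q² q*)_x = 0`. -/
def IsDNLSSolutionOn (q : ℝ → ℝ → ℂ) (Ω : Set (ℝ × ℝ)) : Prop :=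
  ContDiffOn ℝ ∞ (fun p : ℝ × ℝ => q p.1 p.2) Ω ∧
  ∀ x t : ℝ, (x, t) ∈ Ω →
    Complex.I * deriv (fun s => q x s) t - deriv (deriv (fun y => q y t)) x
        + Complex.I * deriv (fun y => q y t ^ 2 * (starRingEnd ℂ) (q y t)) x = 0

/-- The matrix `σ = diag(1, -1)`. -/
def sigma : Matrix (Fin 2) (Fin 2) ℂ := !![1, 0; 0, -1]

/-- The potential matrix `Q`. -/
def potential (q r : ℂ) : Matrix (Fin 2) (Fin 2) ℂ := !![0, q; r, 0]

/-- `U = i σ λ² + Q λ`. -/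
def laxU (z q r : ℂ) : Matrix (Fin 2) (Fin 2) ℂ :=
  (Complex.I * z ^ 2) • sigma + z • potential q r

/-- `V = 2 i σ λ⁴ + 2 Q λ³ + i Q² σ λ² + (Q³ + i Q_x σ) λ`;
`qx` and `rx` stand for the `x`-derivatives of `q` and `r`. -/
def laxV (z q r qx rx : ℂ) : Matrix (Fin 2) (Fin 2) ℂ :=
  (2 * Complex.I * z ^ 4) • sigma + (2 * z ^ 3) • potential q r
    + (Complex.I * z ^ 2) • (potential q r ^ 2 * sigma)
    + z • (potential q r ^ 3 + Complex.I • (potential qx rx * sigma))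

/-- `Ψ x t z = (φ, ϕ)` is, for every spectral parameter `z ∈ D`, an eigenfunction on `Ω` of the
Lax pair with potentials `q`, `r`; it is smooth and depends holomorphically on `z`.
(If `D = {z₀}` is a single point, this is one eigenfunction at `z₀`, and the dependence on `z`
is no condition.) -/
structure IsEigenfunctionFamily (q r : ℝ → ℝ → ℂ) (Ω : Set (ℝ × ℝ)) (D : Set ℂ)
    (Ψ : ℝ → ℝ → ℂ → Fin 2 → ℂ) : Prop where
  smooth : ContDiffOn ℝ ∞ (fun w : (ℝ × ℝ) × ℂ => Ψ w.1.1 w.1.2 w.2) (Ω ×ˢ D)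
  holomorphic : ∀ x t : ℝ, (x, t) ∈ Ω → DifferentiableOn ℂ (Ψ x t) D
  lax_x : ∀ x t : ℝ, (x, t) ∈ Ω → ∀ z ∈ D,
    HasDerivAt (fun y => Ψ y t z) (laxU z (q x t) (r x t) *ᵥ Ψ x t z) x
  lax_t : ∀ x t : ℝ, (x, t) ∈ Ω → ∀ z ∈ D,
    HasDerivAt (fun s => Ψ x s z)
      (laxV z (q x t) (r x t) (deriv (fun y => q y t) x) (deriv (fun y => r y t) x) *ᵥ Ψ x t z) t

/-! ### The determinants of the Darboux transformation

Columns are numbered from `0`; the column with number `k : Fin N` is the `(k+1)`-st one, so that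
it carries the power `λ^(N-(k+1))`. A vector `v : Fin 2 → ℂ` stands for `(φ, ϕ) = (v 0, v 1)`. -/

/-- Row of `M`: `λ^(N-1) ϕ, λ^(N-2) φ, λ^(N-3) ϕ, …`. -/
def entryM {N : ℕ} (k : Fin N) (z : ℂ) (v : Fin 2 → ℂ) : ℂ :=
  z ^ (N - 1 - (k : ℕ)) * (if Even (k : ℕ) then v 1 else v 0)

/-- Row of `P`: `λ^(N-1) φ, λ^(N-2) ϕ, λ^(N-3) φ, …`. -/
def entryP {N : ℕ} (k : Fin N) (z : ℂ) (v : Fin 2 → ℂ) : ℂ :=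
  z ^ (N - 1 - (k : ℕ)) * (if Even (k : ℕ) then v 0 else v 1)

/-- Row of `H`: the first entry of the row of `M` is replaced by `λ^N φ`. -/
def entryH {N : ℕ} (k : Fin N) (z : ℂ) (v : Fin 2 → ℂ) : ℂ :=
  if (k : ℕ) = 0 then z ^ N * v 0 else entryM k z v

/-- Row of `W`: the first entry of the row of `P` is replaced by `λ^N ϕ`. -/
def entryW {N : ℕ} (k : Fin N) (z : ℂ) (v : Fin 2 → ℂ) : ℂ :=
  if (k : ℕ) = 0 then z ^ N * v 1 else entryP k z v

/-- The matrix of the `N`-fold transformation whose row `j` belongs to the spectral parameter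
`Λ j` and the eigenfunction `z ↦ V j z` (at a fixed point of the plane). -/
def nfoldMatrix {N : ℕ} (e : Fin N → ℂ → (Fin 2 → ℂ) → ℂ) (Λ : Fin N → ℂ)
    (V : Fin N → ℂ → Fin 2 → ℂ) : Matrix (Fin N) (Fin N) ℂ :=
  Matrix.of fun j k => e k (Λ j) (V j (Λ j))

/-- The matrix with Taylor rows: row `j` holds the Taylor coefficients of order `d j` at `ε = 0` of
the entries of row `j` with spectral parameter `Λ j + ε`. -/
def taylorMatrix {N : ℕ} (e : Fin N → ℂ → (Fin 2 → ℂ) → ℂ) (Λ : Fin N → ℂ) (d : Fin N → ℕ)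
    (V : Fin N → ℂ → Fin 2 → ℂ) : Matrix (Fin N) (Fin N) ℂ :=
  Matrix.of fun j k =>
    iteratedDeriv (d j) (fun ε : ℂ => e k (Λ j + ε) (V j (Λ j + ε))) 0 / ((d j).factorial : ℂ)

/-- `|M|² / |P|² · q + 2 i |M| |H| / |P|²`. -/
def formulaQ {N : ℕ} (q : ℂ) (M H P : Matrix (Fin N) (Fin N) ℂ) : ℂ :=
  M.det ^ 2 / P.det ^ 2 * q + 2 * Complex.I * (M.det * H.det / P.det ^ 2)

/-- `|P|² / |M|² · r - 2 i |P| |W| / |M|²`. -/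
def formulaR {N : ℕ} (r : ℂ) (P W M : Matrix (Fin N) (Fin N) ℂ) : ℂ :=
  P.det ^ 2 / M.det ^ 2 * r - 2 * Complex.I * (P.det * W.det / M.det ^ 2)

/-! ### The blocks of coalescing parameters

There are `b` pairs of spectral parameters `(λ₁, λ₂), …, (λ_{2b-1}, λ_{2b})`, numbered from `0`
(`Sum.inl 0, Sum.inl 1, …`), and `2n` free parameters (`Sum.inr`). The rows are, in this order:
* the `2b` rows of the parameters `λ₁, …, λ_{2b}` themselves, of order `0`;
* for `l = 0, …, b - 1` a block of `2 m_l` rows, which belong alternately to the first and to the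
  second member of pair `l`, of orders `1, 1, 2, 2, …, m_l, m_l`;
* the `2n` rows of the free parameters, of order `0`. -/

/-- `N = 2 b + 2 (m_0 + … + m_{b-1}) + 2 n`. -/
abbrev dtSize (b : ℕ) (m : Fin b → ℕ) (n : ℕ) : ℕ := 2 * b + (∑ l, 2 * m l) + 2 * n

/-- Index type of the parameters that are distinguished in the limit. -/
abbrev Node (b n : ℕ) : Type := Fin (2 * b) ⊕ Fin (2 * n)

/-- Index of the first (`s` even) or second (`s` odd) member of the pair `l`. -/
def pairNode {b : ℕ} (l : Fin b) (s : ℕ) : Fin (2 * b) :=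
  ⟨2 * (l : ℕ) + s % 2, by have := l.isLt; omega⟩

/-- Index of the pair to which a parameter belongs. -/
def pairIndex {b : ℕ} (i : Fin (2 * b)) : Fin b :=
  ⟨(i : ℕ) / 2, by have := i.isLt; omega⟩

/-- The parameter to which row `j` belongs in the limit. -/
def rowNode (b : ℕ) (m : Fin b → ℕ) (n : ℕ) : Fin (dtSize b m n) → Node b n :=
  Fin.addCases
    (Fin.addCases (fun i => Sum.inl i)
      (fun s => Sum.inl (pairNode (finSigmaFinEquiv.symm s).1 ((finSigmaFinEquiv.symm s).2 : ℕ))))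
    (fun i => Sum.inr i)

/-- The order `n_j` of row `j`: the row with number `s` (from `0`) of its block has order
`[(s + 2) / 2]`. -/
def rowOrder (b : ℕ) (m : Fin b → ℕ) (n : ℕ) : Fin (dtSize b m n) → ℕ :=
  Fin.addCases
    (Fin.addCases (fun _ => 0)
      (fun s => (((finSigmaFinEquiv.symm s).2 : ℕ) + 2) / 2))
    (fun _ => 0)

/-- The number of rows that belong to a given parameter. -/
def nodeMult {b n : ℕ} (m : Fin b → ℕ) : Node b n → ℕ :=
  Sum.elim (fun i => m (pairIndex i) + 1) (fun _ => 1)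

variable {b n : ℕ}

/-- The limit values of the `N` spectral parameters. -/
def limitParams (m : Fin b → ℕ) (lam : Node b n → ℂ) : Fin (dtSize b m n) → ℂ :=
  fun j => lam (rowNode b m n j)

/-- The admissible choices of the `N` spectral parameters: the parameters `λ₁, …, λ_{2b}` and the
free parameters keep their values, and parameters that coalesce in the limit are pairwise
distinct. -/
def admissibleParams (m : Fin b → ℕ) (lam : Node b n → ℂ) : Set (Fin (dtSize b m n) → ℂ) :=
  {Λ | (∀ j, rowOrder b m n j = 0 → Λ j = limitParams m lam j) ∧
    ∀ i j, rowNode b m n i = rowNode b m n j → Λ i = Λ j → i = j}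

/-- The matrix of the `N`-fold transformation at `(x, t)` with spectral parameters `Λ`, where the
parameter of row `j` is inserted into the eigenfunction of the node to which row `j` belongs. -/
def nfoldAt (e : ∀ {N : ℕ}, Fin N → ℂ → (Fin 2 → ℂ) → ℂ) (m : Fin b → ℕ)
    (Ψ : Node b n → ℝ → ℝ → ℂ → Fin 2 → ℂ) (Λ : Fin (dtSize b m n) → ℂ) (x t : ℝ) :
    Matrix (Fin (dtSize b m n)) (Fin (dtSize b m n)) ℂ :=
  nfoldMatrix e Λ (fun j => Ψ (rowNode b m n j) x t)

/-- The matrix with Taylor rows (`M'`, `H'`, `P'`, `W'`) at `(x, t)`. -/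
def taylorAt (e : ∀ {N : ℕ}, Fin N → ℂ → (Fin 2 → ℂ) → ℂ) (m : Fin b → ℕ)
    (lam : Node b n → ℂ) (Ψ : Node b n → ℝ → ℝ → ℂ → Fin 2 → ℂ) (x t : ℝ) :
    Matrix (Fin (dtSize b m n)) (Fin (dtSize b m n)) ℂ :=
  taylorMatrix e (limitParams m lam) (rowOrder b m n) (fun j => Ψ (rowNode b m n j) x t)

/-- `q[N]` of the `N`-fold transformation with spectral parameters `Λ`. -/
def nfoldQ (q : ℝ → ℝ → ℂ) (m : Fin b → ℕ) (Ψ : Node b n → ℝ → ℝ → ℂ → Fin 2 → ℂ)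
    (Λ : Fin (dtSize b m n) → ℂ) (x t : ℝ) : ℂ :=
  formulaQ (q x t) (nfoldAt entryM m Ψ Λ x t) (nfoldAt entryH m Ψ Λ x t)
    (nfoldAt entryP m Ψ Λ x t)

/-- `r[N]` of the `N`-fold transformation with spectral parameters `Λ`. -/
def nfoldR (r : ℝ → ℝ → ℂ) (m : Fin b → ℕ) (Ψ : Node b n → ℝ → ℝ → ℂ → Fin 2 → ℂ)
    (Λ : Fin (dtSize b m n) → ℂ) (x t : ℝ) : ℂ :=
  formulaR (r x t) (nfoldAt entryP m Ψ Λ x t) (nfoldAt entryW m Ψ Λ x t)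
    (nfoldAt entryM m Ψ Λ x t)

/-- `q_N` of the generalized (semi-)degenerate transformation. -/
def degenerateQ (q : ℝ → ℝ → ℂ) (m : Fin b → ℕ) (lam : Node b n → ℂ)
    (Ψ : Node b n → ℝ → ℝ → ℂ → Fin 2 → ℂ) (x t : ℝ) : ℂ :=
  formulaQ (q x t) (taylorAt entryM m lam Ψ x t) (taylorAt entryH m lam Ψ x t)
    (taylorAt entryP m lam Ψ x t)

/-- `r_N` of the generalized (semi-)degenerate transformation. -/
def degenerateR (r : ℝ → ℝ → ℂ) (m : Fin b → ℕ) (lam : Node b n → ℂ)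
    (Ψ : Node b n → ℝ → ℝ → ℂ → Fin 2 → ℂ) (x t : ℝ) : ℂ :=
  formulaR (r x t) (taylorAt entryP m lam Ψ x t) (taylorAt entryW m lam Ψ x t)
    (taylorAt entryM m lam Ψ x t)

/-- The eigenfunction `(e^{i(λ² x + 2 λ⁴ t)}, e^{-i(λ² x + 2 λ⁴ t)})` of the zero seed. -/
def zeroSeedEigenfunction (x t : ℝ) (z : ℂ) : Fin 2 → ℂ :=
  ![Complex.exp (Complex.I * (z ^ 2 * x + 2 * z ^ 4 * t)),
    Complex.exp (-(Complex.I * (z ^ 2 * x + 2 * z ^ 4 * t)))]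

end KaupNewell

end

noncomputable section

namespace KaupNewell

/-! ### Determinants of column families and their derivatives -/

/-! Let `X j` be the vector, indexed by the rows, of the Taylor coefficients of `λ^j φ` (even `j`)
or `λ^j ϕ` (odd `j`), and let `Y j` be the same with `φ` and `ϕ` exchanged. As `N` is even, `M'` has
the columns `X (N-1), …, X 0` and `P'` the columns `Y (N-1), …, Y 0`; `H'` and `W'` arise by putting
`X N` and `Y N` in the first column. If `X N + ∑ α k • X (N-1-k) = 0` and `Y N + ∑ β k • Y (N-1-k) =
0`, Cramer's rule gives `α 0 = -|H'|/|M'|`, hence `q_N = (|M'|/|P'|)² (q - 2i α 0)`, and likewise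
for `r_N` with `β 0`.

New solution. Multiplication by `λ` acts on Taylor rows as one constant linear map `T`, a sum of
Jordan blocks, with `T (X j) = Y (j+1)` and `T (Y j) = X (j+1)`. Applying `T` repeatedly to the two
relations expresses every `X (N+s)` needed in the basis `X (N-1), …, X 0`, with coordinates
polynomial in `α` and `β` (`eq_comb_highCoord`). The Lax pair moves `X j` by a combination of `X
(j+1), …, X (j+4)` (`laxSequence_taylorVec`). So the derivatives of `α`, `β` and the logarithmic
derivatives of the determinants are polynomials in `α`, `β`, `q`, `r` and their `x`-derivatives
(`hasDerivAt_relCoeff`, `hasDerivAt_det_colMatrix`), and the Kaup-Newell equation for `q_N` becomes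
a polynomial identity modulo `ι² = -1` (`transformed_equation`). Exchanging `X` with `Y`, `q` with
`r` and `i` with `-i` gives the other equation. Only `T` and the flow of the columns enter, so
coalesced parameters need no limiting argument here.

Limit. Newton interpolation writes each `N`-fold matrix as `newtonMatrix Λ * B Λ`, where `B Λ` holds
divided differences and tends to the matrix with Taylor rows (`exists_factorization`). The left
factor is common to all four matrices and invertible for distinct parameters, so it cancels from
formulas that are homogeneous of degree zero in the determinants.

Reduction. Under `λ ↦ -λ*` the conjugated rows of `M'` are, up to order and sign, those of `P'`; the
same sign `s` relates `|M'|` to `|P'|`, and the extra power of `λ` in the first column makes it `-s`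
between `|H'|` and `|W'|` (`exists_sign_conj_det`). This is `r_N = -q_N*`.

Zero seed. At the origin the eigenfunction is `(1, 1)` and `P'` is a confluent Vandermonde matrix,
invertible for distinct nodes. -/

theorem hasDerivAt_det {N : ℕ} {A : ℝ → Matrix (Fin N) (Fin N) ℂ}
    {A' : Matrix (Fin N) (Fin N) ℂ} {s : ℝ}
    (h : ∀ i j, HasDerivAt (fun y => A y i j) (A' i j) s) :
    HasDerivAt (fun y => (A y).det) (∑ k, ((A s).updateCol k (fun i => A' i k)).det) s := by
  have key : ∀ y, (A y).det = ∑ σ : Equiv.Perm (Fin N),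
      ((Equiv.Perm.sign σ : ℤ) : ℂ) * ∏ i, A y (σ i) i := fun y => Matrix.det_apply' _
  simp_rw [key]
  have h1 : HasDerivAt (fun y => ∑ σ : Equiv.Perm (Fin N),
      ((Equiv.Perm.sign σ : ℤ) : ℂ) * ∏ i, A y (σ i) i)
      (∑ σ : Equiv.Perm (Fin N), ((Equiv.Perm.sign σ : ℤ) : ℂ) *
        ∑ k, (∏ j ∈ Finset.univ.erase k, A s (σ j) j) • A' (σ k) k) s := by
    refine HasDerivAt.fun_sum fun σ _ => HasDerivAt.const_mul _ ?_
    exact HasDerivAt.fun_finsetProd fun i _ => h (σ i) i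
  convert h1 using 1
  simp_rw [Matrix.det_apply', Finset.mul_sum]
  rw [Finset.sum_comm]
  refine Finset.sum_congr rfl fun σ _ => Finset.sum_congr rfl fun k _ => ?_
  congr 1
  rw [← Finset.prod_erase_mul _ _ (Finset.mem_univ k), smul_eq_mul]
  congr 1
  · refine Finset.prod_congr rfl fun j hj => ?_
    rw [Matrix.updateCol_ne (Finset.ne_of_mem_erase hj)]
  · simp

/-- The matrix with columns `X (N-1), …, X 0`. -/
def colMatrix {N : ℕ} (X : ℕ → Fin N → ℂ) : Matrix (Fin N) (Fin N) ℂ :=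
  Matrix.of fun i k => X (N - 1 - k) i

/-- The coefficients `α` of the relation `X N + α 0 • X (N-1) + … + α (N-1) • X 0 = 0`,
extended by zero. -/
def relCoeff {N : ℕ} (X : ℕ → Fin N → ℂ) (k : ℕ) : ℂ :=
  if h : k < N then -((colMatrix X).updateCol ⟨k, h⟩ (X N)).det / (colMatrix X).det else 0

theorem relCoeff_of_le {N : ℕ} (X : ℕ → Fin N → ℂ) {k : ℕ} (h : N ≤ k) : relCoeff X k = 0 :=
  dif_neg (not_lt.mpr h)

/-- The combination `∑ γ k • X (N-1-k+i)` over `k < N`. -/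
def comb {N : ℕ} (X : ℕ → Fin N → ℂ) (γ : ℕ → ℂ) (i : ℕ) : Fin N → ℂ :=
  ∑ k ∈ Finset.range N, γ k • X (N - 1 - k + i)

theorem colMatrix_mulVec {N : ℕ} (X : ℕ → Fin N → ℂ) (γ : ℕ → ℂ) :
    colMatrix X *ᵥ (fun k : Fin N => γ k) = comb X γ 0 := by
  ext i
  rw [comb, ← Fin.sum_univ_eq_sum_range (fun k => γ k • X (N - 1 - k + 0))]
  simp [Matrix.mulVec, dotProduct, colMatrix, mul_comm]

/-- The columns form a basis, so velocities of coefficients can be read off by comparing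
coordinates. -/
theorem comb_injective {N : ℕ} {X : ℕ → Fin N → ℂ} (h : (colMatrix X).det ≠ 0) {γ δ : ℕ → ℂ}
    (e : comb X γ 0 = comb X δ 0) {k : ℕ} (hk : k < N) : γ k = δ k := by
  rw [← colMatrix_mulVec, ← colMatrix_mulVec] at e
  exact congrFun (Matrix.mulVec_injective_of_isUnit
    ((Matrix.isUnit_iff_isUnit_det _).2 (isUnit_iff_ne_zero.2 h)) e) (⟨k, hk⟩ : Fin N)

theorem comb_relCoeff {N : ℕ} {X : ℕ → Fin N → ℂ} (h : (colMatrix X).det ≠ 0) :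
    X N + comb X (relCoeff X) 0 = 0 := by
  rw [← colMatrix_mulVec]
  have : (fun k : Fin N => relCoeff X k)
      = -((colMatrix X).det)⁻¹ • (colMatrix X).cramer (X N) := by
    ext k
    simp [relCoeff, Matrix.cramer_apply, div_eq_inv_mul]
  rw [this, Matrix.mulVec_smul, Matrix.mulVec_cramer, smul_smul]
  simp [h]

/-- Raising all degrees by one pushes only the leading vector out of the previous window of `N`
vectors. Iterating this isolates the high vectors `X (N+s)`. -/
theorem comb_succ {N : ℕ} (X : ℕ → Fin N → ℂ) (hN : 1 ≤ N) {γ : ℕ → ℂ}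
    (hγ : ∀ k, N ≤ k → γ k = 0) (i : ℕ) :
    comb X γ (i + 1) = γ 0 • X (N + i) + comb X (fun k => γ (k + 1)) i := by
  obtain ⟨m, rfl⟩ : ∃ m, N = m + 1 := ⟨N - 1, by omega⟩
  unfold comb
  rw [Finset.sum_range_succ', Finset.sum_range_succ _ m]
  beta_reduce
  -- The shifted family has one slot too many; the extension of the coefficients by zero fills it.
  rw [hγ (m + 1) le_rfl, zero_smul, add_zero,
    add_comm (∑ k ∈ Finset.range m, _)]
  congr 1
  · congr 2; omega
  · refine Finset.sum_congr rfl fun k hk => ?_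
    have := Finset.mem_range.1 hk
    congr 2; omega

theorem comb_add {N : ℕ} (X : ℕ → Fin N → ℂ) (γ δ : ℕ → ℂ) (i : ℕ) :
    comb X (fun k => γ k + δ k) i = comb X γ i + comb X δ i := by
  simp [comb, add_smul, Finset.sum_add_distrib]

theorem comb_smul {N : ℕ} (X : ℕ → Fin N → ℂ) (c : ℂ) (γ : ℕ → ℂ) (i : ℕ) :
    comb X (fun k => c * γ k) i = c • comb X γ i := by
  simp [comb, mul_smul, Finset.smul_sum]

theorem comb_neg {N : ℕ} (X : ℕ → Fin N → ℂ) (γ : ℕ → ℂ) (i : ℕ) :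
    comb X (fun k => -γ k) i = -comb X γ i := by
  simp [comb]

theorem map_comb {N : ℕ} {X Y : ℕ → Fin N → ℂ} (T : (Fin N → ℂ) →ₗ[ℂ] (Fin N → ℂ))
    (hT : ∀ j, T (X j) = Y (j + 1)) (γ : ℕ → ℂ) (i : ℕ) : T (comb X γ i) = comb Y γ (i + 1) := by
  simp only [comb, map_sum, map_smul, hT, add_assoc]

/-- Coordinates of `X N, …, X (N+4)` with respect to `X (N-1), …, X 0`. -/
def highCoord (α β : ℕ → ℂ) : ℕ → ℕ → ℂ
  | 0, k => -α k
  | 1, k => -β 0 * highCoord α β 0 k - β (k + 1)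
  | 2, k => -α 0 * highCoord α β 1 k - α 1 * highCoord α β 0 k - α (k + 2)
  | 3, k => -β 0 * highCoord α β 2 k - β 1 * highCoord α β 1 k - β 2 * highCoord α β 0 k
      - β (k + 3)
  | 4, k => -α 0 * highCoord α β 3 k - α 1 * highCoord α β 2 k - α 2 * highCoord α β 1 k
      - α 3 * highCoord α β 0 k - α (k + 4)
  | _, _ => 0

theorem highCoord_of_le {N : ℕ} {α β : ℕ → ℂ} (hα : ∀ k, N ≤ k → α k = 0)
    (hβ : ∀ k, N ≤ k → β k = 0) (s : ℕ) {k : ℕ} (hk : N ≤ k) : highCoord α β s k = 0 := by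
  have a : ∀ i, α (k + i) = 0 := fun i => hα _ (by omega)
  have b : ∀ i, β (k + i) = 0 := fun i => hβ _ (by omega)
  have a0 := hα k hk
  match s with
  | 0 => simp [highCoord, a0]
  | 1 => simp [highCoord, a0, b]
  | 2 => simp [highCoord, a0, a, b]
  | 3 => simp [highCoord, a0, a, b]
  | 4 => simp [highCoord, a0, a, b]
  | _ + 5 => simp [highCoord]

/-- Each application of `T` raises the degree by one and swaps the two families while keeping the
coefficients. Hence the `X`-relations in degrees `N, N+1, …, N+4` have coefficients `α, β, α, β, α`;
solving them successively for their leading vectors yields the recursion `highCoord`. -/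
theorem eq_comb_highCoord {N : ℕ} {X Y : ℕ → Fin N → ℂ} (hN : 1 ≤ N)
    (T : (Fin N → ℂ) →ₗ[ℂ] (Fin N → ℂ))
    (hX : ∀ j, T (X j) = Y (j + 1)) (hY : ∀ j, T (Y j) = X (j + 1)) {α β : ℕ → ℂ}
    (hα : ∀ k, N ≤ k → α k = 0) (hβ : ∀ k, N ≤ k → β k = 0)
    (rX : X N + comb X α 0 = 0) (rY : Y N + comb Y β 0 = 0) {s : ℕ} (hs : s ≤ 4) :
    X (N + s) = comb X (highCoord α β s) 0 := by
  have a : ∀ i k, N ≤ k → α (k + i) = 0 := fun i k h => hα _ (by omega)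
  have b : ∀ i k, N ≤ k → β (k + i) = 0 := fun i k h => hβ _ (by omega)
  have h0 : X N = comb X (highCoord α β 0) 0 := by
    have : highCoord α β 0 = fun k => -α k := by ext k; simp only [highCoord]
    rw [this, comb_neg]; exact eq_neg_of_add_eq_zero_left rX
  have r1 : X (N + 1) + comb X β 1 = 0 := by
    have := congrArg T rY
    rwa [map_add, hY, map_comb T hY, map_zero] at this
  have r1' : Y (N + 1) + comb Y α 1 = 0 := by
    have := congrArg T rX
    rwa [map_add, hX, map_comb T hX, map_zero] at this
  have r2 : X (N + 2) + comb X α 2 = 0 := by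
    have := congrArg T r1'
    rwa [map_add, hY, map_comb T hY, map_zero] at this
  have r2' : Y (N + 2) + comb Y β 2 = 0 := by
    have := congrArg T r1
    rwa [map_add, hX, map_comb T hX, map_zero] at this
  have r3 : X (N + 3) + comb X β 3 = 0 := by
    have := congrArg T r2'
    rwa [map_add, hY, map_comb T hY, map_zero] at this
  have r3' : Y (N + 3) + comb Y α 3 = 0 := by
    have := congrArg T r2
    rwa [map_add, hX, map_comb T hX, map_zero] at this
  have r4 : X (N + 4) + comb X α 4 = 0 := by
    have := congrArg T r3'
    rwa [map_add, hY, map_comb T hY, map_zero] at this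
  rw [comb_succ X hN hβ] at r1
  rw [comb_succ X hN hα, comb_succ X hN (a 1)] at r2
  rw [comb_succ X hN hβ, comb_succ X hN (b 1), comb_succ X hN (b 2)] at r3
  rw [comb_succ X hN hα, comb_succ X hN (a 1), comb_succ X hN (a 2), comb_succ X hN (a 3)] at r4
  have h1 : X (N + 1) = comb X (highCoord α β 1) 0 := by
    have : highCoord α β 1 = fun k => (-β 0) * highCoord α β 0 k + -β (k + 1) := by
      ext k; simp only [highCoord]; ring
    rw [this, comb_add, comb_smul, comb_neg, ← h0]
    rw [eq_neg_of_add_eq_zero_left r1]; simp only [add_zero]; module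
  have h2 : X (N + 2) = comb X (highCoord α β 2) 0 := by
    have : highCoord α β 2 = fun k => ((-α 0) * highCoord α β 1 k + (-α 1) * highCoord α β 0 k)
        + -α (k + 1 + 1) := by
      ext k; simp only [highCoord]; ring_nf
    rw [this, comb_add, comb_add, comb_smul, comb_smul, comb_neg, ← h0, ← h1]
    rw [eq_neg_of_add_eq_zero_left r2]; simp only [add_zero, zero_add]; module
  have h3 : X (N + 3) = comb X (highCoord α β 3) 0 := by
    have : highCoord α β 3 = fun k => ((-β 0) * highCoord α β 2 k + (-β 1) * highCoord α β 1 k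
        + (-β 2) * highCoord α β 0 k) + -β (k + 1 + 1 + 1) := by
      ext k; simp only [highCoord]; ring_nf
    rw [this, comb_add, comb_add, comb_add, comb_smul, comb_smul, comb_smul, comb_neg,
      ← h0, ← h1, ← h2]
    rw [eq_neg_of_add_eq_zero_left r3]; simp only [add_zero, zero_add]; module
  have h4 : X (N + 4) = comb X (highCoord α β 4) 0 := by
    have : highCoord α β 4 = fun k => ((-α 0) * highCoord α β 3 k + (-α 1) * highCoord α β 2 k
        + (-α 2) * highCoord α β 1 k + (-α 3) * highCoord α β 0 k) + -α (k + 1 + 1 + 1 + 1) := by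
      ext k; simp only [highCoord]; ring_nf
    rw [this, comb_add, comb_add, comb_add, comb_add, comb_smul, comb_smul, comb_smul, comb_smul,
      comb_neg, ← h0, ← h1, ← h2, ← h3]
    rw [eq_neg_of_add_eq_zero_left r4]; simp only [add_zero, zero_add]; module
  interval_cases s
  exacts [h0, h1, h2, h3, h4]

theorem differentiableAt_relCoeff {N : ℕ} {X : ℕ → ℝ → Fin N → ℂ} {s : ℝ}
    (h : ∀ j ≤ N, DifferentiableAt ℝ (X j) s) (hM : (colMatrix fun j => X j s).det ≠ 0) (k : ℕ) :
    DifferentiableAt ℝ (fun y => relCoeff (fun j => X j y) k) s := by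
  unfold relCoeff
  split_ifs with hk
  · have hc : ∀ i j, DifferentiableAt ℝ (fun y => colMatrix (fun j => X j y) i j) s :=
      fun i j => differentiableAt_pi.1 (h _ (by omega)) i
    have h1 := (hasDerivAt_det fun i j => (hc i j).hasDerivAt).differentiableAt
    refine DifferentiableAt.div (DifferentiableAt.neg ?_) h1 hM
    refine (hasDerivAt_det (A' := Matrix.of fun i j => deriv (fun y =>
      ((colMatrix fun j => X j y).updateCol ⟨k, hk⟩ (X N y)) i j) s)
      fun i j => DifferentiableAt.hasDerivAt ?_).differentiableAt
    simp only [Matrix.updateCol_apply]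
    split_ifs
    · exact differentiableAt_pi.1 (h N le_rfl) i
    · exact hc i j
  · exact differentiableAt_const _

/-- The velocity of `relCoeff` if the columns move with coefficients `d`. -/
def relVelocity (d : ℕ → ℕ → ℂ) (α β : ℕ → ℂ) (k : ℕ) : ℂ :=
  -(d 1 0 * highCoord α β 1 k + d 2 0 * highCoord α β 2 k + d 3 0 * highCoord α β 3 k
      + d 4 0 * highCoord α β 4 k
    + (α 0 * d 1 1 * highCoord α β 0 k + α (k + 1) * d 1 (k + 2))
    + (α 0 * d 2 1 * highCoord α β 1 k + α 1 * d 2 2 * highCoord α β 0 k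
      + α (k + 2) * d 2 (k + 3))
    + (α 0 * d 3 1 * highCoord α β 2 k + α 1 * d 3 2 * highCoord α β 1 k
      + α 2 * d 3 3 * highCoord α β 0 k + α (k + 3) * d 3 (k + 4))
    + (α 0 * d 4 1 * highCoord α β 3 k + α 1 * d 4 2 * highCoord α β 2 k
      + α 2 * d 4 3 * highCoord α β 1 k + α 3 * d 4 4 * highCoord α β 0 k
      + α (k + 4) * d 4 (k + 5)))

/-- The logarithmic derivative of the determinant if the columns move with coefficients `d`. -/
def detVelocity (d : ℕ → ℕ → ℂ) (α β : ℕ → ℂ) : ℂ :=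
  (d 1 1 * highCoord α β 0 0 + d 2 1 * highCoord α β 1 0 + d 3 1 * highCoord α β 2 0
    + d 4 1 * highCoord α β 3 0)
  + (d 2 2 * highCoord α β 0 1 + d 3 2 * highCoord α β 1 1 + d 4 2 * highCoord α β 2 1)
  + (d 3 3 * highCoord α β 0 2 + d 4 3 * highCoord α β 1 2)
  + d 4 4 * highCoord α β 0 3

/-! ### Velocities of the relation coefficients and of the determinant -/

section Flow

variable {N : ℕ} {X Y : ℕ → ℝ → Fin N → ℂ} {s : ℝ}

/-- Differentiate the relation `X N + comb X α 0 = 0`, rewrite the high vectors in the basis and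
compare coordinates. The number `d i k` is the coefficient of `X (N-k+i)` in the velocity of `X
(N-k)`, so the column with number `k` carries `d i (k+1)`. -/
theorem hasDerivAt_relCoeff (hN : 1 ≤ N) (T : (Fin N → ℂ) →ₗ[ℂ] (Fin N → ℂ))
    (hX : ∀ j, T (X j s) = Y (j + 1) s) (hY : ∀ j, T (Y j s) = X (j + 1) s) (d : ℕ → ℕ → ℂ)
    (h0 : HasDerivAt (X N) (d 1 0 • X (N + 1) s + d 2 0 • X (N + 2) s + d 3 0 • X (N + 3) s
      + d 4 0 • X (N + 4) s) s)
    (hd : ∀ k < N, HasDerivAt (X (N - 1 - k)) (d 1 (k + 1) • X (N - 1 - k + 1) s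
      + d 2 (k + 1) • X (N - 1 - k + 2) s + d 3 (k + 1) • X (N - 1 - k + 3) s
      + d 4 (k + 1) • X (N - 1 - k + 4) s) s)
    (hM : (colMatrix fun j => X j s).det ≠ 0) (hP : (colMatrix fun j => Y j s).det ≠ 0)
    {k : ℕ} (hk : k < N) :
    HasDerivAt (fun y => relCoeff (fun j => X j y) k)
      (relVelocity d (relCoeff fun j => X j s) (relCoeff fun j => Y j s) k) s := by
  have hdiff : ∀ j ≤ N, DifferentiableAt ℝ (X j) s := by
    intro j hj
    rcases hj.eq_or_lt with rfl | hj
    · exact h0.differentiableAt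
    · have := (hd (N - 1 - j) (by omega)).differentiableAt
      rwa [show N - 1 - (N - 1 - j) = j by omega] at this
  have hα := fun k => (differentiableAt_relCoeff hdiff hM k).hasDerivAt
  set α := relCoeff fun j => X j s with hαdef
  set β := relCoeff fun j => Y j s with hβdef
  set α' : ℕ → ℂ := fun k => deriv (fun y => relCoeff (fun j => X j y) k) s with hα'
  have zα : ∀ k, N ≤ k → α k = 0 := fun k h => relCoeff_of_le _ h
  have zβ : ∀ k, N ≤ k → β k = 0 := fun k h => relCoeff_of_le _ h
  have rX : X N s + comb (fun j => X j s) α 0 = 0 := comb_relCoeff hM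
  have rY : Y N s + comb (fun j => Y j s) β 0 = 0 := comb_relCoeff hP
  -- Nonvanishing of the determinant is an open condition, so the relation holds near `s` and its
  -- derivative is zero.
  have hev : ∀ᶠ y in 𝓝 s, X N y + comb (fun j => X j y) (relCoeff fun j => X j y) 0 = 0 := by
    have hc : ContinuousAt (fun y => (colMatrix fun j => X j y).det) s :=
      (hasDerivAt_det fun i j =>
        (differentiableAt_pi.1 (hdiff (N - 1 - j) (by omega)) i).hasDerivAt).continuousAt
    filter_upwards [hc.eventually_ne hM] with y hy using comb_relCoeff hy
  have hD : HasDerivAt (fun y => X N y + comb (fun j => X j y) (relCoeff fun j => X j y) 0)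
      ((d 1 0 • X (N + 1) s + d 2 0 • X (N + 2) s + d 3 0 • X (N + 3) s + d 4 0 • X (N + 4) s)
        + ∑ k ∈ Finset.range N, (α k • (d 1 (k + 1) • X (N - 1 - k + 1) s
      + d 2 (k + 1) • X (N - 1 - k + 2) s + d 3 (k + 1) • X (N - 1 - k + 3) s
      + d 4 (k + 1) • X (N - 1 - k + 4) s) + α' k • X (N - 1 - k) s)) s := by
    refine h0.add (HasDerivAt.fun_sum fun k hk => ?_)
    exact (hα k).smul (hd k (Finset.mem_range.1 hk))
  have hz := hD.unique ((hasDerivAt_const s (0 : Fin N → ℂ)).congr_of_eventuallyEq hev)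
  have hsum : ∑ k ∈ Finset.range N, (α k • (d 1 (k + 1) • X (N - 1 - k + 1) s
      + d 2 (k + 1) • X (N - 1 - k + 2) s + d 3 (k + 1) • X (N - 1 - k + 3) s
      + d 4 (k + 1) • X (N - 1 - k + 4) s) + α' k • X (N - 1 - k) s)
      = comb (fun j => X j s) (fun k => α k * d 1 (k + 1)) 1
        + comb (fun j => X j s) (fun k => α k * d 2 (k + 1)) 2
        + comb (fun j => X j s) (fun k => α k * d 3 (k + 1)) 3
        + comb (fun j => X j s) (fun k => α k * d 4 (k + 1)) 4
        + comb (fun j => X j s) α' 0 := by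
    simp only [comb, ← Finset.sum_add_distrib, smul_add, smul_smul, add_zero]
  rw [hsum] at hz
  have z0 : ∀ e k, N ≤ k → α k * d e (k + 1) = 0 := fun e k h => by
    rw [zα _ (by omega), zero_mul]
  have z1 : ∀ e k, N ≤ k → α (k + 1) * d e (k + 1 + 1) = 0 := fun e k h => by
    rw [zα _ (by omega), zero_mul]
  have z2 : ∀ e k, N ≤ k → α (k + 1 + 1) * d e (k + 1 + 1 + 1) = 0 := fun e k h => by
    rw [zα _ (by omega), zero_mul]
  have z3 : ∀ e k, N ≤ k → α (k + 1 + 1 + 1) * d e (k + 1 + 1 + 1 + 1) = 0 := fun e k h => by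
    rw [zα _ (by omega), zero_mul]
  -- A sum whose degrees are raised by `i` is peeled `i` times, after which only `X (N+s)` with `s <
  -- i` and a combination of the basis remain.
  rw [comb_succ _ hN (z0 1), comb_succ _ hN (z0 2), comb_succ _ hN (z1 2),
    comb_succ _ hN (z0 3), comb_succ _ hN (z1 3), comb_succ _ hN (z2 3),
    comb_succ _ hN (z0 4), comb_succ _ hN (z1 4), comb_succ _ hN (z2 4),
    comb_succ _ hN (z3 4)] at hz
  have hc := fun {i : ℕ} (hi : i ≤ 4) => eq_comb_highCoord (X := fun j => X j s)
    (Y := fun j => Y j s) hN T hX hY zα zβ rX rY hi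
  have c0 := hc (i := 0) (by norm_num)
  have c1 := hc (i := 1) (by norm_num)
  have c2 := hc (i := 2) (by norm_num)
  have c3 := hc (i := 3) (by norm_num)
  have c4 := hc (i := 4) (by norm_num)
  simp only [add_zero] at c0
  simp only [add_zero, zero_add] at hz
  rw [c4, c3, c2, c1, c0] at hz
  have hv : comb (fun j => X j s) α' 0 = comb (fun j => X j s) (relVelocity d α β) 0 := by
    have : relVelocity d α β = fun k =>
      -(d 1 0 * highCoord α β 1 k + d 2 0 * highCoord α β 2 k + d 3 0 * highCoord α β 3 k
      + d 4 0 * highCoord α β 4 k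
    + (α 0 * d 1 1 * highCoord α β 0 k + α (k + 1) * d 1 (k + 1 + 1))
    + (α 0 * d 2 1 * highCoord α β 1 k + (α 1 * d 2 (1 + 1) * highCoord α β 0 k
      + α (k + 1 + 1) * d 2 (k + 1 + 1 + 1)))
    + (α 0 * d 3 1 * highCoord α β 2 k + (α 1 * d 3 (1 + 1) * highCoord α β 1 k
      + (α (1 + 1) * d 3 (1 + 1 + 1) * highCoord α β 0 k
      + α (k + 1 + 1 + 1) * d 3 (k + 1 + 1 + 1 + 1))))
    + (α 0 * d 4 1 * highCoord α β 3 k + (α 1 * d 4 (1 + 1) * highCoord α β 2 k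
      + (α (1 + 1) * d 4 (1 + 1 + 1) * highCoord α β 1 k
      + (α (1 + 1 + 1) * d 4 (1 + 1 + 1 + 1) * highCoord α β 0 k
      + α (k + 1 + 1 + 1 + 1) * d 4 (k + 1 + 1 + 1 + 1 + 1)))))) := by
      ext k; simp only [relVelocity]; ring_nf
    rw [this, comb_neg]
    simp only [comb_add, comb_smul]
    rw [← sub_eq_zero, sub_neg_eq_add, ← hz]
    abel
  have := comb_injective hM hv hk
  rw [← this]
  exact hα k

/-- Cramer's rule, read from `adjugate * matrix = det • 1`. -/
theorem det_updateCol_comb {Z : ℕ → Fin N → ℂ} (γ : ℕ → ℂ) (k : Fin N) :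
    ((colMatrix Z).updateCol k (comb Z γ 0)).det = γ k * (colMatrix Z).det := by
  have h := congrFun (Matrix.cramer_eq_adjugate_mulVec (colMatrix Z) (comb Z γ 0)) k
  rw [Matrix.cramer_apply] at h
  rw [h, ← colMatrix_mulVec, Matrix.mulVec_mulVec, Matrix.adjugate_mul]
  simp [Matrix.smul_mulVec, mul_comm]

/-- Also covers `N < 4`, where the surplus terms on the right vanish. -/
theorem sum_range_eq_four {F : ℕ → ℂ} (h4 : ∀ k, 4 ≤ k → F k = 0) (hF : ∀ k, N ≤ k → F k = 0) :
    ∑ k ∈ Finset.range N, F k = F 0 + F 1 + F 2 + F 3 := by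
  have e1 : ∑ k ∈ Finset.range N, F k = ∑ k ∈ Finset.range (N + 4), F k :=
    Finset.sum_subset (by simp) fun k _ hk => hF k (by simpa using hk)
  have e2 : ∑ k ∈ Finset.range 4, F k = ∑ k ∈ Finset.range (N + 4), F k :=
    Finset.sum_subset (by simp) fun k _ hk => h4 k (by simpa using hk)
  rw [e1, ← e2]
  simp [Finset.sum_range_succ]

/-- The velocity raises degrees by at most four, so outside the first four columns every replacement
duplicates a column. What survives is the part of the trace of the flow that comes from those
columns. -/
theorem hasDerivAt_det_colMatrix (hN : 1 ≤ N) (T : (Fin N → ℂ) →ₗ[ℂ] (Fin N → ℂ))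
    (hX : ∀ j, T (X j s) = Y (j + 1) s) (hY : ∀ j, T (Y j s) = X (j + 1) s) (d : ℕ → ℕ → ℂ)
    (hd : ∀ k < N, HasDerivAt (X (N - 1 - k)) (d 1 (k + 1) • X (N - 1 - k + 1) s
      + d 2 (k + 1) • X (N - 1 - k + 2) s + d 3 (k + 1) • X (N - 1 - k + 3) s
      + d 4 (k + 1) • X (N - 1 - k + 4) s) s)
    (hM : (colMatrix fun j => X j s).det ≠ 0) (hP : (colMatrix fun j => Y j s).det ≠ 0) :
    HasDerivAt (fun y => (colMatrix fun j => X j y).det)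
      ((colMatrix fun j => X j s).det *
        detVelocity d (relCoeff fun j => X j s) (relCoeff fun j => Y j s)) s := by
  set α := relCoeff fun j => X j s with hαdef
  set β := relCoeff fun j => Y j s with hβdef
  have zα : ∀ k, N ≤ k → α k = 0 := fun k h => relCoeff_of_le _ h
  have zβ : ∀ k, N ≤ k → β k = 0 := fun k h => relCoeff_of_le _ h
  have rX : X N s + comb (fun j => X j s) α 0 = 0 := comb_relCoeff hM
  have rY : Y N s + comb (fun j => Y j s) β 0 = 0 := comb_relCoeff hP
  have zh : ∀ i k, N ≤ k → highCoord α β i k = 0 := fun i k h => highCoord_of_le zα zβ i h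
  have h1 := hasDerivAt_det (A := fun y => colMatrix fun j => X j y)
    (A' := Matrix.of fun i k : Fin N => (d 1 (k + 1) • X (N - 1 - k + 1) s
      + d 2 (k + 1) • X (N - 1 - k + 2) s + d 3 (k + 1) • X (N - 1 - k + 3) s
      + d 4 (k + 1) • X (N - 1 - k + 4) s) i) (s := s)
    (fun i k => hasDerivAt_pi.1 (hd k k.2) i)
  refine h1.congr_deriv ?_
  -- Raising column `k` by `i+1` degrees either leaves the window, giving `X (N + (i-k))` whose
  -- `k`-th coordinate counts, or reproduces column `k-(i+1)` and kills the determinant.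
  have hcol : ∀ i ≤ 4, ∀ k : Fin N,
      ((colMatrix fun j => X j s).updateCol k (X (N - 1 - k + (i + 1)) s)).det
        = (if (k : ℕ) < i + 1 then highCoord α β (i - k) k else 0)
          * (colMatrix fun j => X j s).det := by
    intro i hi k
    split_ifs with h
    · have : N - 1 - (k : ℕ) + (i + 1) = N + (i - k) := by omega
      rw [this, eq_comb_highCoord (X := fun j => X j s) (Y := fun j => Y j s) hN T hX hY zα zβ rX rY
        (show i - (k : ℕ) ≤ 4 by omega), det_updateCol_comb]
    · rw [zero_mul]
      have hlt : (k : ℕ) - (i + 1) < N := by omega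
      refine Matrix.det_zero_of_column_eq (i := k) (j := ⟨k - (i + 1), hlt⟩)
        (fun e => by have := congrArg Fin.val e; simp at this; omega) fun l => ?_
      rw [Matrix.updateCol_self, Matrix.updateCol_ne
        (fun e => by have := congrArg Fin.val e; simp at this; omega)]
      simp only [colMatrix, Matrix.of_apply]
      congr 2; omega
  have hterm : ∀ k : Fin N, ((colMatrix fun j => X j s).updateCol k
      (fun i => (Matrix.of fun i k : Fin N => (d 1 (k + 1) • X (N - 1 - k + 1) s
      + d 2 (k + 1) • X (N - 1 - k + 2) s + d 3 (k + 1) • X (N - 1 - k + 3) s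
      + d 4 (k + 1) • X (N - 1 - k + 4) s) i) i k)).det
      = (colMatrix fun j => X j s).det *
        (d 1 (k + 1) * (if (k : ℕ) < 1 then highCoord α β (0 - k) k else 0)
        + d 2 (k + 1) * (if (k : ℕ) < 2 then highCoord α β (1 - k) k else 0)
        + d 3 (k + 1) * (if (k : ℕ) < 3 then highCoord α β (2 - k) k else 0)
        + d 4 (k + 1) * (if (k : ℕ) < 4 then highCoord α β (3 - k) k else 0)) := by
    intro k
    have e : (fun i => (Matrix.of fun i k : Fin N => (d 1 (k + 1) • X (N - 1 - k + 1) s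
      + d 2 (k + 1) • X (N - 1 - k + 2) s + d 3 (k + 1) • X (N - 1 - k + 3) s
      + d 4 (k + 1) • X (N - 1 - k + 4) s) i) i k) = d 1 (k + 1) • X (N - 1 - k + 1) s
      + d 2 (k + 1) • X (N - 1 - k + 2) s + d 3 (k + 1) • X (N - 1 - k + 3) s
      + d 4 (k + 1) • X (N - 1 - k + 4) s := rfl
    rw [e, Matrix.det_updateCol_add, Matrix.det_updateCol_add, Matrix.det_updateCol_add,
      Matrix.det_updateCol_smul, Matrix.det_updateCol_smul, Matrix.det_updateCol_smul,
      Matrix.det_updateCol_smul, hcol 0 (by norm_num), hcol 1 (by norm_num), hcol 2 (by norm_num),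
      hcol 3 (by norm_num)]
    simp only [Nat.reduceAdd]
    ring
  rw [Finset.sum_congr rfl fun k _ => hterm k, ← Finset.mul_sum]
  congr 1
  rw [Fin.sum_univ_eq_sum_range (fun k : ℕ =>
        (d 1 (k + 1) * (if k < 1 then highCoord α β (0 - k) k else 0)
        + d 2 (k + 1) * (if k < 2 then highCoord α β (1 - k) k else 0)
        + d 3 (k + 1) * (if k < 3 then highCoord α β (2 - k) k else 0)
        + d 4 (k + 1) * (if k < 4 then highCoord α β (3 - k) k else 0)))]
  rw [sum_range_eq_four]
  · simp [detVelocity]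
  · intro k hk
    rw [if_neg (by omega), if_neg (by omega), if_neg (by omega), if_neg (by omega)]
    ring
  · intro k hk
    simp [zh _ k hk]

end Flow

/-! ### Sequences of vectors moving by the Lax pair -/

/-- The vectors `X j`, `Y j` stand for `λ ^ j φ`, `λ ^ j ϕ` (for even `j`) and for
`λ ^ j ϕ`, `λ ^ j φ` (for odd `j`), with the matrix `T` as spectral parameter. -/
structure LaxSequence {N : ℕ} (ι : ℂ) (q r qx rx : ℝ → ℝ → ℂ) (Ω : Set (ℝ × ℝ))
    (T : (Fin N → ℂ) →ₗ[ℂ] (Fin N → ℂ)) (X Y : ℕ → ℝ → ℝ → Fin N → ℂ) : Prop where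
  mapX : ∀ j x t, (x, t) ∈ Ω → T (X j x t) = Y (j + 1) x t
  mapY : ∀ j x t, (x, t) ∈ Ω → T (Y j x t) = X (j + 1) x t
  even_x : ∀ j x t, (x, t) ∈ Ω → Even j →
    HasDerivAt (fun y => X j y t) (q x t • X (j + 1) x t + ι • X (j + 2) x t) x ∧
    HasDerivAt (fun y => Y j y t) (r x t • Y (j + 1) x t + (-ι) • Y (j + 2) x t) x
  odd_x : ∀ j x t, (x, t) ∈ Ω → ¬Even j →
    HasDerivAt (fun y => X j y t) (r x t • X (j + 1) x t + (-ι) • X (j + 2) x t) x ∧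
    HasDerivAt (fun y => Y j y t) (q x t • Y (j + 1) x t + ι • Y (j + 2) x t) x
  even_t : ∀ j x t, (x, t) ∈ Ω → Even j →
    HasDerivAt (fun s => X j x s) ((q x t ^ 2 * r x t - ι * qx x t) • X (j + 1) x t
      + (ι * (q x t * r x t)) • X (j + 2) x t + (2 * q x t) • X (j + 3) x t
      + (2 * ι) • X (j + 4) x t) t ∧
    HasDerivAt (fun s => Y j x s) ((r x t ^ 2 * q x t - -ι * rx x t) • Y (j + 1) x t
      + (-ι * (r x t * q x t)) • Y (j + 2) x t + (2 * r x t) • Y (j + 3) x t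
      + (2 * -ι) • Y (j + 4) x t) t
  odd_t : ∀ j x t, (x, t) ∈ Ω → ¬Even j →
    HasDerivAt (fun s => X j x s) ((r x t ^ 2 * q x t - -ι * rx x t) • X (j + 1) x t
      + (-ι * (r x t * q x t)) • X (j + 2) x t + (2 * r x t) • X (j + 3) x t
      + (2 * -ι) • X (j + 4) x t) t ∧
    HasDerivAt (fun s => Y j x s) ((q x t ^ 2 * r x t - ι * qx x t) • Y (j + 1) x t
      + (ι * (q x t * r x t)) • Y (j + 2) x t + (2 * q x t) • Y (j + 3) x t
      + (2 * ι) • Y (j + 4) x t) t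

/-- The coefficients of the `x`-flow. -/
def xFlow (ι q r : ℂ) (i k : ℕ) : ℂ :=
  if i = 1 then (if Even k then q else r) else if i = 2 then (if Even k then ι else -ι) else 0

/-- The coefficients of the `t`-flow. -/
def tFlow (ι q r qx rx : ℂ) (i k : ℕ) : ℂ :=
  if i = 1 then (if Even k then q ^ 2 * r - ι * qx else r ^ 2 * q - -ι * rx)
  else if i = 2 then (if Even k then ι * (q * r) else -ι * (r * q))
  else if i = 3 then (if Even k then 2 * q else 2 * r)
  else if i = 4 then (if Even k then 2 * ι else 2 * -ι) else 0

theorem relVelocity_of_le {N : ℕ} (d : ℕ → ℕ → ℂ) {α β : ℕ → ℂ} (hα : ∀ k, N ≤ k → α k = 0)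
    (hβ : ∀ k, N ≤ k → β k = 0) {k : ℕ} (hk : N ≤ k) : relVelocity d α β k = 0 := by
  have a : ∀ i, α (k + i) = 0 := fun i => hα _ (by omega)
  simp [relVelocity, highCoord_of_le hα hβ _ hk, a]

namespace LaxSequence

variable {N : ℕ} {ι : ℂ} {q r qx rx : ℝ → ℝ → ℂ} {Ω : Set (ℝ × ℝ)}
    {T : (Fin N → ℂ) →ₗ[ℂ] (Fin N → ℂ)} {X Y : ℕ → ℝ → ℝ → Fin N → ℂ}

/-- This symmetry derives every fact about `r`, `Y`, `β` from its counterpart for `q`, `X`, `α`. It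
is why the imaginary unit is a parameter `ι`. -/
theorem swap (S : LaxSequence ι q r qx rx Ω T X Y) :
    LaxSequence (-ι) r q rx qx Ω T Y X where
  mapX := S.mapY
  mapY := S.mapX
  even_x j x t h e := by simpa only [neg_neg] using (S.even_x j x t h e).symm
  odd_x j x t h e := by simpa only [neg_neg] using (S.odd_x j x t h e).symm
  even_t j x t h e := by simpa only [neg_neg] using (S.even_t j x t h e).symm
  odd_t j x t h e := by simpa only [neg_neg] using (S.odd_t j x t h e).symm

/-- The coefficients `α k` at a point of the plane. -/
def coeffAt (X : ℕ → ℝ → ℝ → Fin N → ℂ) (k : ℕ) (x t : ℝ) : ℂ := relCoeff (fun j => X j x t) k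

/-- The determinant of the columns `X (N-1), …, X 0` at a point of the plane. -/
def detAt (X : ℕ → ℝ → ℝ → Fin N → ℂ) (x t : ℝ) : ℂ := (colMatrix fun j => X j x t).det

/-- Since `N` is even, `X (N-1-k)` has the parity of `k+1`; this lets `xFlow` depend on the parity
of the column index alone. -/
theorem flow_x (S : LaxSequence ι q r qx rx Ω T X Y) (hN : 1 ≤ N) (hE : Even N) {x t : ℝ}
    (h : (x, t) ∈ Ω) (hM : detAt X x t ≠ 0) (hP : detAt Y x t ≠ 0) :
    (∀ k, HasDerivAt (fun y => coeffAt X k y t) (relVelocity (xFlow ι (q x t) (r x t))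
      (fun k => coeffAt X k x t) (fun k => coeffAt Y k x t) k) x) ∧
    HasDerivAt (fun y => detAt X y t) (detAt X x t * detVelocity (xFlow ι (q x t) (r x t))
      (fun k => coeffAt X k x t) (fun k => coeffAt Y k x t)) x := by
  have hd : ∀ k < N, HasDerivAt (fun y => X (N - 1 - k) y t)
      (xFlow ι (q x t) (r x t) 1 (k + 1) • X (N - 1 - k + 1) x t
      + xFlow ι (q x t) (r x t) 2 (k + 1) • X (N - 1 - k + 2) x t
      + xFlow ι (q x t) (r x t) 3 (k + 1) • X (N - 1 - k + 3) x t
      + xFlow ι (q x t) (r x t) 4 (k + 1) • X (N - 1 - k + 4) x t) x := by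
    intro k hk
    by_cases e : Even (N - 1 - k)
    · have e' : Even (k + 1) := by grind
      simpa [xFlow, e'] using (S.even_x _ x t h e).1
    · have e' : ¬Even (k + 1) := by grind
      simpa [xFlow, e'] using (S.odd_x _ x t h e).1
  refine ⟨fun k => ?_, ?_⟩
  · rcases lt_or_ge k N with hk | hk
    · refine hasDerivAt_relCoeff (X := fun j y => X j y t) (Y := fun j y => Y j y t) hN T
        (fun j => S.mapX j x t h) (fun j => S.mapY j x t h) _ ?_ hd hM hP hk
      simpa [xFlow] using (S.even_x _ x t h hE).1
    · rw [relVelocity_of_le (N := N) _ (fun k h => dif_neg (not_lt.2 h))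
        (fun k h => dif_neg (not_lt.2 h)) hk]
      simp only [coeffAt, relCoeff_of_le _ hk]
      exact hasDerivAt_const _ _
  · exact hasDerivAt_det_colMatrix (X := fun j y => X j y t) (Y := fun j y => Y j y t) hN T
        (fun j => S.mapX j x t h) (fun j => S.mapY j x t h) _ hd hM hP

theorem flow_t (S : LaxSequence ι q r qx rx Ω T X Y) (hN : 1 ≤ N) (hE : Even N) {x t : ℝ}
    (h : (x, t) ∈ Ω) (hM : detAt X x t ≠ 0) (hP : detAt Y x t ≠ 0) :
    HasDerivAt (fun s => coeffAt X 0 x s) (relVelocity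
      (tFlow ι (q x t) (r x t) (qx x t) (rx x t))
      (fun k => coeffAt X k x t) (fun k => coeffAt Y k x t) 0) t ∧
    HasDerivAt (fun s => detAt X x s) (detAt X x t * detVelocity
      (tFlow ι (q x t) (r x t) (qx x t) (rx x t))
      (fun k => coeffAt X k x t) (fun k => coeffAt Y k x t)) t := by
  have hd : ∀ k < N, HasDerivAt (fun s => X (N - 1 - k) x s)
      (tFlow ι (q x t) (r x t) (qx x t) (rx x t) 1 (k + 1) • X (N - 1 - k + 1) x t
      + tFlow ι (q x t) (r x t) (qx x t) (rx x t) 2 (k + 1) • X (N - 1 - k + 2) x t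
      + tFlow ι (q x t) (r x t) (qx x t) (rx x t) 3 (k + 1) • X (N - 1 - k + 3) x t
      + tFlow ι (q x t) (r x t) (qx x t) (rx x t) 4 (k + 1) • X (N - 1 - k + 4) x t) t := by
    intro k hk
    by_cases e : Even (N - 1 - k)
    · have e' : Even (k + 1) := by grind
      simpa only [tFlow, e', if_true, OfNat.ofNat_ne_one, if_false, OfNat.ofNat_eq_ofNat,
        Nat.reduceEqDiff] using (S.even_t _ x t h e).1
    · have e' : ¬Even (k + 1) := by grind
      simpa only [tFlow, e', if_true, OfNat.ofNat_ne_one, if_false, OfNat.ofNat_eq_ofNat,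
        Nat.reduceEqDiff] using (S.odd_t _ x t h e).1
  refine ⟨?_, ?_⟩
  · refine hasDerivAt_relCoeff (X := fun j s => X j x s) (Y := fun j s => Y j x s) hN T
        (fun j => S.mapX j x t h) (fun j => S.mapY j x t h) _ ?_ hd hM hP (by omega)
    simpa only [tFlow, Even.zero, if_true, OfNat.ofNat_ne_one, if_false, OfNat.ofNat_eq_ofNat,
        Nat.reduceEqDiff] using (S.even_t _ x t h hE).1
  · exact hasDerivAt_det_colMatrix (X := fun j s => X j x s) (Y := fun j s => Y j x s) hN T
        (fun j => S.mapX j x t h) (fun j => S.mapY j x t h) _ hd hM hP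

/-! ### The Kaup-Newell equation as a polynomial identity -/

/-- The logarithmic `x`-derivative of the quotient of the determinants. -/
def gauge (ι q r a0 b0 : ℂ) : ℂ := (q - 2 * ι * a0) * b0 - r * a0

/-- The `x`-derivative of `α 0`. -/
def coeffVel (ι q r a0 a1 a2 b0 b1 : ℂ) : ℂ :=
  2 * ι * a2 - gauge ι q r a0 b0 * a0 + (q - 2 * ι * a0) * b1 - q * a1

/-- The `x`-derivative of `α 1`. -/
def coeffVel' (ι q r a0 a1 a2 b0 b2 : ℂ) : ℂ :=
  -gauge ι q r a0 b0 * a1 + (q - 2 * ι * a0) * b2 - r * a2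

/-- The `x`-derivative of the transformed potential, up to the gauge factor. -/
def potentialVel (ι q r qx a0 a1 a2 b0 b1 : ℂ) : ℂ :=
  qx - 2 * ι * coeffVel ι q r a0 a1 a2 b0 b1 + 2 * gauge ι q r a0 b0 * (q - 2 * ι * a0)

/-- The transformed potential. -/
def newPotential (ι : ℂ) (q : ℝ → ℝ → ℂ) (X Y : ℕ → ℝ → ℝ → Fin N → ℂ) (x t : ℝ) : ℂ :=
  (detAt X x t / detAt Y x t) ^ 2 * (q x t - 2 * ι * coeffAt X 0 x t)

/-- The velocity of `α 0` contains `α 1` and `α 2`, so its second derivative needs their velocities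
as well; this brings in `α 3`, `α 4` and `β 3`. -/
theorem coeff_x (S : LaxSequence ι q r qx rx Ω T X Y) (hN : 1 ≤ N) (hE : Even N) {x t : ℝ}
    (h : (x, t) ∈ Ω) (hM : detAt X x t ≠ 0) (hP : detAt Y x t ≠ 0) :
    HasDerivAt (fun y => coeffAt X 0 y t) (coeffVel ι (q x t) (r x t) (coeffAt X 0 x t)
      (coeffAt X 1 x t) (coeffAt X 2 x t) (coeffAt Y 0 x t) (coeffAt Y 1 x t)) x ∧
    HasDerivAt (fun y => coeffAt X 1 y t) (coeffVel' ι (q x t) (r x t) (coeffAt X 0 x t)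
      (coeffAt X 1 x t) (coeffAt X 2 x t) (coeffAt Y 0 x t) (coeffAt Y 2 x t)) x ∧
    HasDerivAt (fun y => coeffAt X 2 y t) (2 * ι * coeffAt X 4 x t
      - gauge ι (q x t) (r x t) (coeffAt X 0 x t) (coeffAt Y 0 x t) * coeffAt X 2 x t
      + (q x t - 2 * ι * coeffAt X 0 x t) * coeffAt Y 3 x t - q x t * coeffAt X 3 x t) x := by
  obtain ⟨h1, -⟩ := S.flow_x hN hE h hM hP
  refine ⟨(h1 0).congr_deriv ?_, (h1 1).congr_deriv ?_, (h1 2).congr_deriv ?_⟩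
  · simp [relVelocity, highCoord, xFlow, Nat.even_add_one, coeffVel, gauge]; ring
  · simp [relVelocity, highCoord, xFlow, Nat.even_add_one, coeffVel', gauge]; ring
  · simp [relVelocity, highCoord, xFlow, Nat.even_add_one, gauge]; ring

theorem ratio_x (S : LaxSequence ι q r qx rx Ω T X Y) (hN : 1 ≤ N) (hE : Even N) {x t : ℝ}
    (h : (x, t) ∈ Ω) (hM : detAt X x t ≠ 0) (hP : detAt Y x t ≠ 0) :
    HasDerivAt (fun y => (detAt X y t / detAt Y y t) ^ 2)
      (2 * gauge ι (q x t) (r x t) (coeffAt X 0 x t) (coeffAt Y 0 x t)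
        * (detAt X x t / detAt Y x t) ^ 2) x := by
  obtain ⟨-, h1⟩ := S.flow_x hN hE h hM hP
  obtain ⟨-, h2⟩ := S.swap.flow_x hN hE h hP hM
  refine ((h1.div h2 hP).pow 2).congr_deriv ?_
  -- The logarithmic derivative of a quotient is the difference of the two logarithmic derivatives,
  -- the second obtained through `swap`.
  have : gauge ι (q x t) (r x t) (coeffAt X 0 x t) (coeffAt Y 0 x t) =
      detVelocity (xFlow ι (q x t) (r x t)) (fun k => coeffAt X k x t) (fun k => coeffAt Y k x t)
      - detVelocity (xFlow (-ι) (r x t) (q x t)) (fun k => coeffAt Y k x t)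
        (fun k => coeffAt X k x t) := by
    simp [detVelocity, highCoord, xFlow, Nat.even_add_one, gauge]; ring
  rw [this]
  norm_num
  field_simp

theorem newPotential_x (S : LaxSequence ι q r qx rx Ω T X Y) (hN : 1 ≤ N) (hE : Even N)
    {x t : ℝ} (h : (x, t) ∈ Ω) (hM : detAt X x t ≠ 0) (hP : detAt Y x t ≠ 0)
    (hq : HasDerivAt (fun y => q y t) (qx x t) x) :
    HasDerivAt (fun y => newPotential ι q X Y y t) ((detAt X x t / detAt Y x t) ^ 2 *
      potentialVel ι (q x t) (r x t) (qx x t) (coeffAt X 0 x t)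
      (coeffAt X 1 x t) (coeffAt X 2 x t) (coeffAt Y 0 x t) (coeffAt Y 1 x t)) x := by
  refine ((S.ratio_x hN hE h hM hP).mul
    (hq.sub ((S.coeff_x hN hE h hM hP).1.const_mul (2 * ι)))).congr_deriv ?_
  simp only [potentialVel, Pi.sub_apply]
  ring

/-- The logarithmic `t`-derivative of the quotient of the determinants. -/
def gaugeT (ι q r qx rx : ℂ) (α β : ℕ → ℂ) : ℂ :=
  detVelocity (tFlow ι q r qx rx) α β - detVelocity (tFlow (-ι) r q rx qx) β α

/-- With the gauge factor removed, the equation for the new potential coincides with the one for the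
old: after insertion of all velocities every `α k` and `β k` cancels, using only `ι² = -1`. The
primed unknowns stand for derivatives and are eliminated at the end. -/
theorem transformed_equation (ι q r qx rx qxx qt : ℂ) (α β : ℕ → ℂ) (hι : ι ^ 2 = -1)
    (hq : ι * qt - qxx - ι * (2 * q * qx * r + q ^ 2 * rx) = 0)
    (a0' a1' a2' b0' b1' u u' v' g gr : ℂ)
    (ha0 : a0' = coeffVel ι q r (α 0) (α 1) (α 2) (β 0) (β 1))
    (ha1 : a1' = coeffVel' ι q r (α 0) (α 1) (α 2) (β 0) (β 2))
    (ha2 : a2' = 2 * ι * α 4 - gauge ι q r (α 0) (β 0) * α 2 + (q - 2 * ι * α 0) * β 3 - q * α 3)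
    (hb0 : b0' = coeffVel (-ι) r q (β 0) (β 1) (β 2) (α 0) (α 1))
    (hb1 : b1' = coeffVel' (-ι) r q (β 0) (β 1) (β 2) (α 0) (α 2))
    (hu : u = gauge ι q r (α 0) (β 0))
    (hu' : u' = (qx - 2 * ι * a0') * β 0 + (q - 2 * ι * α 0) * b0' - (rx * α 0 + r * a0'))
    (hv' : v' = 2 * ι * a2' - (u' * α 0 + u * a0') + ((qx - 2 * ι * a0') * β 1
      + (q - 2 * ι * α 0) * b1') - (qx * α 1 + q * a1'))
    (hg : g = potentialVel ι q r qx (α 0) (α 1) (α 2) (β 0) (β 1))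
    (hgr : gr = potentialVel (-ι) r q rx (β 0) (β 1) (β 2) (α 0) (α 1)) :
    ι * (2 * gaugeT ι q r qx rx α β * (q - 2 * ι * α 0)
        + (qt - 2 * ι * relVelocity (tFlow ι q r qx rx) α β 0))
      - (2 * u * g + (qxx - 2 * ι * v' + 2 * (u' * (q - 2 * ι * α 0) + u * (qx - 2 * ι * a0'))))
      - ι * (2 * (q - 2 * ι * α 0) * g * (r - 2 * -ι * β 0) + (q - 2 * ι * α 0) ^ 2 * gr) = 0 := by
  have h3 : ι ^ 3 = -ι := by rw [pow_succ, hι]; ring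
  have h4 : ι ^ 4 = 1 := by rw [show ι ^ 4 = (ι ^ 2) ^ 2 by ring, hι]; ring
  have h5 : ι ^ 5 = ι := by rw [pow_succ, h4]; ring
  simp only [potentialVel] at hg hgr
  rw [← hu, ← ha0] at hg
  rw [← hb0] at hgr
  -- The swap inverts the quotient of the determinants, so its logarithmic derivative changes sign.
  have hu2 : gauge (-ι) r q (β 0) (α 0) = -u := by rw [hu]; simp only [gauge]; ring
  rw [hu2] at hgr
  simp only [coeffVel, coeffVel', hu2, ← hu] at ha0 ha1 ha2 hb0 hb1
  simp only [gauge] at hu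
  simp only [gaugeT, detVelocity, relVelocity, highCoord, tFlow, Nat.even_add_one, even_two,
    Nat.reduceAdd, Nat.reduceEqDiff, OfNat.ofNat_ne_one, if_true, if_false,
    Even.zero, OfNat.one_ne_ofNat,
    not_true_eq_false, not_false_eq_true]
  subst hg hgr hv' hu' ha0 ha1 ha2 hb0 hb1 hu
  refine Eq.trans ?_ hq
  ring_nf
  simp only [hι, h3, h4, h5]
  ring

theorem newPotential_xx (S : LaxSequence ι q r qx rx Ω T X Y) (hN : 1 ≤ N) (hE : Even N)
    {x t : ℝ} (h : (x, t) ∈ Ω) (hM : detAt X x t ≠ 0) (hP : detAt Y x t ≠ 0) {qxx a0' a1' a2' b0' b1' u u' v' : ℂ}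
    (hq : HasDerivAt (fun y => q y t) (qx x t) x) (hr : HasDerivAt (fun y => r y t) (rx x t) x)
    (hqx : HasDerivAt (fun y => qx y t) qxx x)
    (a0 : HasDerivAt (fun y => coeffAt X 0 y t) a0' x)
    (a1 : HasDerivAt (fun y => coeffAt X 1 y t) a1' x)
    (a2 : HasDerivAt (fun y => coeffAt X 2 y t) a2' x)
    (b0 : HasDerivAt (fun y => coeffAt Y 0 y t) b0' x)
    (b1 : HasDerivAt (fun y => coeffAt Y 1 y t) b1' x)
    (hu : u = gauge ι (q x t) (r x t) (coeffAt X 0 x t) (coeffAt Y 0 x t))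
    (hu' : u' = (qx x t - 2 * ι * a0') * coeffAt Y 0 x t + (q x t - 2 * ι * coeffAt X 0 x t) * b0'
      - (rx x t * coeffAt X 0 x t + r x t * a0'))
    (hv' : v' = 2 * ι * a2' - (u' * coeffAt X 0 x t + u * a0')
      + ((qx x t - 2 * ι * a0') * coeffAt Y 1 x t
      + (q x t - 2 * ι * coeffAt X 0 x t) * b1') - (qx x t * coeffAt X 1 x t + q x t * a1')) :
    HasDerivAt (fun y => (detAt X y t / detAt Y y t) ^ 2 *
      potentialVel ι (q y t) (r y t) (qx y t) (coeffAt X 0 y t)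
      (coeffAt X 1 y t) (coeffAt X 2 y t) (coeffAt Y 0 y t) (coeffAt Y 1 y t))
      ((detAt X x t / detAt Y x t) ^ 2 * (2 * u * potentialVel ι (q x t) (r x t) (qx x t)
        (coeffAt X 0 x t) (coeffAt X 1 x t) (coeffAt X 2 x t) (coeffAt Y 0 x t) (coeffAt Y 1 x t)
        + (qxx - 2 * ι * v' + 2 * (u' * (q x t - 2 * ι * coeffAt X 0 x t)
          + u * (qx x t - 2 * ι * a0'))))) x := by
  have du : HasDerivAt
      (fun y => gauge ι (q y t) (r y t) (coeffAt X 0 y t) (coeffAt Y 0 y t)) u' x :=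
    (((hq.sub (a0.const_mul (2 * ι))).mul b0).sub (hr.mul a0)).congr_deriv hu'.symm
  have dv : HasDerivAt (fun y => coeffVel ι (q y t) (r y t) (coeffAt X 0 y t)
      (coeffAt X 1 y t) (coeffAt X 2 y t) (coeffAt Y 0 y t) (coeffAt Y 1 y t)) v' x :=
    ((((a2.const_mul (2 * ι)).sub (du.mul a0)).add
      ((hq.sub (a0.const_mul (2 * ι))).mul b1)).sub (hq.mul a1)).congr_deriv (by rw [hv', hu]; rfl)
  have dg := (hqx.sub (dv.const_mul (2 * ι))).add
      ((du.const_mul 2).mul (hq.sub (a0.const_mul (2 * ι))))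
  refine ((S.ratio_x hN hE h hM hP).mul dg).congr_deriv ?_
  simp only [Pi.add_apply, Pi.sub_apply, Pi.mul_apply, potentialVel, hu]
  ring

theorem ratio_t (S : LaxSequence ι q r qx rx Ω T X Y) (hN : 1 ≤ N) (hE : Even N) {x t : ℝ}
    (h : (x, t) ∈ Ω) (hM : detAt X x t ≠ 0) (hP : detAt Y x t ≠ 0) :
    HasDerivAt (fun s => (detAt X x s / detAt Y x s) ^ 2)
      (2 * gaugeT ι (q x t) (r x t) (qx x t) (rx x t) (fun k => coeffAt X k x t)
        (fun k => coeffAt Y k x t) * (detAt X x t / detAt Y x t) ^ 2) t := by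
  obtain ⟨-, h1⟩ := S.flow_t hN hE h hM hP
  obtain ⟨-, h2⟩ := S.swap.flow_t hN hE h hP hM
  refine ((h1.div h2 hP).pow 2).congr_deriv ?_
  rw [gaugeT]
  norm_num
  field_simp

theorem kaupNewell_newPotential (S : LaxSequence ι q r qx rx Ω T X Y) (hN : 1 ≤ N) (hE : Even N)
    (hι : ι ^ 2 = -1) (hΩ : IsOpen Ω)
    (hdet : ∀ x t, (x, t) ∈ Ω → detAt X x t ≠ 0 ∧ detAt Y x t ≠ 0)
    (hq : ∀ x t, (x, t) ∈ Ω → HasDerivAt (fun y => q y t) (qx x t) x)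
    (hr : ∀ x t, (x, t) ∈ Ω → HasDerivAt (fun y => r y t) (rx x t) x)
    {qxx qt : ℝ → ℝ → ℂ}
    (hqx : ∀ x t, (x, t) ∈ Ω → HasDerivAt (fun y => qx y t) (qxx x t) x)
    (hqt : ∀ x t, (x, t) ∈ Ω → HasDerivAt (fun s => q x s) (qt x t) t)
    (hKN : ∀ x t, (x, t) ∈ Ω → ι * qt x t - qxx x t
      - ι * (2 * q x t * qx x t * r x t + q x t ^ 2 * rx x t) = 0)
    {x t : ℝ} (h : (x, t) ∈ Ω) :
    ι * deriv (fun s => newPotential ι q X Y x s) t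
      - deriv (deriv (fun y => newPotential ι q X Y y t)) x
      - ι * deriv (fun y => newPotential ι q X Y y t ^ 2 * newPotential (-ι) r Y X y t) x = 0 := by
  obtain ⟨hM, hP⟩ := hdet x t h
  obtain ⟨a0, a1, a2⟩ := S.coeff_x hN hE h hM hP
  obtain ⟨b0, b1, -⟩ := S.swap.coeff_x hN hE h hP hM
  have d1 := S.newPotential_x hN hE h hM hP (hq x t h)
  have d1' := S.swap.newPotential_x hN hE h hP hM (hr x t h)
  -- To differentiate a second time, the formula for the first derivative is needed on a
  -- neighbourhood; this is where openness of `Ω` enters.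
  have hev : deriv (fun y => newPotential ι q X Y y t) =ᶠ[𝓝 x]
      fun y => (detAt X y t / detAt Y y t) ^ 2 *
      potentialVel ι (q y t) (r y t) (qx y t) (coeffAt X 0 y t)
      (coeffAt X 1 y t) (coeffAt X 2 y t) (coeffAt Y 0 y t) (coeffAt Y 1 y t) := by
    have : ∀ᶠ y in 𝓝 x, (y, t) ∈ Ω :=
      (Continuous.prodMk_left t).continuousAt.eventually_mem (hΩ.mem_nhds h)
    filter_upwards [this] with y hy
    exact (S.newPotential_x hN hE hy (hdet y t hy).1 (hdet y t hy).2 (hq y t hy)).deriv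
  have d2 := S.newPotential_xx hN hE h hM hP (hq x t h) (hr x t h) (hqx x t h) a0 a1 a2 b0 b1
    rfl rfl rfl
  obtain ⟨at0, -⟩ := S.flow_t hN hE h hM hP
  have dt : HasDerivAt (fun s => newPotential ι q X Y x s) _ t :=
    (S.ratio_t hN hE h hM hP).mul ((hqt x t h).sub (at0.const_mul (2 * ι)))
  have d3 : HasDerivAt (fun y => newPotential ι q X Y y t ^ 2 * newPotential (-ι) r Y X y t) _ x :=
    (d1.pow 2).mul d1'
  rw [hev.deriv_eq, d2.deriv, dt.deriv, d3.deriv]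
  have key := transformed_equation ι (q x t) (r x t) (qx x t) (rx x t) (qxx x t) (qt x t)
    (fun k => coeffAt X k x t) (fun k => coeffAt Y k x t) hι (hKN x t h)
    _ _ _ _ _ _ _ _ _ _ rfl rfl rfl rfl rfl rfl rfl rfl rfl rfl
  -- The two potentials carry inverse gauge factors, so the cubic term has the same overall factor
  -- as the linear ones.
  have hAB : (detAt X x t / detAt Y x t) ^ 2 * (detAt Y x t / detAt X x t) ^ 2 = 1 := by
    field_simp
  simp only [newPotential, Pi.pow_apply]
  linear_combination (norm := skip) (detAt X x t / detAt Y x t) ^ 2 * key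
    - ι * (detAt X x t / detAt Y x t) ^ 2 * (2 * (q x t - 2 * ι * coeffAt X 0 x t)
      * potentialVel ι (q x t) (r x t) (qx x t) (coeffAt X 0 x t) (coeffAt X 1 x t)
        (coeffAt X 2 x t) (coeffAt Y 0 x t) (coeffAt Y 1 x t)
      * (r x t - 2 * -ι * coeffAt Y 0 x t) + (q x t - 2 * ι * coeffAt X 0 x t) ^ 2
      * potentialVel (-ι) (r x t) (q x t) (rx x t) (coeffAt Y 0 x t) (coeffAt Y 1 x t)
        (coeffAt Y 2 x t) (coeffAt X 0 x t) (coeffAt X 1 x t)) * hAB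
  generalize (detAt X x t / detAt Y x t) ^ 2 = A at *
  generalize (detAt Y x t / detAt X x t) ^ 2 = B at *
  ring

end LaxSequence

/-! ### Taylor coefficients of holomorphic families -/

/-- The Taylor coefficient of order `d` of `g` at `μ`. -/
def taylorCoeff (d : ℕ) (μ : ℂ) (g : ℂ → ℂ) : ℂ :=
  iteratedDeriv d (fun ε : ℂ => g (μ + ε)) 0 / (d.factorial : ℂ)

theorem taylorCoeff_eq (d : ℕ) (μ : ℂ) (g : ℂ → ℂ) :
    taylorCoeff d μ g = iteratedDeriv d g μ / (d.factorial : ℂ) := by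
  simp [taylorCoeff, iteratedDeriv_comp_const_add]

theorem taylorCoeff_zero (μ : ℂ) (g : ℂ → ℂ) : taylorCoeff 0 μ g = g μ := by
  simp [taylorCoeff_eq]

theorem taylorCoeff_congr {d : ℕ} {μ : ℂ} {g h : ℂ → ℂ} (e : g =ᶠ[𝓝 μ] h) :
    taylorCoeff d μ g = taylorCoeff d μ h := by
  rw [taylorCoeff_eq, taylorCoeff_eq, e.iteratedDeriv_eq]

/-- A domain on which Taylor coefficients of order `d` at `μ` make sense. -/
def Admissible (D : Set ℂ) (μ : ℂ) (d : ℕ) : Prop := μ ∈ D ∧ (d = 0 ∨ IsOpen D)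

theorem contDiffAt_of_differentiableOn {D : Set ℂ} (hD : IsOpen D) {μ : ℂ} (hμ : μ ∈ D)
    {g : ℂ → ℂ} (hg : DifferentiableOn ℂ g D) {n : WithTop ℕ∞} : ContDiffAt ℂ n g μ :=
  (hg.analyticAt (hD.mem_nhds hμ)).contDiffAt

theorem taylorCoeff_add {D : Set ℂ} {μ : ℂ} {d : ℕ} (hD : Admissible D μ d) {g h : ℂ → ℂ}
    (hg : DifferentiableOn ℂ g D) (hh : DifferentiableOn ℂ h D) :
    taylorCoeff d μ (fun z => g z + h z) = taylorCoeff d μ g + taylorCoeff d μ h := by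
  obtain ⟨hμ, rfl | hD⟩ := hD
  · simp [taylorCoeff_zero]
  · rw [taylorCoeff_eq, taylorCoeff_eq, taylorCoeff_eq, iteratedDeriv_fun_add
      (contDiffAt_of_differentiableOn hD hμ hg) (contDiffAt_of_differentiableOn hD hμ hh), add_div]

theorem taylorCoeff_const_mul {μ : ℂ} {d : ℕ} (c : ℂ) (g : ℂ → ℂ) :
    taylorCoeff d μ (fun z => c * g z) = c * taylorCoeff d μ g := by
  rw [taylorCoeff_eq, taylorCoeff_eq, iteratedDeriv_const_mul_field, mul_div_assoc]

/-- Write `z = μ + (z - μ)`: multiplication by `z` is a Jordan block on Taylor coefficients. This is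
what replaces the diagonal matrix of spectral parameters. -/
theorem taylorCoeff_id_mul {D : Set ℂ} {μ : ℂ} {d : ℕ} (hD : Admissible D μ d) {g : ℂ → ℂ}
    (hg : DifferentiableOn ℂ g D) :
    taylorCoeff d μ (fun z => z * g z) =
      μ * taylorCoeff d μ g + if d = 0 then 0 else taylorCoeff (d - 1) μ g := by
  obtain ⟨hμ, rfl | hD⟩ := hD
  · simp [taylorCoeff_zero]
  · have key : ∀ d, ∀ g : ℂ → ℂ, DifferentiableOn ℂ g D → ∀ z ∈ D,
        iteratedDeriv (d + 1) (fun z => z * g z) z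
          = z * iteratedDeriv (d + 1) g z + (d + 1) * iteratedDeriv d g z := by
      intro d
      induction d with
      | zero =>
        intro g hg z hz
        have := (hg.differentiableAt (hD.mem_nhds hz))
        simp only [zero_add, iteratedDeriv_one, iteratedDeriv_zero]
        refine ((hasDerivAt_id' z).mul this.hasDerivAt).deriv.trans ?_
        simp; ring
      | succ d ih =>
        intro g hg z hz
        rw [iteratedDeriv_succ]
        have e : iteratedDeriv (d + 1) (fun z => z * g z) =ᶠ[𝓝 z] fun z =>
            z * iteratedDeriv (d + 1) g z + (d + 1) * iteratedDeriv d g z := by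
          filter_upwards [hD.mem_nhds hz] with w hw using ih g hg w hw
        have h1 : ∀ k, HasDerivAt (iteratedDeriv k g) (iteratedDeriv (k + 1) g z) z := fun k => by
          rw [iteratedDeriv_succ, hasDerivAt_deriv_iff, iteratedDeriv_eq_iterate]
          exact ((hg.analyticAt (hD.mem_nhds hz)).iterated_deriv k).differentiableAt
        rw [e.deriv_eq]
        refine (((hasDerivAt_id' z).mul (h1 (d + 1))).add ((h1 d).const_mul _)).deriv.trans ?_
        push_cast
        ring
    cases d with
    | zero => simp [taylorCoeff_zero]
    | succ d =>
      rw [taylorCoeff_eq, taylorCoeff_eq, taylorCoeff_eq, key d g hg μ hμ, Nat.factorial_succ]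
      have h1 : ((d.factorial : ℕ) : ℂ) ≠ 0 := by exact_mod_cast d.factorial_ne_zero
      have h2 : (d : ℂ) + 1 ≠ 0 := by exact_mod_cast d.succ_ne_zero
      simp only [Nat.add_eq_zero_iff, one_ne_zero, and_false, if_false, Nat.add_sub_cancel]
      push_cast
      field_simp

/-! ### Differentiating Taylor coefficients along the plane -/

/-- `G x t z` is smooth on `Ω × D` and holomorphic in `z`. -/
structure HolomorphicFamily (Ω : Set (ℝ × ℝ)) (D : Set ℂ) (G : ℝ → ℝ → ℂ → ℂ) : Prop where
  smooth : ContDiffOn ℝ ∞ (fun w : (ℝ × ℝ) × ℂ => G w.1.1 w.1.2 w.2) (Ω ×ˢ D)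
  holomorphic : ∀ x t : ℝ, (x, t) ∈ Ω → DifferentiableOn ℂ (G x t) D

namespace HolomorphicFamily

variable {Ω : Set (ℝ × ℝ)} {D : Set ℂ} {G G' : ℝ → ℝ → ℂ → ℂ}

/-- The complex derivative is the real directional derivative along `1`. Through this identity,
joint real smoothness passes to the derivative in `z`. -/
theorem fderiv_z (hG : HolomorphicFamily Ω D G) (hΩ : IsOpen Ω) (hD : IsOpen D)
    {x t : ℝ} (h : (x, t) ∈ Ω) {z : ℂ} (hz : z ∈ D) :
    fderiv ℝ (fun w : (ℝ × ℝ) × ℂ => G w.1.1 w.1.2 w.2) ((x, t), z) (0, 1)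
      = deriv (G x t) z := by
  have h1 : HasFDerivAt (fun w : (ℝ × ℝ) × ℂ => G w.1.1 w.1.2 w.2)
      (fderiv ℝ (fun w : (ℝ × ℝ) × ℂ => G w.1.1 w.1.2 w.2) ((x, t), z)) ((x, t), z) :=
    ((hG.smooth.contDiffAt ((hΩ.prod hD).mem_nhds ⟨h, hz⟩)).differentiableAt
      (by simp)).hasFDerivAt
  have h2 : HasFDerivAt (fun z : ℂ => (((x, t), z) : (ℝ × ℝ) × ℂ))
      ((0 : ℂ →L[ℝ] ℝ × ℝ).prod (ContinuousLinearMap.id ℝ ℂ)) z :=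
    (hasFDerivAt_const _ _).prodMk (hasFDerivAt_id z)
  have h3 := h1.comp z h2
  have h4 := ((hG.holomorphic x t h).differentiableAt
    (hD.mem_nhds hz)).hasDerivAt.hasFDerivAt.restrictScalars ℝ
  have := congrArg (fun L : ℂ →L[ℝ] ℂ => L 1) (h3.unique h4)
  simpa using this

theorem deriv_family (hG : HolomorphicFamily Ω D G) (hΩ : IsOpen Ω) (hD : IsOpen D) :
    HolomorphicFamily Ω D (fun x t => deriv (G x t)) where
  smooth := by
    have := (hG.smooth.fderiv_of_isOpen (hΩ.prod hD) (m := ∞) (by simp)).clm_apply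
      (contDiffOn_const (c := ((0, 1) : (ℝ × ℝ) × ℂ)))
    exact this.congr fun w hw => (hG.fderiv_z hΩ hD hw.1 hw.2).symm
  holomorphic x t h := (hG.holomorphic x t h).deriv hD

theorem fderiv_x (hG : HolomorphicFamily Ω D G) (hΩ : IsOpen Ω) (hD : IsOpen D)
    {x t : ℝ} (h : (x, t) ∈ Ω) {z : ℂ} (hz : z ∈ D) :
    HasDerivAt (fun y => G y t z)
      (fderiv ℝ (fun w : (ℝ × ℝ) × ℂ => G w.1.1 w.1.2 w.2) ((x, t), z) ((1, 0), 0)) x := by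
  have h1 : HasFDerivAt (fun w : (ℝ × ℝ) × ℂ => G w.1.1 w.1.2 w.2)
      (fderiv ℝ (fun w : (ℝ × ℝ) × ℂ => G w.1.1 w.1.2 w.2) ((x, t), z)) ((x, t), z) :=
    ((hG.smooth.contDiffAt ((hΩ.prod hD).mem_nhds ⟨h, hz⟩)).differentiableAt
      (by simp)).hasFDerivAt
  have h2 : HasDerivAt (fun y : ℝ => (((y, t), z) : (ℝ × ℝ) × ℂ)) ((1, 0), 0) x :=
    ((hasDerivAt_id x).prodMk (hasDerivAt_const _ _)).prodMk (hasDerivAt_const _ _)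
  exact h1.comp_hasDerivAt x h2

theorem fderiv_t (hG : HolomorphicFamily Ω D G) (hΩ : IsOpen Ω) (hD : IsOpen D)
    {x t : ℝ} (h : (x, t) ∈ Ω) {z : ℂ} (hz : z ∈ D) :
    HasDerivAt (fun s => G x s z)
      (fderiv ℝ (fun w : (ℝ × ℝ) × ℂ => G w.1.1 w.1.2 w.2) ((x, t), z) ((0, 1), 0)) t := by
  have h1 : HasFDerivAt (fun w : (ℝ × ℝ) × ℂ => G w.1.1 w.1.2 w.2)
      (fderiv ℝ (fun w : (ℝ × ℝ) × ℂ => G w.1.1 w.1.2 w.2) ((x, t), z)) ((x, t), z) :=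
    ((hG.smooth.contDiffAt ((hΩ.prod hD).mem_nhds ⟨h, hz⟩)).differentiableAt
      (by simp)).hasFDerivAt
  have h2 : HasDerivAt (fun s : ℝ => (((x, s), z) : (ℝ × ℝ) × ℂ)) ((0, 1), 0) t :=
    ((hasDerivAt_const _ _).prodMk (hasDerivAt_id t)).prodMk (hasDerivAt_const _ _)
  exact h1.comp_hasDerivAt t h2

/-- Derivatives in a direction of the plane commute with complex derivatives. -/
theorem fderiv_deriv (hG : HolomorphicFamily Ω D G) (hΩ : IsOpen Ω) (hD : IsOpen D) (v : ℝ × ℝ)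
    (hG' : ∀ x t : ℝ, (x, t) ∈ Ω → DifferentiableOn ℂ (G' x t) D)
    (hv : ∀ x t : ℝ, (x, t) ∈ Ω → ∀ z ∈ D,
      fderiv ℝ (fun w : (ℝ × ℝ) × ℂ => G w.1.1 w.1.2 w.2) ((x, t), z) (v, 0) = G' x t z)
    {x t : ℝ} (h : (x, t) ∈ Ω) {z : ℂ} (hz : z ∈ D) :
    fderiv ℝ (fun w : (ℝ × ℝ) × ℂ => deriv (G w.1.1 w.1.2) w.2) ((x, t), z) (v, 0)
      = deriv (G' x t) z := by
  set F : (ℝ × ℝ) × ℂ → ℂ := fun w => G w.1.1 w.1.2 w.2 with hF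
  have hU := (hΩ.prod hD)
  have hFG' : HolomorphicFamily Ω D G' := by
    refine ⟨?_, hG'⟩
    have := (hG.smooth.fderiv_of_isOpen hU (m := ∞) (by simp)).clm_apply
      (contDiffOn_const (c := ((v, 0) : (ℝ × ℝ) × ℂ)))
    exact this.congr fun w hw => (hv _ _ hw.1 _ hw.2).symm
  have hmem := hU.mem_nhds (show ((x, t), z) ∈ Ω ×ˢ D from ⟨h, hz⟩)
  have hFat : ContDiffAt ℝ ∞ F ((x, t), z) := hG.smooth.contDiffAt hmem
  -- Both sides are second real derivatives of `F`, in the directions `(v, 0)` and `(0, 1)`, so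
  -- symmetry of the second derivative finishes the proof.
  have hsymm : IsSymmSndFDerivAt ℝ F ((x, t), z) := hFat.isSymmSndFDerivAt (by
    rw [minSmoothness_of_isRCLikeNormedField]; exact WithTop.coe_le_coe.2 (le_top : (2 : ℕ∞) ≤ ⊤))
  have hdd : DifferentiableAt ℝ (fderiv ℝ F) ((x, t), z) :=
    (hFat.fderiv_right (m := ∞) (by simp)).differentiableAt (by simp)
  have e1 : (fun w : (ℝ × ℝ) × ℂ => deriv (G w.1.1 w.1.2) w.2) =ᶠ[𝓝 ((x, t), z)]
      fun w => fderiv ℝ F w (0, 1) := by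
    filter_upwards [hmem] with w hw using (hG.fderiv_z hΩ hD hw.1 hw.2).symm
  have e2 : (fun w : (ℝ × ℝ) × ℂ => G' w.1.1 w.1.2 w.2) =ᶠ[𝓝 ((x, t), z)]
      fun w => fderiv ℝ F w (v, 0) := by
    filter_upwards [hmem] with w hw using (hv _ _ hw.1 _ hw.2).symm
  rw [e1.fderiv_eq, ← hFG'.fderiv_z hΩ hD h hz, e2.fderiv_eq,
    fderiv_clm_apply hdd (differentiableAt_const _), fderiv_clm_apply hdd (differentiableAt_const _)]
  simpa using hsymm.eq (v, 0) (0, 1)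

theorem iteratedDeriv_family (hG : HolomorphicFamily Ω D G) (hΩ : IsOpen Ω) (hD : IsOpen D)
    (d : ℕ) : HolomorphicFamily Ω D (fun x t => iteratedDeriv d (G x t)) := by
  induction d with
  | zero => simpa using hG
  | succ d ih => simpa only [iteratedDeriv_succ] using ih.deriv_family hΩ hD

/-- The families are quantified after the colon because the induction step replaces both by their
complex derivatives. -/
theorem fderiv_iteratedDeriv (hΩ : IsOpen Ω) (hD : IsOpen D) (v : ℝ × ℝ) (d : ℕ)
    {x t : ℝ} (h : (x, t) ∈ Ω) {z : ℂ} (hz : z ∈ D) : ∀ {G G' : ℝ → ℝ → ℂ → ℂ},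
    HolomorphicFamily Ω D G →
    (∀ x t : ℝ, (x, t) ∈ Ω → DifferentiableOn ℂ (G' x t) D) →
    (∀ x t : ℝ, (x, t) ∈ Ω → ∀ z ∈ D,
      fderiv ℝ (fun w : (ℝ × ℝ) × ℂ => G w.1.1 w.1.2 w.2) ((x, t), z) (v, 0) = G' x t z) →
    fderiv ℝ (fun w : (ℝ × ℝ) × ℂ => iteratedDeriv d (G w.1.1 w.1.2) w.2) ((x, t), z) (v, 0)
      = iteratedDeriv d (G' x t) z := by
  induction d with
  | zero => intro G G' hG hG' hv; simpa using hv x t h z hz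
  | succ d ih =>
    intro G G' hG hG' hv
    simp only [iteratedDeriv_succ']
    exact ih (hG.deriv_family hΩ hD) (fun x t h => (hG' x t h).deriv hD)
      fun x t h z hz => hG.fderiv_deriv hΩ hD v hG' hv h hz

theorem contDiffOn_eval (hG : HolomorphicFamily Ω D G) {z : ℂ} (hz : z ∈ D) :
    ContDiffOn ℝ ∞ (fun p : ℝ × ℝ => G p.1 p.2 z) Ω :=
  hG.smooth.comp (contDiff_id.prodMk contDiff_const).contDiffOn fun _ hp => ⟨hp, hz⟩

theorem contDiffOn_taylorCoeff (hG : HolomorphicFamily Ω D G) (hΩ : IsOpen Ω) {μ : ℂ} {d : ℕ}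
    (hD : Admissible D μ d) :
    ContDiffOn ℝ ∞ (fun p : ℝ × ℝ => taylorCoeff d μ (G p.1 p.2)) Ω := by
  obtain ⟨hμ, rfl | hD⟩ := hD
  · simpa only [taylorCoeff_zero] using hG.contDiffOn_eval hμ
  · simp only [taylorCoeff_eq]
    exact ((hG.iteratedDeriv_family hΩ hD d).contDiffOn_eval hμ).div_const _

theorem hasDerivAt_taylorCoeff_x (hG : HolomorphicFamily Ω D G) (hΩ : IsOpen Ω) {μ : ℂ} {d : ℕ}
    (hD : Admissible D μ d) (hG' : ∀ x t : ℝ, (x, t) ∈ Ω → DifferentiableOn ℂ (G' x t) D)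
    (hv : ∀ x t : ℝ, (x, t) ∈ Ω → ∀ z ∈ D, HasDerivAt (fun y => G y t z) (G' x t z) x)
    {x t : ℝ} (h : (x, t) ∈ Ω) :
    HasDerivAt (fun y => taylorCoeff d μ (G y t)) (taylorCoeff d μ (G' x t)) x := by
  obtain ⟨hμ, rfl | hD⟩ := hD
  · simpa only [taylorCoeff_zero] using hv x t h μ hμ
  · simp only [taylorCoeff_eq]
    have h1 := (hG.iteratedDeriv_family hΩ hD d).fderiv_x hΩ hD h hμ
    rw [fderiv_iteratedDeriv hΩ hD (1, 0) d h hμ hG hG' fun x t h z hz =>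
      (hG.fderiv_x hΩ hD h hz).unique (hv x t h z hz)] at h1
    exact h1.div_const _

theorem hasDerivAt_taylorCoeff_t (hG : HolomorphicFamily Ω D G) (hΩ : IsOpen Ω) {μ : ℂ} {d : ℕ}
    (hD : Admissible D μ d) (hG' : ∀ x t : ℝ, (x, t) ∈ Ω → DifferentiableOn ℂ (G' x t) D)
    (hv : ∀ x t : ℝ, (x, t) ∈ Ω → ∀ z ∈ D, HasDerivAt (fun s => G x s z) (G' x t z) t)
    {x t : ℝ} (h : (x, t) ∈ Ω) :
    HasDerivAt (fun s => taylorCoeff d μ (G x s)) (taylorCoeff d μ (G' x t)) t := by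
  obtain ⟨hμ, rfl | hD⟩ := hD
  · simpa only [taylorCoeff_zero] using hv x t h μ hμ
  · simp only [taylorCoeff_eq]
    have h1 := (hG.iteratedDeriv_family hΩ hD d).fderiv_t hΩ hD h hμ
    rw [fderiv_iteratedDeriv hΩ hD (0, 1) d h hμ hG hG' fun x t h z hz =>
      (hG.fderiv_t hΩ hD h hz).unique (hv x t h z hz)] at h1
    exact h1.div_const _

end HolomorphicFamily

/-! ### The rows of the matrices -/

section Rows

variable {b n : ℕ} {m : Fin b → ℕ}

/-- The row of order `0` of a pair parameter. -/
def pairRow (m : Fin b → ℕ) (n : ℕ) (i : Fin (2 * b)) : Fin (dtSize b m n) :=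
  Fin.castAdd (2 * n) (Fin.castAdd (∑ l, 2 * m l) i)

/-- The row with number `k` of block `l`. -/
def blockRow (m : Fin b → ℕ) (n : ℕ) (l : Fin b) (k : Fin (2 * m l)) : Fin (dtSize b m n) :=
  Fin.castAdd (2 * n) (Fin.natAdd (2 * b) (finSigmaFinEquiv ⟨l, k⟩))

/-- The row of a free parameter. -/
def freeRow (m : Fin b → ℕ) (n : ℕ) (i : Fin (2 * n)) : Fin (dtSize b m n) :=
  Fin.natAdd (2 * b + ∑ l, 2 * m l) i

theorem rowNode_pairRow (i : Fin (2 * b)) : rowNode b m n (pairRow m n i) = Sum.inl i := by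
  simp [rowNode, pairRow]

theorem rowOrder_pairRow (i : Fin (2 * b)) : rowOrder b m n (pairRow m n i) = 0 := by
  simp [rowOrder, pairRow]

theorem rowNode_blockRow (l : Fin b) (k : Fin (2 * m l)) :
    rowNode b m n (blockRow m n l k) = Sum.inl (pairNode l k) := by
  simp only [rowNode, blockRow, Fin.addCases_left, Fin.addCases_right]
  rw [Equiv.symm_apply_apply]

theorem rowOrder_blockRow (l : Fin b) (k : Fin (2 * m l)) :
    rowOrder b m n (blockRow m n l k) = ((k : ℕ) + 2) / 2 := by
  simp only [rowOrder, blockRow, Fin.addCases_left, Fin.addCases_right]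
  rw [Equiv.symm_apply_apply]

theorem rowNode_freeRow (i : Fin (2 * n)) : rowNode b m n (freeRow m n i) = Sum.inr i := by
  simp [rowNode, freeRow]

theorem rowOrder_freeRow (i : Fin (2 * n)) : rowOrder b m n (freeRow m n i) = 0 := by
  simp [rowOrder, freeRow]

theorem row_cases {p : Fin (dtSize b m n) → Prop} (h1 : ∀ i, p (pairRow m n i))
    (h2 : ∀ l k, p (blockRow m n l k)) (h3 : ∀ i, p (freeRow m n i)) (j) : p j := by
  refine Fin.addCases (fun j => Fin.addCases h1 (fun s => ?_) j) h3 j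
  obtain ⟨⟨l, k⟩, rfl⟩ := finSigmaFinEquiv.surjective s
  exact h2 l k

theorem pairIndex_pairNode (l : Fin b) (s : ℕ) : pairIndex (pairNode l s) = l := by
  ext; simp only [pairIndex, pairNode]; omega

theorem pairNode_eq_iff {l l' : Fin b} {s s' : ℕ} :
    pairNode l s = pairNode l' s' ↔ l = l' ∧ s % 2 = s' % 2 := by
  simp only [pairNode, Fin.ext_iff]; omega

theorem rowOrder_lt (j : Fin (dtSize b m n)) :
    rowOrder b m n j < nodeMult m (rowNode b m n j) := by
  refine row_cases (p := fun j => rowOrder b m n j < nodeMult m (rowNode b m n j))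
    (fun i => ?_) (fun l k => ?_) (fun i => ?_) j
  · simp [rowNode_pairRow, rowOrder_pairRow, nodeMult]
  · have := k.2
    simp only [rowNode_blockRow, rowOrder_blockRow, nodeMult, Sum.elim_inl, pairIndex_pairNode]
    omega
  · simp [rowNode_freeRow, rowOrder_freeRow, nodeMult]

/-- The orders at a node fill an initial segment without gaps. Hence the row of preceding order
always exists and multiplication by `λ` maps Taylor rows to Taylor rows. -/
theorem exists_row (c : Node b n) {d : ℕ} (hd : d < nodeMult m c) :
    ∃ j, rowNode b m n j = c ∧ rowOrder b m n j = d := by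
  rcases c with i | i
  · simp only [nodeMult, Sum.elim_inl] at hd
    rcases Nat.eq_zero_or_pos d with rfl | h
    · exact ⟨_, rowNode_pairRow i, rowOrder_pairRow i⟩
    -- Positions `2(d-1)` and `2(d-1)+1` of a block are the two rows of order `d`; the parity of `i`
    -- selects the member of the pair.
    · refine ⟨blockRow m n (pairIndex i) ⟨2 * (d - 1) + (i : ℕ) % 2, by omega⟩, ?_, ?_⟩
      · rw [rowNode_blockRow]
        congr 1; ext; simp only [pairNode, pairIndex]; omega
      · rw [rowOrder_blockRow]; simp only; omega
  · simp only [nodeMult, Sum.elim_inr] at hd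
    obtain rfl : d = 0 := by omega
    exact ⟨_, rowNode_freeRow i, rowOrder_freeRow i⟩

theorem row_ext {i j : Fin (dtSize b m n)} (h1 : rowNode b m n i = rowNode b m n j)
    (h2 : rowOrder b m n i = rowOrder b m n j) : i = j := by
  revert h1 h2
  refine row_cases (p := fun i => rowNode b m n i = rowNode b m n j →
    rowOrder b m n i = rowOrder b m n j → i = j) (fun i => ?_) (fun l k => ?_) (fun i => ?_) i <;>
  refine row_cases (p := fun j => rowNode b m n _ = rowNode b m n j →
    rowOrder b m n _ = rowOrder b m n j → _ = j)
    (fun i' => ?_) (fun l' k' => ?_) (fun i' => ?_) j <;>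
  simp only [rowNode_pairRow, rowOrder_pairRow, rowNode_blockRow, rowOrder_blockRow,
    rowNode_freeRow, rowOrder_freeRow, reduceCtorEq, false_imp_iff, Sum.inl.injEq, Sum.inr.injEq,
    pairNode_eq_iff]
  · rintro rfl -; rfl
  · intro _ h; omega
  · intro _ h; omega
  · rintro ⟨rfl, h⟩ h'
    congr 1; ext; omega
  · rintro rfl -; rfl

/-- Rows are the same as pairs of a node and an order below its multiplicity. -/
def rowEquiv (b : ℕ) (m : Fin b → ℕ) (n : ℕ) :
    Fin (dtSize b m n) ≃ Σ c : Node b n, Fin (nodeMult m c) :=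
  Equiv.ofBijective (fun j => ⟨rowNode b m n j, ⟨rowOrder b m n j, rowOrder_lt j⟩⟩) <| by
    constructor
    · intro i j h
      have h1 : rowNode b m n i = rowNode b m n j := congrArg Sigma.fst h
      refine row_ext h1 ?_
      exact congrArg (fun s : Σ c : Node b n, Fin (nodeMult m c) => (s.2 : ℕ)) h
    · rintro ⟨c, d, hd⟩
      obtain ⟨j, rfl, rfl⟩ := exists_row c hd
      exact ⟨j, rfl⟩

theorem sum_nodeMult : ∑ c : Node b n, nodeMult m c = dtSize b m n := by
  simpa using (Fintype.card_congr (rowEquiv b m n)).symm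

/-- Evenness makes `X N` the column `λ^N φ` of `H` and `Y N` the column `λ^N ϕ` of `W`. -/
theorem dtSize_even : Even (dtSize b m n) := by
  refine ((even_two_mul b).add ?_).add (even_two_mul n)
  exact Finset.even_sum _ fun l _ => even_two_mul _

end Rows

/-! ### The Taylor rows move by the Lax pair -/

section PlaneDerivatives

variable {Ω : Set (ℝ × ℝ)} {f : ℝ → ℝ → ℂ}

theorem hasDerivAt_x_of_contDiffOn (hf : ContDiffOn ℝ ∞ (fun p : ℝ × ℝ => f p.1 p.2) Ω)
    (hΩ : IsOpen Ω) {x t : ℝ} (h : (x, t) ∈ Ω) :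
    HasDerivAt (fun y => f y t) (fderiv ℝ (fun p : ℝ × ℝ => f p.1 p.2) (x, t) (1, 0)) x := by
  have h1 : HasFDerivAt (fun p : ℝ × ℝ => f p.1 p.2)
      (fderiv ℝ (fun p : ℝ × ℝ => f p.1 p.2) (x, t)) (x, t) :=
    ((hf.contDiffAt (hΩ.mem_nhds h)).differentiableAt (by simp)).hasFDerivAt
  have h2 : HasDerivAt (fun y : ℝ => ((y, t) : ℝ × ℝ)) (1, 0) x :=
    (hasDerivAt_id x).prodMk (hasDerivAt_const _ _)
  exact h1.comp_hasDerivAt x h2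

theorem hasDerivAt_t_of_contDiffOn (hf : ContDiffOn ℝ ∞ (fun p : ℝ × ℝ => f p.1 p.2) Ω)
    (hΩ : IsOpen Ω) {x t : ℝ} (h : (x, t) ∈ Ω) :
    HasDerivAt (fun s => f x s) (fderiv ℝ (fun p : ℝ × ℝ => f p.1 p.2) (x, t) (0, 1)) t := by
  have h1 : HasFDerivAt (fun p : ℝ × ℝ => f p.1 p.2)
      (fderiv ℝ (fun p : ℝ × ℝ => f p.1 p.2) (x, t)) (x, t) :=
    ((hf.contDiffAt (hΩ.mem_nhds h)).differentiableAt (by simp)).hasFDerivAt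
  have h2 : HasDerivAt (fun s : ℝ => ((x, s) : ℝ × ℝ)) (0, 1) t :=
    (hasDerivAt_const _ _).prodMk (hasDerivAt_id t)
  exact h1.comp_hasDerivAt t h2

theorem contDiffOn_deriv_x (hf : ContDiffOn ℝ ∞ (fun p : ℝ × ℝ => f p.1 p.2) Ω)
    (hΩ : IsOpen Ω) : ContDiffOn ℝ ∞ (fun p : ℝ × ℝ => deriv (fun y => f y p.2) p.1) Ω := by
  have := (hf.fderiv_of_isOpen hΩ (m := ∞) (by simp)).clm_apply
      (contDiffOn_const (c := ((1, 0) : ℝ × ℝ)))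
  exact this.congr fun w hw => (hasDerivAt_x_of_contDiffOn hf hΩ hw).deriv

end PlaneDerivatives

theorem contDiffOn_det {N : ℕ} {E : Type*} [NormedAddCommGroup E] [NormedSpace ℝ E]
    {A : E → Matrix (Fin N) (Fin N) ℂ} {s : Set E}
    (h : ∀ i j, ContDiffOn ℝ ∞ (fun p => A p i j) s) : ContDiffOn ℝ ∞ (fun p => (A p).det) s := by
  simp only [Matrix.det_apply']
  exact ContDiffOn.sum fun σ _ => contDiffOn_const.mul (contDiffOn_prod fun i _ => h _ _)

namespace LaxSequence

theorem mono {N : ℕ} {ι : ℂ} {q r qx rx : ℝ → ℝ → ℂ} {Ω Ω' : Set (ℝ × ℝ)}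
    {T : (Fin N → ℂ) →ₗ[ℂ] (Fin N → ℂ)} {X Y : ℕ → ℝ → ℝ → Fin N → ℂ}
    (S : LaxSequence ι q r qx rx Ω T X Y) (h : Ω' ⊆ Ω) : LaxSequence ι q r qx rx Ω' T X Y where
  mapX j x t e := S.mapX j x t (h e)
  mapY j x t e := S.mapY j x t (h e)
  even_x j x t e := S.even_x j x t (h e)
  odd_x j x t e := S.odd_x j x t (h e)
  even_t j x t e := S.even_t j x t (h e)
  odd_t j x t e := S.odd_t j x t (h e)

end LaxSequence

theorem HolomorphicFamily.pow_mul {Ω : Set (ℝ × ℝ)} {D : Set ℂ} {G : ℝ → ℝ → ℂ → ℂ}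
    (hG : HolomorphicFamily Ω D G) (p : ℕ) :
    HolomorphicFamily Ω D (fun x t z => z ^ p * G x t z) where
  smooth := (contDiff_snd.pow p).contDiffOn.mul hG.smooth
  holomorphic x t h := ((differentiable_id.pow p).differentiableOn).mul (hG.holomorphic x t h)

/-- The common shape of both flows of the Lax pair: odd powers of `λ` come with the other component,
even powers with the same one. The coefficients do not depend on `λ`, so they pass through the
Taylor coefficient. -/
theorem taylorCoeff_lax {Ω : Set (ℝ × ℝ)} {D : Set ℂ} {f g : ℝ → ℝ → ℂ → ℂ}
    (hf : HolomorphicFamily Ω D f) (hg : HolomorphicFamily Ω D g) {μ : ℂ} {d : ℕ}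
    (hD : Admissible D μ d) {x t : ℝ} (h : (x, t) ∈ Ω) (p : ℕ) (c₁ c₂ c₃ c₄ : ℂ) :
    taylorCoeff d μ (fun z => z ^ p * (c₁ * (z * g x t z) + c₂ * (z ^ 2 * f x t z)
      + c₃ * (z ^ 3 * g x t z) + c₄ * (z ^ 4 * f x t z)))
    = c₁ * taylorCoeff d μ (fun z => z ^ (p + 1) * g x t z)
      + c₂ * taylorCoeff d μ (fun z => z ^ (p + 2) * f x t z)
      + c₃ * taylorCoeff d μ (fun z => z ^ (p + 3) * g x t z)
      + c₄ * taylorCoeff d μ (fun z => z ^ (p + 4) * f x t z) := by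
  have hF := fun k c => ((hf.pow_mul k).holomorphic x t h).const_mul c
  have hG := fun k c => ((hg.pow_mul k).holomorphic x t h).const_mul c
  rw [← taylorCoeff_const_mul, ← taylorCoeff_const_mul, ← taylorCoeff_const_mul,
    ← taylorCoeff_const_mul, ← taylorCoeff_add hD (hG _ _) (hF _ _),
    ← taylorCoeff_add hD ((hG _ _).fun_add (hF _ _)) (hG _ _),
    ← taylorCoeff_add hD (((hG _ _).fun_add (hF _ _)).fun_add (hG _ _)) (hF _ _)]
  congr 1
  ext z
  ring

theorem differentiableOn_lax {Ω : Set (ℝ × ℝ)} {D : Set ℂ} {f g : ℝ → ℝ → ℂ → ℂ}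
    (hf : HolomorphicFamily Ω D f) (hg : HolomorphicFamily Ω D g) {x t : ℝ} (h : (x, t) ∈ Ω)
    (p : ℕ) (c₁ c₂ c₃ c₄ : ℂ) :
    DifferentiableOn ℂ (fun z => z ^ p * (c₁ * (z * g x t z) + c₂ * (z ^ 2 * f x t z)
      + c₃ * (z ^ 3 * g x t z) + c₄ * (z ^ 4 * f x t z))) D := by
  have h1 := hf.holomorphic x t h
  have h2 := hg.holomorphic x t h
  fun_prop

section Eigenfunction

variable {q r : ℝ → ℝ → ℂ} {Ω : Set (ℝ × ℝ)} {D : Set ℂ} {Ψ : ℝ → ℝ → ℂ → Fin 2 → ℂ}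

theorem IsEigenfunctionFamily.component (hΨ : IsEigenfunctionFamily q r Ω D Ψ) (i : Fin 2) :
    HolomorphicFamily Ω D (fun x t z => Ψ x t z i) where
  smooth := contDiffOn_pi.1 hΨ.smooth i
  holomorphic x t h := differentiableOn_pi.1 (hΨ.holomorphic x t h) i

theorem IsEigenfunctionFamily.x_zero (hΨ : IsEigenfunctionFamily q r Ω D Ψ) {x t : ℝ}
    (h : (x, t) ∈ Ω) {z : ℂ} (hz : z ∈ D) :
    HasDerivAt (fun y => Ψ y t z 0) (q x t * (z * Ψ x t z 1)
      + Complex.I * (z ^ 2 * Ψ x t z 0) + 0 * (z ^ 3 * Ψ x t z 1) + 0 * (z ^ 4 * Ψ x t z 0)) x := by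
  refine (hasDerivAt_pi.1 (hΨ.lax_x x t h z hz) 0).congr_deriv ?_
  simp [laxU, sigma, potential, Matrix.mulVec, dotProduct, Fin.sum_univ_two]
  ring

theorem IsEigenfunctionFamily.x_one (hΨ : IsEigenfunctionFamily q r Ω D Ψ) {x t : ℝ}
    (h : (x, t) ∈ Ω) {z : ℂ} (hz : z ∈ D) :
    HasDerivAt (fun y => Ψ y t z 1) (r x t * (z * Ψ x t z 0)
      + -Complex.I * (z ^ 2 * Ψ x t z 1) + 0 * (z ^ 3 * Ψ x t z 0)
      + 0 * (z ^ 4 * Ψ x t z 1)) x := by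
  refine (hasDerivAt_pi.1 (hΨ.lax_x x t h z hz) 1).congr_deriv ?_
  simp [laxU, sigma, potential, Matrix.mulVec, dotProduct, Fin.sum_univ_two]
  ring

theorem IsEigenfunctionFamily.t_zero (hΨ : IsEigenfunctionFamily q r Ω D Ψ) {x t : ℝ}
    (h : (x, t) ∈ Ω) {z : ℂ} (hz : z ∈ D) :
    HasDerivAt (fun s => Ψ x s z 0)
      ((q x t ^ 2 * r x t - Complex.I * deriv (fun y => q y t) x) * (z * Ψ x t z 1)
      + (Complex.I * (q x t * r x t)) * (z ^ 2 * Ψ x t z 0) + (2 * q x t) * (z ^ 3 * Ψ x t z 1)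
      + (2 * Complex.I) * (z ^ 4 * Ψ x t z 0)) t := by
  refine (hasDerivAt_pi.1 (hΨ.lax_t x t h z hz) 0).congr_deriv ?_
  simp [laxV, sigma, potential, Matrix.mulVec, dotProduct, Fin.sum_univ_two, pow_succ]
  ring

theorem IsEigenfunctionFamily.t_one (hΨ : IsEigenfunctionFamily q r Ω D Ψ) {x t : ℝ}
    (h : (x, t) ∈ Ω) {z : ℂ} (hz : z ∈ D) :
    HasDerivAt (fun s => Ψ x s z 1)
      ((r x t ^ 2 * q x t - -Complex.I * deriv (fun y => r y t) x) * (z * Ψ x t z 0)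
      + (-Complex.I * (r x t * q x t)) * (z ^ 2 * Ψ x t z 1) + (2 * r x t) * (z ^ 3 * Ψ x t z 0)
      + (2 * -Complex.I) * (z ^ 4 * Ψ x t z 1)) t := by
  refine (hasDerivAt_pi.1 (hΨ.lax_t x t h z hz) 1).congr_deriv ?_
  simp [laxV, sigma, potential, Matrix.mulVec, dotProduct, Fin.sum_univ_two, pow_succ]
  ring

end Eigenfunction

section TaylorVectors

variable {b n : ℕ} (m : Fin b → ℕ) (lam : Node b n → ℂ)
  (Ψ : Node b n → ℝ → ℝ → ℂ → Fin 2 → ℂ)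

/-- The vector of the Taylor coefficients of `λ ^ p Ψ u` (even `p`) or `λ ^ p Ψ v` (odd `p`). -/
def taylorVec (u v : Fin 2) (p : ℕ) (x t : ℝ) : Fin (dtSize b m n) → ℂ := fun j =>
  taylorCoeff (rowOrder b m n j) (lam (rowNode b m n j))
    (fun z => z ^ p * if Even p then Ψ (rowNode b m n j) x t z u else Ψ (rowNode b m n j) x t z v)

/-- The row with the same parameter and the preceding order. -/
def prevRow (j : Fin (dtSize b m n)) : Fin (dtSize b m n) :=
  (rowEquiv b m n).symm ⟨rowNode b m n j, ⟨rowOrder b m n j - 1,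
    (Nat.sub_le _ _).trans_lt (rowOrder_lt j)⟩⟩

theorem rowNode_symm (s : Σ c : Node b n, Fin (nodeMult m c)) :
    rowNode b m n ((rowEquiv b m n).symm s) = s.1 := by
  conv_rhs => rw [← (rowEquiv b m n).apply_symm_apply s]
  rfl

theorem rowOrder_symm (s : Σ c : Node b n, Fin (nodeMult m c)) :
    rowOrder b m n ((rowEquiv b m n).symm s) = s.2 := by
  conv_rhs => rw [← (rowEquiv b m n).apply_symm_apply s]
  rfl

theorem rowNode_prevRow (j : Fin (dtSize b m n)) :
    rowNode b m n (prevRow m j) = rowNode b m n j := rowNode_symm m _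

theorem rowOrder_prevRow (j : Fin (dtSize b m n)) :
    rowOrder b m n (prevRow m j) = rowOrder b m n j - 1 := rowOrder_symm m _

/-- Multiplication of Taylor rows by the spectral parameter. -/
def spectralMap : (Fin (dtSize b m n) → ℂ) →ₗ[ℂ] (Fin (dtSize b m n) → ℂ) where
  toFun w j := lam (rowNode b m n j) * w j + if rowOrder b m n j = 0 then 0 else w (prevRow m j)
  map_add' w w' := by
    ext j; simp only [Pi.add_apply]; split_ifs <;> ring
  map_smul' c w := by
    ext j; simp only [Pi.smul_apply, smul_eq_mul, RingHom.id_apply]; split_ifs <;> ring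

variable {m lam Ψ} {q r : ℝ → ℝ → ℂ} {Ω : Set (ℝ × ℝ)} {D : Node b n → Set ℂ}

/-- Positive orders occur only at pair nodes, whose domains are open. Rows of free nodes have order
`0` and need just the value at the node. -/
theorem admissible_row (hD : ∀ c, lam c ∈ D c) (hDo : ∀ i, IsOpen (D (Sum.inl i)))
    (j : Fin (dtSize b m n)) :
    Admissible (D (rowNode b m n j)) (lam (rowNode b m n j)) (rowOrder b m n j) := by
  refine ⟨hD _, ?_⟩
  have h := rowOrder_lt j
  rcases hc : rowNode b m n j with i | i
  · exact Or.inr (hDo i)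
  · left
    rw [hc] at h
    simpa [nodeMult] using h

/-- The extra factor `z` changes the parity of the exponent but not the component, which is why the
roles of `u` and `v` are exchanged. -/
theorem spectralMap_taylorVec (hD : ∀ c, lam c ∈ D c) (hDo : ∀ i, IsOpen (D (Sum.inl i)))
    (hΨ : ∀ c, IsEigenfunctionFamily q r Ω (D c) (Ψ c)) (u v : Fin 2) (p : ℕ) {x t : ℝ}
    (h : (x, t) ∈ Ω) :
    spectralMap m lam (taylorVec m lam Ψ u v p x t) = taylorVec m lam Ψ v u (p + 1) x t := by
  ext j
  have hol : DifferentiableOn ℂ (fun z => z ^ p * if Even p then Ψ (rowNode b m n j) x t z u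
      else Ψ (rowNode b m n j) x t z v) (D (rowNode b m n j)) := by
    split_ifs
    · exact (((hΨ _).component u).pow_mul p).holomorphic x t h
    · exact (((hΨ _).component v).pow_mul p).holomorphic x t h
  have key := taylorCoeff_id_mul (admissible_row hD hDo j) hol
  have e : (fun z => z ^ (p + 1) * if Even (p + 1) then Ψ (rowNode b m n j) x t z v
      else Ψ (rowNode b m n j) x t z u) = fun z => z * (z ^ p * if Even p then
        Ψ (rowNode b m n j) x t z u else Ψ (rowNode b m n j) x t z v) := by
    ext z
    by_cases hp : Even p
    · simp [hp, Nat.even_add_one, pow_succ']; ring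
    · simp [hp, Nat.even_add_one, pow_succ']; ring
  simp only [spectralMap, LinearMap.coe_mk, AddHom.coe_mk, taylorVec]
  rw [e, key, rowNode_prevRow, rowOrder_prevRow]

/-- A Taylor coefficient in `λ` commutes with `∂x` and `∂t`, so each row inherits the Lax equations,
with powers of `λ` turned into shifts of the index. -/
theorem laxSequence_taylorVec (hΩ : IsOpen Ω) (hD : ∀ c, lam c ∈ D c)
    (hDo : ∀ i, IsOpen (D (Sum.inl i)))
    (hΨ : ∀ c, IsEigenfunctionFamily q r Ω (D c) (Ψ c)) :
    LaxSequence Complex.I q r (fun x t => deriv (fun y => q y t) x)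
      (fun x t => deriv (fun y => r y t) x) Ω (spectralMap m lam)
      (taylorVec m lam Ψ 0 1) (taylorVec m lam Ψ 1 0) := by
  have hx : ∀ (j : Fin (dtSize b m n)) (p : ℕ) {x t : ℝ}, (x, t) ∈ Ω → _ := fun j p {x t} h =>
    (((hΨ (rowNode b m n j)).component 0).pow_mul p).hasDerivAt_taylorCoeff_x hΩ
      (admissible_row hD hDo j) (fun x t h => differentiableOn_lax ((hΨ _).component 0)
        ((hΨ _).component 1) h p _ _ _ _)
      (fun x t h z hz => ((hΨ _).x_zero h hz).const_mul (z ^ p)) h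
  have hx' : ∀ (j : Fin (dtSize b m n)) (p : ℕ) {x t : ℝ}, (x, t) ∈ Ω → _ := fun j p {x t} h =>
    (((hΨ (rowNode b m n j)).component 1).pow_mul p).hasDerivAt_taylorCoeff_x hΩ
      (admissible_row hD hDo j) (fun x t h => differentiableOn_lax ((hΨ _).component 1)
        ((hΨ _).component 0) h p _ _ _ _)
      (fun x t h z hz => ((hΨ _).x_one h hz).const_mul (z ^ p)) h
  have ht : ∀ (j : Fin (dtSize b m n)) (p : ℕ) {x t : ℝ}, (x, t) ∈ Ω → _ := fun j p {x t} h =>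
    (((hΨ (rowNode b m n j)).component 0).pow_mul p).hasDerivAt_taylorCoeff_t hΩ
      (admissible_row hD hDo j) (fun x t h => differentiableOn_lax ((hΨ _).component 0)
        ((hΨ _).component 1) h p _ _ _ _)
      (fun x t h z hz => ((hΨ _).t_zero h hz).const_mul (z ^ p)) h
  have ht' : ∀ (j : Fin (dtSize b m n)) (p : ℕ) {x t : ℝ}, (x, t) ∈ Ω → _ := fun j p {x t} h =>
    (((hΨ (rowNode b m n j)).component 1).pow_mul p).hasDerivAt_taylorCoeff_t hΩ
      (admissible_row hD hDo j) (fun x t h => differentiableOn_lax ((hΨ _).component 1)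
        ((hΨ _).component 0) h p _ _ _ _)
      (fun x t h z hz => ((hΨ _).t_one h hz).const_mul (z ^ p)) h
  have e1 : ∀ p : ℕ, Even p → ¬Even (p + 1) ∧ Even (p + 2) ∧ ¬Even (p + 3) ∧ Even (p + 4) := by
    intro p hp; simp [Nat.even_add_one, show p + 2 = p + 1 + 1 from rfl,
      show p + 3 = p + 1 + 1 + 1 from rfl, show p + 4 = p + 1 + 1 + 1 + 1 from rfl, hp]
  have e2 : ∀ p : ℕ, ¬Even p → Even (p + 1) ∧ ¬Even (p + 2) ∧ Even (p + 3) ∧ ¬Even (p + 4) := by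
    intro p hp; simp [Nat.even_add_one, show p + 2 = p + 1 + 1 from rfl,
      show p + 3 = p + 1 + 1 + 1 from rfl, show p + 4 = p + 1 + 1 + 1 + 1 from rfl, hp]
  refine ⟨fun p x t h => spectralMap_taylorVec hD hDo hΨ 0 1 p h,
    fun p x t h => spectralMap_taylorVec hD hDo hΨ 1 0 p h, ?_, ?_, ?_, ?_⟩
  · intro p x t h hp
    obtain ⟨p1, p2, -, -⟩ := e1 p hp
    constructor <;> refine hasDerivAt_pi.2 fun j => ?_
    · have := hx j p h
      rw [taylorCoeff_lax ((hΨ _).component 0) ((hΨ _).component 1) (admissible_row hD hDo j) h]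
        at this
      simpa [taylorVec, hp, p1, p2] using this
    · have := hx' j p h
      rw [taylorCoeff_lax ((hΨ _).component 1) ((hΨ _).component 0) (admissible_row hD hDo j) h]
        at this
      simpa [taylorVec, hp, p1, p2] using this
  · intro p x t h hp
    obtain ⟨p1, p2, -, -⟩ := e2 p hp
    constructor <;> refine hasDerivAt_pi.2 fun j => ?_
    · have := hx' j p h
      rw [taylorCoeff_lax ((hΨ _).component 1) ((hΨ _).component 0) (admissible_row hD hDo j) h]
        at this
      simpa [taylorVec, hp, p1, p2] using this
    · have := hx j p h
      rw [taylorCoeff_lax ((hΨ _).component 0) ((hΨ _).component 1) (admissible_row hD hDo j) h]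
        at this
      simpa [taylorVec, hp, p1, p2] using this
  · intro p x t h hp
    obtain ⟨p1, p2, p3, p4⟩ := e1 p hp
    constructor <;> refine hasDerivAt_pi.2 fun j => ?_
    · have := ht j p h
      rw [taylorCoeff_lax ((hΨ _).component 0) ((hΨ _).component 1) (admissible_row hD hDo j) h]
        at this
      simpa only [taylorVec, hp, p1, p2, p3, p4, if_true, if_false, Pi.add_apply, Pi.smul_apply,
        smul_eq_mul] using this
    · have := ht' j p h
      rw [taylorCoeff_lax ((hΨ _).component 1) ((hΨ _).component 0) (admissible_row hD hDo j) h]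
        at this
      simpa only [taylorVec, hp, p1, p2, p3, p4, if_true, if_false, Pi.add_apply, Pi.smul_apply,
        smul_eq_mul] using this
  · intro p x t h hp
    obtain ⟨p1, p2, p3, p4⟩ := e2 p hp
    constructor <;> refine hasDerivAt_pi.2 fun j => ?_
    · have := ht' j p h
      rw [taylorCoeff_lax ((hΨ _).component 1) ((hΨ _).component 0) (admissible_row hD hDo j) h]
        at this
      simpa only [taylorVec, hp, p1, p2, p3, p4, if_true, if_false, Pi.add_apply, Pi.smul_apply,
        smul_eq_mul] using this
    · have := ht j p h
      rw [taylorCoeff_lax ((hΨ _).component 0) ((hΨ _).component 1) (admissible_row hD hDo j) h]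
        at this
      simpa only [taylorVec, hp, p1, p2, p3, p4, if_true, if_false, Pi.add_apply, Pi.smul_apply,
        smul_eq_mul] using this

end TaylorVectors

/-! ### The transformed potentials solve the Kaup-Newell system -/

section Solution

variable {b n : ℕ} {m : Fin b → ℕ} {lam : Node b n → ℂ}
  {Ψ : Node b n → ℝ → ℝ → ℂ → Fin 2 → ℂ}

theorem even_degree_iff (k : Fin (dtSize b m n)) :
    Even (dtSize b m n - 1 - k) ↔ ¬Even (k : ℕ) := by
  have h := dtSize_even (b := b) (m := m) (n := n)
  have hk := k.2
  generalize dtSize b m n = N at *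
  grind

theorem taylorAt_entryM (x t : ℝ) :
    taylorAt entryM m lam Ψ x t = colMatrix fun p => taylorVec m lam Ψ 0 1 p x t := by
  ext j k
  simp only [taylorAt, taylorMatrix, limitParams, Matrix.of_apply, colMatrix, taylorVec,
    taylorCoeff, entryM, even_degree_iff, ite_not]

theorem taylorAt_entryP (x t : ℝ) :
    taylorAt entryP m lam Ψ x t = colMatrix fun p => taylorVec m lam Ψ 1 0 p x t := by
  ext j k
  simp only [taylorAt, taylorMatrix, limitParams, Matrix.of_apply, colMatrix, taylorVec,
    taylorCoeff, entryP, even_degree_iff, ite_not]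

theorem dtSize_pos (hb : 1 ≤ b) : 0 < dtSize b m n := by unfold dtSize; omega

theorem taylorAt_entryH (hb : 1 ≤ b) (x t : ℝ) :
    taylorAt entryH m lam Ψ x t = (colMatrix fun p => taylorVec m lam Ψ 0 1 p x t).updateCol
      ⟨0, dtSize_pos hb⟩ (taylorVec m lam Ψ 0 1 (dtSize b m n) x t) := by
  rw [← taylorAt_entryM]
  ext j k
  by_cases hk : k = ⟨0, dtSize_pos hb⟩
  · subst hk
    simp [taylorAt, taylorMatrix, limitParams, taylorVec, taylorCoeff, entryH, dtSize_even]
  · have : (k : ℕ) ≠ 0 := fun h => hk (Fin.ext h)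
    simp [Matrix.updateCol_ne hk, taylorAt, taylorMatrix, entryH, this]

theorem taylorAt_entryW (hb : 1 ≤ b) (x t : ℝ) :
    taylorAt entryW m lam Ψ x t = (colMatrix fun p => taylorVec m lam Ψ 1 0 p x t).updateCol
      ⟨0, dtSize_pos hb⟩ (taylorVec m lam Ψ 1 0 (dtSize b m n) x t) := by
  rw [← taylorAt_entryP]
  ext j k
  by_cases hk : k = ⟨0, dtSize_pos hb⟩
  · subst hk
    simp [taylorAt, taylorMatrix, limitParams, taylorVec, taylorCoeff, entryW, dtSize_even]
  · have : (k : ℕ) ≠ 0 := fun h => hk (Fin.ext h)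
    simp [Matrix.updateCol_ne hk, taylorAt, taylorMatrix, entryW, this]

/-- Cramer's rule, in the form `α 0 = -|H'|/|M'|`. -/
theorem degenerateQ_eq (hb : 1 ≤ b) (q : ℝ → ℝ → ℂ) :
    degenerateQ q m lam Ψ = LaxSequence.newPotential Complex.I q
      (taylorVec m lam Ψ 0 1) (taylorVec m lam Ψ 1 0) := by
  ext x t
  simp only [degenerateQ, formulaQ, LaxSequence.newPotential, LaxSequence.detAt,
    LaxSequence.coeffAt, relCoeff, dif_pos (dtSize_pos hb (m := m) (n := n)), taylorAt_entryH hb,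
    taylorAt_entryM, taylorAt_entryP]
  generalize (colMatrix fun p => taylorVec m lam Ψ 1 0 p x t).det = P
  -- With division by zero equal to zero both sides vanish here. The identity thus holds at every
  -- point and can be rewritten under derivatives.
  by_cases hM : (colMatrix fun p => taylorVec m lam Ψ 0 1 p x t).det = 0
  · simp [hM]
  · field_simp
    ring

theorem degenerateR_eq (hb : 1 ≤ b) (r : ℝ → ℝ → ℂ) :
    degenerateR r m lam Ψ = LaxSequence.newPotential (-Complex.I) r
      (taylorVec m lam Ψ 1 0) (taylorVec m lam Ψ 0 1) := by
  ext x t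
  simp only [degenerateR, formulaR, LaxSequence.newPotential, LaxSequence.detAt,
    LaxSequence.coeffAt, relCoeff, dif_pos (dtSize_pos hb (m := m) (n := n)), taylorAt_entryW hb,
    taylorAt_entryM, taylorAt_entryP]
  generalize (colMatrix fun p => taylorVec m lam Ψ 0 1 p x t).det = M
  by_cases hP : (colMatrix fun p => taylorVec m lam Ψ 1 0 p x t).det = 0
  · simp [hP]
  · field_simp

variable {q r : ℝ → ℝ → ℂ} {Ω : Set (ℝ × ℝ)} {D : Node b n → Set ℂ}

theorem contDiffOn_taylorVec (hΩ : IsOpen Ω) (hD : ∀ c, lam c ∈ D c)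
    (hDo : ∀ i, IsOpen (D (Sum.inl i)))
    (hΨ : ∀ c, IsEigenfunctionFamily q r Ω (D c) (Ψ c)) (u v : Fin 2) (p : ℕ)
    (j : Fin (dtSize b m n)) :
    ContDiffOn ℝ ∞ (fun w : ℝ × ℝ => taylorVec m lam Ψ u v p w.1 w.2 j) Ω := by
  unfold taylorVec
  split_ifs
  · exact (((hΨ _).component u).pow_mul p).contDiffOn_taylorCoeff hΩ (admissible_row hD hDo j)
  · exact (((hΨ _).component v).pow_mul p).contDiffOn_taylorCoeff hΩ (admissible_row hD hDo j)

theorem contDiffOn_det_taylor (hΩ : IsOpen Ω) (hD : ∀ c, lam c ∈ D c)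
    (hDo : ∀ i, IsOpen (D (Sum.inl i)))
    (hΨ : ∀ c, IsEigenfunctionFamily q r Ω (D c) (Ψ c)) (u v : Fin 2) :
    ContDiffOn ℝ ∞ (fun w : ℝ × ℝ =>
      (colMatrix fun p => taylorVec m lam Ψ u v p w.1 w.2).det) Ω :=
  contDiffOn_det fun _ _ => contDiffOn_taylorVec hΩ hD hDo hΨ u v _ _

theorem contDiffOn_det_taylor_updateCol (hΩ : IsOpen Ω) (hD : ∀ c, lam c ∈ D c)
    (hDo : ∀ i, IsOpen (D (Sum.inl i)))
    (hΨ : ∀ c, IsEigenfunctionFamily q r Ω (D c) (Ψ c)) (u v : Fin 2) (k : Fin (dtSize b m n)) :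
    ContDiffOn ℝ ∞ (fun w : ℝ × ℝ =>
      ((colMatrix fun p => taylorVec m lam Ψ u v p w.1 w.2).updateCol k
        (taylorVec m lam Ψ u v (dtSize b m n) w.1 w.2)).det) Ω := by
  refine contDiffOn_det fun i j => ?_
  simp only [Matrix.updateCol_apply]
  split_ifs
  · exact contDiffOn_taylorVec hΩ hD hDo hΨ u v _ _
  · exact contDiffOn_taylorVec hΩ hD hDo hΨ u v _ _

theorem isOpen_nonsingular (hΩ : IsOpen Ω) {f : ℝ × ℝ → ℂ} (hf : ContDiffOn ℝ ∞ f Ω) :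
    IsOpen {p ∈ Ω | f p ≠ 0} :=
  hf.continuousOn.isOpen_inter_preimage hΩ isOpen_compl_singleton

theorem contDiffOn_formula {s : Set (ℝ × ℝ)} {M H P f : ℝ × ℝ → ℂ} (hM : ContDiffOn ℝ ∞ M s)
    (hH : ContDiffOn ℝ ∞ H s) (hP : ContDiffOn ℝ ∞ P s) (hf : ContDiffOn ℝ ∞ f s)
    (h0 : ∀ p ∈ s, P p ≠ 0) (c : ℂ) :
    ContDiffOn ℝ ∞ (fun p => M p ^ 2 / P p ^ 2 * f p + c * (M p * H p / P p ^ 2)) s := by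
  have h2 : ∀ p ∈ s, P p ^ 2 ≠ 0 := fun p hp => pow_ne_zero _ (h0 p hp)
  have hi : ContDiffOn ℝ ∞ (fun p => (P p ^ 2)⁻¹) s := (hP.pow 2).inv h2
  simp only [div_eq_mul_inv]
  exact (((hM.pow 2).mul hi).mul hf).add (contDiffOn_const.mul ((hM.mul hH).mul hi))

theorem contDiffOn_degenerateQ (hb : 1 ≤ b) (hΩ : IsOpen Ω) (hD : ∀ c, lam c ∈ D c)
    (hDo : ∀ i, IsOpen (D (Sum.inl i))) (hΨ : ∀ c, IsEigenfunctionFamily q r Ω (D c) (Ψ c))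
    (hq : ContDiffOn ℝ ∞ (fun p : ℝ × ℝ => q p.1 p.2) Ω) :
    ContDiffOn ℝ ∞ (fun p : ℝ × ℝ => degenerateQ q m lam Ψ p.1 p.2)
      {p ∈ Ω | (taylorAt entryP m lam Ψ p.1 p.2).det ≠ 0} := by
  simp only [degenerateQ, formulaQ, taylorAt_entryH hb, taylorAt_entryM, taylorAt_entryP]
  have hs : {p ∈ Ω | (colMatrix fun i => taylorVec m lam Ψ 1 0 i p.1 p.2).det ≠ 0} ⊆ Ω :=
    fun _ h => h.1
  have hM := (contDiffOn_det_taylor (m := m) hΩ hD hDo hΨ 0 1).mono hs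
  have hP := (contDiffOn_det_taylor (m := m) hΩ hD hDo hΨ 1 0).mono hs
  have hH := (contDiffOn_det_taylor_updateCol (m := m) hΩ hD hDo hΨ 0 1 ⟨0, dtSize_pos hb⟩).mono hs
  exact contDiffOn_formula hM hH hP (hq.mono hs) (fun p hp => hp.2) _

theorem contDiffOn_degenerateR (hb : 1 ≤ b) (hΩ : IsOpen Ω) (hD : ∀ c, lam c ∈ D c)
    (hDo : ∀ i, IsOpen (D (Sum.inl i))) (hΨ : ∀ c, IsEigenfunctionFamily q r Ω (D c) (Ψ c))
    (hr : ContDiffOn ℝ ∞ (fun p : ℝ × ℝ => r p.1 p.2) Ω) :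
    ContDiffOn ℝ ∞ (fun p : ℝ × ℝ => degenerateR r m lam Ψ p.1 p.2)
      {p ∈ Ω | (taylorAt entryM m lam Ψ p.1 p.2).det ≠ 0} := by
  simp only [degenerateR, formulaR, taylorAt_entryW hb, taylorAt_entryM, taylorAt_entryP]
  have hs : {p ∈ Ω | (colMatrix fun i => taylorVec m lam Ψ 0 1 i p.1 p.2).det ≠ 0} ⊆ Ω :=
    fun _ h => h.1
  have hM := (contDiffOn_det_taylor (m := m) hΩ hD hDo hΨ 0 1).mono hs
  have hP := (contDiffOn_det_taylor (m := m) hΩ hD hDo hΨ 1 0).mono hs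
  have hW := (contDiffOn_det_taylor_updateCol (m := m) hΩ hD hDo hΨ 1 0 ⟨0, dtSize_pos hb⟩).mono hs
  simp only [sub_eq_add_neg, ← neg_mul]
  exact contDiffOn_formula hP hW hM (hr.mono hs) (fun p hp => hp.2) _

theorem isKNSolutionOn_degenerate (hb : 1 ≤ b) (hΩ : IsOpen Ω) (hKN : IsKNSolutionOn q r Ω)
    (hD : ∀ c, lam c ∈ D c) (hDo : ∀ i, IsOpen (D (Sum.inl i)))
    (hΨ : ∀ c, IsEigenfunctionFamily q r Ω (D c) (Ψ c)) :
    IsKNSolutionOn (degenerateQ q m lam Ψ) (degenerateR r m lam Ψ)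
      {p ∈ Ω | (taylorAt entryP m lam Ψ p.1 p.2).det ≠ 0 ∧
        (taylorAt entryM m lam Ψ p.1 p.2).det ≠ 0} := by
  obtain ⟨hq, hr, heq⟩ := hKN
  set Ω' : Set (ℝ × ℝ) := {p ∈ Ω | (taylorAt entryP m lam Ψ p.1 p.2).det ≠ 0 ∧
        (taylorAt entryM m lam Ψ p.1 p.2).det ≠ 0} with hΩ'
  have hsub : Ω' ⊆ Ω := fun p hp => hp.1
  have hopen : IsOpen Ω' := by
    have h1 := isOpen_nonsingular hΩ (contDiffOn_det_taylor (m := m) hΩ hD hDo hΨ 1 0)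
    have h2 := isOpen_nonsingular hΩ (contDiffOn_det_taylor (m := m) hΩ hD hDo hΨ 0 1)
    convert! h1.inter h2 using 1
    ext p
    simp only [hΩ', taylorAt_entryM, taylorAt_entryP, Set.mem_ofPred_eq, Set.mem_inter_iff]
    tauto
  have hdet : ∀ x t, (x, t) ∈ Ω' → LaxSequence.detAt (taylorVec m lam Ψ 0 1) x t ≠ 0 ∧
      LaxSequence.detAt (taylorVec m lam Ψ 1 0) x t ≠ 0 := fun x t h => by
    refine ⟨?_, ?_⟩
    · have := h.2.2; rwa [taylorAt_entryM] at this
    · have := h.2.1; rwa [taylorAt_entryP] at this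
  have S := (laxSequence_taylorVec (m := m) hΩ hD hDo hΨ).mono hsub
  have hN : 1 ≤ dtSize b m n := dtSize_pos hb
  have dx : ∀ {f : ℝ → ℝ → ℂ}, ContDiffOn ℝ ∞ (fun p : ℝ × ℝ => f p.1 p.2) Ω → ∀ x t,
      (x, t) ∈ Ω' → HasDerivAt (fun y => f y t) (deriv (fun y => f y t) x) x := fun hf x t h =>
    (hasDerivAt_x_of_contDiffOn hf hΩ (hsub h)).differentiableAt.hasDerivAt
  have dt : ∀ {f : ℝ → ℝ → ℂ}, ContDiffOn ℝ ∞ (fun p : ℝ × ℝ => f p.1 p.2) Ω → ∀ x t,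
      (x, t) ∈ Ω' → HasDerivAt (fun s => f x s) (deriv (fun s => f x s) t) t := fun hf x t h =>
    (hasDerivAt_t_of_contDiffOn hf hΩ (hsub h)).differentiableAt.hasDerivAt
  refine ⟨(contDiffOn_degenerateQ hb hΩ hD hDo hΨ hq).mono fun p hp => ⟨hp.1, hp.2.1⟩,
    (contDiffOn_degenerateR hb hΩ hD hDo hΨ hr).mono fun p hp => ⟨hp.1, hp.2.2⟩,
    fun x t h => ⟨?_, ?_⟩⟩
  · rw [degenerateQ_eq hb, degenerateR_eq hb]
    refine S.kaupNewell_newPotential hN dtSize_even Complex.I_sq hopen hdet (dx hq) (dx hr)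
      (dx (contDiffOn_deriv_x hq hΩ)) (dt hq) (fun x t h => ?_) h
    have e := (((dx hq x t h).pow 2).mul (dx hr x t h)).deriv
    refine Eq.trans ?_ (heq x t (hsub h)).1
    rw [show (fun y => q y t ^ 2 * r y t) = (fun y => q y t) ^ 2 * fun y => r y t from rfl, e]
    simp
  · rw [degenerateQ_eq hb, degenerateR_eq hb]
    -- The swapped statement, with `-i` in place of `i`, is the negative of the second Kaup-Newell
    -- equation.
    have key := S.swap.kaupNewell_newPotential hN dtSize_even (by simp) hopen
      (fun x t h => (hdet x t h).symm) (dx hr) (dx hq)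
      (dx (contDiffOn_deriv_x hr hΩ)) (dt hr) (fun x t h => ?_) h
    · rw [neg_neg] at key
      simp only [mul_comm (LaxSequence.newPotential Complex.I _ _ _ _ _)]
      linear_combination -key
    · have e := ((dx hq x t h).mul ((dx hr x t h).pow 2)).deriv
      have e' := (heq x t (hsub h)).2
      rw [show (fun y => q y t * r y t ^ 2) = (fun y => q y t) * (fun y => r y t) ^ 2 from rfl, e]
        at e'
      simp only [Pi.pow_apply] at e'
      norm_num at e'
      linear_combination -e'

end Solution

/-! ### Divided differences -/

section DividedDifferences

variable {f : ℂ → ℂ} {D : Set ℂ} {μ : ℂ} {R : ℝ}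

/-- The divided difference of `f` at `w 0, …, w k`, as a Cauchy integral. -/
def dividedDifference (f : ℂ → ℂ) (μ : ℂ) (R : ℝ) (w : ℕ → ℂ) (k : ℕ) : ℂ :=
  (2 * Real.pi * Complex.I : ℂ)⁻¹ *
    ∮ ζ in C(μ, R), (∏ l ∈ Finset.range (k + 1), (ζ - w l)⁻¹) * f ζ

theorem continuousOn_prod_inv (hf : ContinuousOn f (Metric.sphere μ R)) (s : Finset ℕ)
    {w : ℕ → ℂ} (hw : ∀ l ∈ s, w l ∈ Metric.ball μ R) :
    ContinuousOn (fun ζ => (∏ l ∈ s, (ζ - w l)⁻¹) * f ζ) (Metric.sphere μ R) := by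
  refine (continuousOn_finsetProd _ fun l hl => ?_).mul hf
  refine ((continuous_id.sub continuous_const).continuousOn).inv₀ fun ζ hζ h => ?_
  have := hw l hl
  have h' : ζ = w l := sub_eq_zero.1 h
  rw [← h'] at this
  simp only [Metric.mem_ball, Metric.mem_sphere] at this hζ
  linarith

/-- Defining divided differences by Cauchy integrals makes Newton's formula valid without distinct
points and gives continuity in the points. -/
theorem newton_interpolation (hR : 0 < R) (hf : DifferentiableOn ℂ f (Metric.closedBall μ R))
    {w : ℕ → ℂ} {d : ℕ} (hw : ∀ l ≤ d, w l ∈ Metric.ball μ R) :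
    f (w d) = ∑ k ∈ Finset.range (d + 1),
      (∏ l ∈ Finset.range k, (w d - w l)) * dividedDifference f μ R w k := by
  have hc : ContinuousOn f (Metric.sphere μ R) :=
    hf.continuousOn.mono Metric.sphere_subset_closedBall
  set E : ℕ → ℂ := fun K => (2 * Real.pi * Complex.I : ℂ)⁻¹ *
    ∮ ζ in C(μ, R), (∏ l ∈ insert d (Finset.range K), (ζ - w l)⁻¹) * f ζ with hE
  -- `E K` is the divided difference at `w 0, …, w (K-1), w d`. The recursion is the identity
  -- `1/(ζ-w d) = 1/(ζ-w K) + (w d-w K)/((ζ-w d)(ζ-w K))` under the integral; `K < d` keeps `d`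
  -- outside the range.
  have hstep : ∀ K < d, E K = dividedDifference f μ R w K + (w d - w K) * E (K + 1) := by
    intro K hK
    have hi : ∀ s : Finset ℕ, (∀ l ∈ s, l ≤ d) →
        CircleIntegrable (fun ζ => (∏ l ∈ s, (ζ - w l)⁻¹) * f ζ) μ R := fun s hs =>
      (continuousOn_prod_inv hc s fun l hl => hw l (hs l hl)).circleIntegrable hR.le
    have h1 := hi (Finset.range (K + 1)) fun l hl => by
      have := Finset.mem_range.1 hl; omega
    have h2 := hi (insert d (Finset.range (K + 1))) fun l hl => by
      rcases Finset.mem_insert.1 hl with rfl | hl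
      · exact le_rfl
      · have := Finset.mem_range.1 hl; omega
    simp only [hE, dividedDifference]
    suffices h3 : (∮ ζ in C(μ, R), (∏ l ∈ insert d (Finset.range K), (ζ - w l)⁻¹) * f ζ) =
        (∮ ζ in C(μ, R), (∏ l ∈ Finset.range (K + 1), (ζ - w l)⁻¹) * f ζ) + (w d - w K) *
          ∮ ζ in C(μ, R), (∏ l ∈ insert d (Finset.range (K + 1)), (ζ - w l)⁻¹) * f ζ by
      rw [h3]; ring
    have h3 : CircleIntegrable (fun ζ => (w d - w K) *
        ((∏ l ∈ insert d (Finset.range (K + 1)), (ζ - w l)⁻¹) * f ζ)) μ R := h2.const_smul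
    rw [← circleIntegral.integral_const_mul, ← circleIntegral.integral_add h1 h3]
    refine circleIntegral.integral_congr hR.le fun ζ hζ => ?_
    have hne : ∀ l ≤ d, ζ - w l ≠ 0 := fun l hl h => by
      have := hw l hl
      rw [← sub_eq_zero.1 h] at this
      simp only [Metric.mem_ball, Metric.mem_sphere] at this hζ
      linarith
    have n1 := hne d le_rfl
    have n2 := hne K hK.le
    rw [Finset.prod_insert (by simp; omega), Finset.prod_insert (by simp; omega),
      Finset.prod_range_succ]
    field_simp
    ring
  have hsum : ∀ K ≤ d, f (w d) = ∑ k ∈ Finset.range K,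
      (∏ l ∈ Finset.range k, (w d - w l)) * dividedDifference f μ R w k
      + (∏ l ∈ Finset.range K, (w d - w l)) * E K := by
    intro K
    induction K with
    | zero =>
      intro _
      have := Complex.two_pi_I_inv_smul_circleIntegral_sub_inv_smul_of_differentiable_on_off_countable
        Set.countable_empty (hw d le_rfl) hf.continuousOn
        (fun z hz => hf.differentiableAt (Filter.mem_of_superset
          (Metric.isOpen_ball.mem_nhds hz.1) Metric.ball_subset_closedBall))
      simp only [smul_eq_mul] at this
      simp [hE, ← this]
    | succ K ih =>
      intro hK
      rw [ih (by omega), hstep K (by omega), Finset.sum_range_succ, Finset.prod_range_succ]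
      ring
  rw [Finset.sum_range_succ]
  -- For `K = d` the remainder is itself the last Newton term, as `insert d (range d) = range
  -- (d+1)`.
  convert hsum d le_rfl using 3
  simp only [dividedDifference, hE]
  rw [Finset.range_add_one]

theorem dividedDifference_const (hR : 0 < R) (hf : DifferentiableOn ℂ f (Metric.closedBall μ R))
    (k : ℕ) : dividedDifference f μ R (fun _ => μ) k = taylorCoeff k μ f := by
  lift R to NNReal using hR.le
  have h := (DifferentiableOn.hasFPowerSeriesOnBall hf (by exact_mod_cast hR)).factorial_smul 1 k
  rw [← iteratedDeriv_eq_iteratedFDeriv, cauchyPowerSeries_apply] at h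
  rw [taylorCoeff_eq, ← h, dividedDifference]
  have : (k.factorial : ℂ) ≠ 0 := by exact_mod_cast k.factorial_ne_zero
  simp only [nsmul_eq_mul, smul_eq_mul]
  rw [mul_div_cancel_left₀ _ this]
  congr 2
  ext ζ
  simp [Finset.prod_const, pow_succ]
  ring

/-- Dominated convergence in the Cauchy integral; when all points equal `μ`, that integral is
Cauchy's formula for the Taylor coefficient. -/
theorem tendsto_dividedDifference (hR : 0 < R)
    (hf : DifferentiableOn ℂ f (Metric.closedBall μ R)) {α : Type*} {F : Filter α}
    [F.IsCountablyGenerated] {w : α → ℕ → ℂ} {k : ℕ}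
    (hw : ∀ l ≤ k, Filter.Tendsto (fun a => w a l) F (𝓝 μ)) :
    Filter.Tendsto (fun a => dividedDifference f μ R (w a) k) F (𝓝 (taylorCoeff k μ f)) := by
  have hc : ContinuousOn f (Metric.sphere μ R) :=
    hf.continuousOn.mono Metric.sphere_subset_closedBall
  rw [← dividedDifference_const hR hf]
  refine Filter.Tendsto.const_mul _ ?_
  obtain ⟨C, hC⟩ := (isCompact_sphere μ R).exists_bound_of_continuousOn hc
  -- Points within `R / 2` of the centre stay at distance at least `R / 2` from the contour, which
  -- bounds the integrand uniformly.
  have hev : ∀ᶠ a in F, ∀ l ∈ Finset.range (k + 1), w a l ∈ Metric.ball μ (R / 2) := by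
    rw [Filter.eventually_all_finset]
    intro l hl
    exact (hw l (by have := Finset.mem_range.1 hl; omega)).eventually_mem
      (Metric.ball_mem_nhds _ (by linarith))
  unfold circleIntegral
  have hbase : ∀ ζ ∈ Metric.sphere μ R, ∀ v ∈ Metric.ball μ (R / 2), R / 2 ≤ ‖ζ - v‖ := by
    intro ζ hζ v hv
    simp only [Metric.mem_sphere, Metric.mem_ball] at hζ hv
    have := dist_triangle ζ v μ
    rw [← dist_eq_norm]
    linarith
  have hs : ∀ θ, circleMap μ R θ ∈ Metric.sphere μ R := fun θ => circleMap_mem_sphere _ hR.le θ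
  refine intervalIntegral.tendsto_integral_filter_of_dominated_convergence
    (fun _ => R * (((R / 2)⁻¹) ^ (k + 1) * C)) ?_ ?_ ?_ ?_
  · filter_upwards [hev] with a ha
    have h1 : ContinuousOn (fun ζ => (∏ l ∈ Finset.range (k + 1), (ζ - w a l)⁻¹) * f ζ)
        (Metric.sphere μ R) := continuousOn_prod_inv hc _ fun l hl =>
      Metric.ball_subset_ball (by linarith) (ha l hl)
    have h2 : Continuous fun θ => (∏ l ∈ Finset.range (k + 1), (circleMap μ R θ - w a l)⁻¹)
        * f (circleMap μ R θ) := h1.comp_continuous (continuous_circleMap μ R) hs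
    simp only [deriv_circleMap]
    exact (((continuous_circleMap 0 R).mul continuous_const).smul h2).aestronglyMeasurable
  · filter_upwards [hev] with a ha
    refine Filter.Eventually.of_forall fun θ _ => ?_
    rw [norm_smul, norm_mul, norm_prod]
    have e1 : ‖deriv (circleMap μ R) θ‖ = R := by
      simp [deriv_circleMap, abs_of_pos hR]
    rw [e1]
    refine mul_le_mul_of_nonneg_left (mul_le_mul ?_ (hC _ (hs θ)) (norm_nonneg _)
      (by positivity)) hR.le
    calc ∏ l ∈ Finset.range (k + 1), ‖(circleMap μ R θ - w a l)⁻¹‖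
        ≤ ∏ l ∈ Finset.range (k + 1), (R / 2)⁻¹ := by
          refine Finset.prod_le_prod (fun _ _ => norm_nonneg _) fun l hl => ?_
          rw [norm_inv]
          exact inv_anti₀ (by linarith) (hbase _ (hs θ) _ (ha l hl))
      _ = _ := by rw [Finset.prod_const, Finset.card_range]
  · exact intervalIntegrable_const
  · refine Filter.Eventually.of_forall fun θ _ => ?_
    refine Filter.Tendsto.const_smul (Filter.Tendsto.mul_const _ ?_) _
    refine tendsto_finsetProd _ fun l hl => ?_
    refine ((tendsto_const_nhds.sub (hw l ?_)).inv₀ ?_)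
    · have := Finset.mem_range.1 hl; omega
    · have := hbase _ (hs θ) μ (Metric.mem_ball_self (by linarith))
      intro h
      rw [h, norm_zero] at this
      linarith

end DividedDifferences

/-! ### The degenerate transformation as a limit -/

section Limit

variable {b n : ℕ} {m : Fin b → ℕ} {lam : Node b n → ℂ}

/-- The parameters of the rows of node `c`, by increasing order of the rows. -/
def nodeSeq (Λ : Fin (dtSize b m n) → ℂ) (c : Node b n) (l : ℕ) : ℂ :=
  if h : l < nodeMult m c then Λ ((rowEquiv b m n).symm ⟨c, ⟨l, h⟩⟩) else 0

theorem nodeSeq_row (Λ : Fin (dtSize b m n) → ℂ) (j : Fin (dtSize b m n)) :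
    nodeSeq Λ (rowNode b m n j) (rowOrder b m n j) = Λ j := by
  rw [nodeSeq, dif_pos (rowOrder_lt j)]
  congr 1
  exact (rowEquiv b m n).symm_apply_apply j

theorem tendsto_nodeSeq {c : Node b n} {l : ℕ} (h : l < nodeMult m c) :
    Filter.Tendsto (fun Λ => nodeSeq Λ c l)
      (𝓝[admissibleParams m lam] (limitParams m lam)) (𝓝 (lam c)) := by
  simp only [nodeSeq, dif_pos h]
  have := ((continuous_apply ((rowEquiv b m n).symm ⟨c, ⟨l, h⟩⟩)).tendsto
    (limitParams m lam)).mono_left (nhdsWithin_le_nhds (s := admissibleParams m lam))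
  rwa [limitParams, rowNode_symm m] at this

/-- The change of basis from divided differences to values. -/
def newtonMatrix (Λ : Fin (dtSize b m n) → ℂ) :
    Matrix (Fin (dtSize b m n)) (Fin (dtSize b m n)) ℂ :=
  Matrix.of fun i j => if rowNode b m n i = rowNode b m n j then
    ∏ l ∈ Finset.range (rowOrder b m n j), (Λ i - nodeSeq Λ (rowNode b m n i) l) else 0

/-- Within one node the matrix is lower triangular in the order, with products of differences of
distinct parameters on the diagonal. The row numbering does not group nodes, so the kernel is shown
to be trivial by induction on the order. -/
theorem det_newtonMatrix_ne_zero {Λ : Fin (dtSize b m n) → ℂ}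
    (hΛ : Λ ∈ admissibleParams m lam) : (newtonMatrix Λ).det ≠ 0 := by
  intro h0
  obtain ⟨v, hv, h⟩ := Matrix.exists_mulVec_eq_zero_iff.2 h0
  refine hv (funext fun j => ?_)
  have key : ∀ d j, rowOrder b m n j = d → v j = 0 := by
    intro d
    induction d using Nat.strong_induction_on with
    | _ d ih =>
      rintro j rfl
      have hj := congrFun h j
      rw [Matrix.mulVec, dotProduct, Finset.sum_eq_single j] at hj
      · simp only [newtonMatrix, Matrix.of_apply, if_true, Pi.zero_apply] at hj
        refine (mul_eq_zero.1 hj).resolve_left ?_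
        refine Finset.prod_ne_zero_iff.2 ?_
        intro l hl h1
        have hl' := Finset.mem_range.1 hl
        rw [nodeSeq, dif_pos (hl'.trans (rowOrder_lt j)), sub_eq_zero] at h1
        have := hΛ.2 _ _ (by rw [rowNode_symm m]) h1
        have h2 := congrArg (rowOrder b m n) this
        rw [rowOrder_symm m] at h2
        simp only at h2
        omega
      · intro i _ hij
        simp only [newtonMatrix, Matrix.of_apply]
        split_ifs with hn
        · rcases lt_or_ge (rowOrder b m n i) (rowOrder b m n j) with h1 | h1
          · rw [ih _ h1 i rfl, mul_zero]
          · have h2 : rowOrder b m n j < rowOrder b m n i :=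
              lt_of_le_of_ne h1 fun e => hij (row_ext hn.symm e.symm)
            -- An entry of higher order contains the factor `Λ j - Λ j`.
            rw [Finset.prod_eq_zero (Finset.mem_range.2 h2), zero_mul]
            rw [nodeSeq_row, sub_self]
        · exact zero_mul _
      · simp
  exact key _ j rfl

/-- At a pair node the coefficients are divided differences. At a free node the parameter is frozen
and the only coefficient is the value. -/
theorem exists_newton_coefficients {D : Node b n → Set ℂ} (hD : ∀ c, lam c ∈ D c)
    (hDo : ∀ i, IsOpen (D (Sum.inl i))) (c : Node b n) {f : ℂ → ℂ}
    (hf : DifferentiableOn ℂ f (D c)) :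
    ∃ δ : (Fin (dtSize b m n) → ℂ) → ℕ → ℂ,
      (∀ᶠ Λ in 𝓝[admissibleParams m lam] (limitParams m lam), ∀ d < nodeMult m c,
        f (nodeSeq Λ c d) = ∑ k ∈ Finset.range (nodeMult m c),
          (∏ l ∈ Finset.range k, (nodeSeq Λ c d - nodeSeq Λ c l)) * δ Λ k) ∧
      ∀ k < nodeMult m c, Filter.Tendsto (fun Λ => δ Λ k)
        (𝓝[admissibleParams m lam] (limitParams m lam)) (𝓝 (taylorCoeff k (lam c) f)) := by
  rcases c with i | i
  · obtain ⟨R, hR, hRD⟩ := Metric.nhds_basis_closedBall.mem_iff.1 ((hDo i).mem_nhds (hD _))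
    have hf' := hf.mono hRD
    refine ⟨fun Λ k => dividedDifference f (lam (Sum.inl i)) R (nodeSeq Λ (Sum.inl i)) k, ?_,
      fun k hk => tendsto_dividedDifference hR hf' fun l hl => tendsto_nodeSeq (by omega)⟩
    have hev : ∀ᶠ Λ in 𝓝[admissibleParams m lam] (limitParams m lam),
        ∀ l ∈ Finset.range (nodeMult m (Sum.inl i : Node b n)),
          nodeSeq Λ (Sum.inl i) l ∈ Metric.ball (lam (Sum.inl i)) R := by
      rw [Filter.eventually_all_finset]
      intro l hl
      exact (tendsto_nodeSeq (Finset.mem_range.1 hl)).eventually_mem (Metric.ball_mem_nhds _ hR)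
    filter_upwards [hev] with Λ hΛ d hd
    rw [newton_interpolation hR hf' (d := d) fun l hl => hΛ l (Finset.mem_range.2 (by omega))]
    -- The terms with `k > d` contain the factor `w d - w d`, so the sum may run over all orders of
    -- the node.
    refine Finset.sum_subset (fun k hk => ?_) fun k _ hk => ?_
    · simp only [Finset.mem_range] at *; omega
    · rw [Finset.prod_eq_zero (i := d) (by simp only [Finset.mem_range] at *; omega) (sub_self _),
        zero_mul]
  · refine ⟨fun _ _ => f (lam (Sum.inr i)), ?_, fun k hk => ?_⟩
    · filter_upwards [self_mem_nhdsWithin] with Λ hΛ d hd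
      have h1 : nodeMult m (Sum.inr i : Node b n) = 1 := rfl
      have hd0 : d = 0 := by omega
      subst hd0
      have : nodeSeq Λ (Sum.inr i) 0 = lam (Sum.inr i) := by
        rw [nodeSeq, dif_pos hd, hΛ.1 _ (by rw [rowOrder_symm m]), limitParams, rowNode_symm m]
      rw [h1, this]
      simp
    · have h1 : nodeMult m (Sum.inr i : Node b n) = 1 := rfl
      obtain rfl : k = 0 := by omega
      rw [taylorCoeff_zero]
      exact tendsto_const_nhds

/-- The left factor depends on `Λ` only and not on the entries `g`, so the same one serves `M`, `H`,
`P` and `W`. -/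
theorem exists_factorization {D : Node b n → Set ℂ} (hD : ∀ c, lam c ∈ D c)
    (hDo : ∀ i, IsOpen (D (Sum.inl i))) {g : Node b n → Fin (dtSize b m n) → ℂ → ℂ}
    (hg : ∀ c k, DifferentiableOn ℂ (g c k) (D c)) :
    ∃ B : (Fin (dtSize b m n) → ℂ) → Matrix (Fin (dtSize b m n)) (Fin (dtSize b m n)) ℂ,
      (∀ᶠ Λ in 𝓝[admissibleParams m lam] (limitParams m lam),
        (Matrix.of fun j k => g (rowNode b m n j) k (Λ j)) = newtonMatrix Λ * B Λ) ∧
      Filter.Tendsto B (𝓝[admissibleParams m lam] (limitParams m lam))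
        (𝓝 (Matrix.of fun j k =>
          taylorCoeff (rowOrder b m n j) (limitParams m lam j) (g (rowNode b m n j) k))) := by
  choose δ hδ hlim using fun c k => exists_newton_coefficients (m := m) hD hDo c (hg c k)
  refine ⟨fun Λ => Matrix.of fun j k => δ (rowNode b m n j) k Λ (rowOrder b m n j), ?_, ?_⟩
  · have hall : ∀ᶠ Λ in 𝓝[admissibleParams m lam] (limitParams m lam), ∀ c k,
        ∀ d < nodeMult m c, g c k (nodeSeq Λ c d) = ∑ e ∈ Finset.range (nodeMult m c),
          (∏ l ∈ Finset.range e, (nodeSeq Λ c d - nodeSeq Λ c l)) * δ c k Λ e := by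
      rw [Filter.eventually_all]
      intro c
      rw [Filter.eventually_all]
      exact fun k => hδ c k
    filter_upwards [hall] with Λ hΛ
    ext j k
    have h := hΛ (rowNode b m n j) k _ (rowOrder_lt j)
    rw [nodeSeq_row] at h
    -- Regroup the sum over rows as a sum over nodes and orders; only the node of row `j`
    -- contributes.
    rw [Matrix.of_apply, h, Matrix.mul_apply, ← (rowEquiv b m n).symm.sum_comp,
      Fintype.sum_sigma, Finset.sum_eq_single (rowNode b m n j), Finset.sum_range]
    · refine Finset.sum_congr rfl fun e _ => ?_
      simp only [newtonMatrix, Matrix.of_apply, rowNode_symm m, rowOrder_symm m, if_true]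
    · intro c _ hc
      refine Finset.sum_eq_zero fun e _ => ?_
      simp only [newtonMatrix, Matrix.of_apply, rowNode_symm m, if_neg hc.symm, zero_mul]
    · simp
  · refine tendsto_pi_nhds.2 fun j => tendsto_pi_nhds.2 fun k => ?_
    exact hlim _ k _ (rowOrder_lt j)

variable {Ψ : Node b n → ℝ → ℝ → ℂ → Fin 2 → ℂ} {D : Node b n → Set ℂ} {x t : ℝ}

theorem exists_factorization_nfoldAt (hD : ∀ c, lam c ∈ D c)
    (hDo : ∀ i, IsOpen (D (Sum.inl i))) (e : ∀ {N : ℕ}, Fin N → ℂ → (Fin 2 → ℂ) → ℂ)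
    (he : ∀ c (k : Fin (dtSize b m n)), DifferentiableOn ℂ (fun z => e k z (Ψ c x t z)) (D c)) :
    ∃ B : (Fin (dtSize b m n) → ℂ) → ℂ,
      (∀ᶠ Λ in 𝓝[admissibleParams m lam] (limitParams m lam),
        (nfoldAt e m Ψ Λ x t).det = (newtonMatrix Λ).det * B Λ) ∧
      Filter.Tendsto B (𝓝[admissibleParams m lam] (limitParams m lam))
        (𝓝 (taylorAt e m lam Ψ x t).det) := by
  obtain ⟨B, hB, hlim⟩ := exists_factorization (m := m) hD hDo he
  refine ⟨fun Λ => (B Λ).det, ?_, ?_⟩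
  · filter_upwards [hB] with Λ hΛ
    rw [← Matrix.det_mul, ← hΛ]
    rfl
  · exact ((Continuous.matrix_det continuous_id).tendsto _).comp hlim

theorem differentiableOn_entryM {N : ℕ} (k : Fin N) {f : ℂ → Fin 2 → ℂ} {s : Set ℂ}
    (hf : DifferentiableOn ℂ f s) : DifferentiableOn ℂ (fun z => entryM k z (f z)) s := by
  have h := differentiableOn_pi.1 hf
  unfold entryM
  split_ifs
  · exact (differentiableOn_id.pow _).mul (h 1)
  · exact (differentiableOn_id.pow _).mul (h 0)

theorem differentiableOn_entryP {N : ℕ} (k : Fin N) {f : ℂ → Fin 2 → ℂ} {s : Set ℂ}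
    (hf : DifferentiableOn ℂ f s) : DifferentiableOn ℂ (fun z => entryP k z (f z)) s := by
  have h := differentiableOn_pi.1 hf
  unfold entryP
  split_ifs
  · exact (differentiableOn_id.pow _).mul (h 0)
  · exact (differentiableOn_id.pow _).mul (h 1)

theorem differentiableOn_entryH {N : ℕ} (k : Fin N) {f : ℂ → Fin 2 → ℂ} {s : Set ℂ}
    (hf : DifferentiableOn ℂ f s) : DifferentiableOn ℂ (fun z => entryH k z (f z)) s := by
  unfold entryH
  split_ifs
  · exact (differentiableOn_id.pow _).mul (differentiableOn_pi.1 hf 0)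
  · exact differentiableOn_entryM k hf

theorem differentiableOn_entryW {N : ℕ} (k : Fin N) {f : ℂ → Fin 2 → ℂ} {s : Set ℂ}
    (hf : DifferentiableOn ℂ f s) : DifferentiableOn ℂ (fun z => entryW k z (f z)) s := by
  unfold entryW
  split_ifs
  · exact (differentiableOn_id.pow _).mul (differentiableOn_pi.1 hf 1)
  · exact differentiableOn_entryP k hf

/-- Numerator and denominator each contain two determinants, so the square of the common factor
cancels and the remaining expression is continuous where `|P'| ≠ 0`. -/
theorem tendsto_nfoldQ (q : ℝ → ℝ → ℂ) (hD : ∀ c, lam c ∈ D c)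
    (hDo : ∀ i, IsOpen (D (Sum.inl i))) (hΨ : ∀ c, DifferentiableOn ℂ (Ψ c x t) (D c))
    (h : (taylorAt entryP m lam Ψ x t).det ≠ 0) :
    (∀ᶠ Λ in 𝓝[admissibleParams m lam] (limitParams m lam), (nfoldAt entryP m Ψ Λ x t).det ≠ 0) ∧
      Filter.Tendsto (fun Λ => nfoldQ q m Ψ Λ x t)
        (𝓝[admissibleParams m lam] (limitParams m lam)) (𝓝 (degenerateQ q m lam Ψ x t)) := by
  obtain ⟨M, hM, hMl⟩ := exists_factorization_nfoldAt (m := m) hD hDo entryM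
    fun c k => differentiableOn_entryM k (hΨ c)
  obtain ⟨H, hH, hHl⟩ := exists_factorization_nfoldAt (m := m) hD hDo entryH
    fun c k => differentiableOn_entryH k (hΨ c)
  obtain ⟨P, hP, hPl⟩ := exists_factorization_nfoldAt (m := m) hD hDo entryP
    fun c k => differentiableOn_entryP k (hΨ c)
  have hP0 := hPl.eventually_ne h
  constructor
  · filter_upwards [hP, hP0, self_mem_nhdsWithin] with Λ h1 h2 h3
    rw [h1]
    exact mul_ne_zero (det_newtonMatrix_ne_zero h3) h2
  · refine Filter.Tendsto.congr' (f₁ := fun Λ =>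
      M Λ ^ 2 / P Λ ^ 2 * q x t + 2 * Complex.I * (M Λ * H Λ / P Λ ^ 2)) ?_ ?_
    · filter_upwards [hM, hH, hP, hP0, self_mem_nhdsWithin] with Λ h1 h2 h3 h4 h5
      have := det_newtonMatrix_ne_zero h5
      rw [nfoldQ, formulaQ, h1, h2, h3]
      field_simp
    · have h2 := pow_ne_zero 2 h
      exact (((hMl.pow 2).div (hPl.pow 2) h2).mul_const _).add
        (((hMl.mul hHl).div (hPl.pow 2) h2).const_mul _)

theorem tendsto_nfoldR (r : ℝ → ℝ → ℂ) (hD : ∀ c, lam c ∈ D c)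
    (hDo : ∀ i, IsOpen (D (Sum.inl i))) (hΨ : ∀ c, DifferentiableOn ℂ (Ψ c x t) (D c))
    (h : (taylorAt entryM m lam Ψ x t).det ≠ 0) :
    (∀ᶠ Λ in 𝓝[admissibleParams m lam] (limitParams m lam), (nfoldAt entryM m Ψ Λ x t).det ≠ 0) ∧
      Filter.Tendsto (fun Λ => nfoldR r m Ψ Λ x t)
        (𝓝[admissibleParams m lam] (limitParams m lam)) (𝓝 (degenerateR r m lam Ψ x t)) := by
  obtain ⟨M, hM, hMl⟩ := exists_factorization_nfoldAt (m := m) hD hDo entryM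
    fun c k => differentiableOn_entryM k (hΨ c)
  obtain ⟨W, hW, hWl⟩ := exists_factorization_nfoldAt (m := m) hD hDo entryW
    fun c k => differentiableOn_entryW k (hΨ c)
  obtain ⟨P, hP, hPl⟩ := exists_factorization_nfoldAt (m := m) hD hDo entryP
    fun c k => differentiableOn_entryP k (hΨ c)
  have hM0 := hMl.eventually_ne h
  constructor
  · filter_upwards [hM, hM0, self_mem_nhdsWithin] with Λ h1 h2 h3
    rw [h1]
    exact mul_ne_zero (det_newtonMatrix_ne_zero h3) h2
  · refine Filter.Tendsto.congr' (f₁ := fun Λ =>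
      P Λ ^ 2 / M Λ ^ 2 * r x t - 2 * Complex.I * (P Λ * W Λ / M Λ ^ 2)) ?_ ?_
    · filter_upwards [hM, hW, hP, hM0, self_mem_nhdsWithin] with Λ h1 h2 h3 h4 h5
      have := det_newtonMatrix_ne_zero h5
      rw [nfoldR, formulaR, h1, h2, h3]
      field_simp
    · have h2 := pow_ne_zero 2 h
      exact (((hPl.pow 2).div (hMl.pow 2) h2).mul_const _).sub
        (((hPl.mul hWl).div (hMl.pow 2) h2).const_mul _)

end Limit

/-! ### Reduction to the derivative nonlinear Schrödinger equation -/

section Reflection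

open ComplexConjugate

/-- Conjugating inside and outside commutes with complex differentiation; each derivative
contributes a sign from the inner negation. -/
theorem iteratedDeriv_conj_neg_conj (d : ℕ) (g : ℂ → ℂ) :
    iteratedDeriv d (fun z => conj (g (-conj z))) =
      fun z => (-1) ^ d * conj (iteratedDeriv d g (-conj z)) := by
  induction d with
  | zero => simp
  | succ d ih =>
    rw [iteratedDeriv_succ, ih, iteratedDeriv_succ]
    ext z
    have h1 : (fun z => conj (iteratedDeriv d g (-conj z))) =
        conj ∘ (fun w => iteratedDeriv d g (-w)) ∘ conj := rfl
    rw [deriv_const_mul_field, h1, deriv_conj_conj]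
    simp only [Function.comp_apply, deriv_comp_neg, map_neg]
    ring

theorem conj_taylorCoeff (d : ℕ) (μ : ℂ) (g : ℂ → ℂ) :
    conj (taylorCoeff d (-conj μ) g) =
      (-1) ^ d * taylorCoeff d μ (fun z => conj (g (-conj z))) := by
  rw [taylorCoeff_eq, taylorCoeff_eq, iteratedDeriv_conj_neg_conj, map_div₀, mul_div_assoc',
    ← mul_assoc, ← mul_pow]
  simp

theorem taylorCoeff_congr_of_admissible {D : Set ℂ} {μ : ℂ} {d : ℕ} (hD : Admissible D μ d)
    {g h : ℂ → ℂ} (e : Set.EqOn g h D) : taylorCoeff d μ g = taylorCoeff d μ h := by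
  obtain ⟨hμ, rfl | hD⟩ := hD
  · rw [taylorCoeff_zero, taylorCoeff_zero, e hμ]
  · exact taylorCoeff_congr (e.eventuallyEq_of_mem (hD.mem_nhds hμ))

variable {b n : ℕ} {m : Fin b → ℕ} {lam : Node b n → ℂ}
  {Ψ : Node b n → ℝ → ℝ → ℂ → Fin 2 → ℂ} {τ : Node b n → Node b n}

/-- The permutation of the rows induced by an involution of the nodes. -/
def rowPerm (m : Fin b → ℕ) (hτ : Function.Involutive τ)
    (hm : ∀ c, nodeMult m (τ c) = nodeMult m c) : Equiv.Perm (Fin (dtSize b m n)) :=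
  Function.Involutive.toPerm (fun j => (rowEquiv b m n).symm
    ⟨τ (rowNode b m n j), ⟨rowOrder b m n j, (rowOrder_lt j).trans_eq (hm _).symm⟩⟩) fun j => by
      refine row_ext ?_ ?_
      · rw [rowNode_symm m]; simp only; rw [rowNode_symm m]; exact hτ _
      · rw [rowOrder_symm m]; simp only; rw [rowOrder_symm m]

theorem rowNode_rowPerm (hτ : Function.Involutive τ)
    (hm : ∀ c, nodeMult m (τ c) = nodeMult m c) (j : Fin (dtSize b m n)) :
    rowNode b m n (rowPerm m hτ hm j) = τ (rowNode b m n j) := rowNode_symm m _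

theorem rowOrder_rowPerm (hτ : Function.Involutive τ)
    (hm : ∀ c, nodeMult m (τ c) = nodeMult m c) (j : Fin (dtSize b m n)) :
    rowOrder b m n (rowPerm m hτ hm j) = rowOrder b m n j := rowOrder_symm m _

variable {D : Node b n → Set ℂ} {x t : ℝ}

/-- The sign splits into a row factor, from differentiating through `z ↦ -z*`, and a column factor,
from the power of `-z*`. This product form lets the signs leave the determinant. -/
theorem conj_taylorVec (hτ : Function.Involutive τ) (hm : ∀ c, nodeMult m (τ c) = nodeMult m c)
    (hlam : ∀ c, lam (τ c) = -conj (lam c)) (hD : ∀ c, lam c ∈ D c)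
    (hDo : ∀ i, IsOpen (D (Sum.inl i)))
    (hΨ : ∀ c w, ∀ z ∈ D c, -conj z ∈ D (τ c) →
      conj (Ψ (τ c) x t (-conj z) w) = Ψ c x t z (1 - w)) (u v : Fin 2) (p : ℕ)
    (j : Fin (dtSize b m n)) :
    conj (taylorVec m lam Ψ u v p x t (rowPerm m hτ hm j)) =
      (-1) ^ rowOrder b m n j * ((-1) ^ p * taylorVec m lam Ψ (1 - u) (1 - v) p x t j) := by
  -- The symmetry of the eigenfunctions is known only where both are defined, so Taylor coefficients
  -- are compared on this intersection.
  have hadm : Admissible (D (rowNode b m n j) ∩ {z | -conj z ∈ D (τ (rowNode b m n j))})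
      (lam (rowNode b m n j)) (rowOrder b m n j) := by
    have h1 := admissible_row hD hDo j
    have h2 := admissible_row hD hDo (rowPerm m hτ hm j)
    rw [rowNode_rowPerm, rowOrder_rowPerm] at h2
    refine ⟨⟨h1.1, ?_⟩, ?_⟩
    · rw [Set.mem_ofPred_eq, ← hlam]; exact h2.1
    · rcases h1.2 with h | h
      · exact Or.inl h
      rcases h2.2 with h' | h'
      · exact Or.inl h'
      · exact Or.inr (h.inter (h'.preimage (Complex.continuous_conj.neg)))
  simp only [taylorVec, rowNode_rowPerm, rowOrder_rowPerm, hlam]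
  rw [conj_taylorCoeff]
  congr 1
  rw [← taylorCoeff_const_mul]
  refine taylorCoeff_congr_of_admissible hadm fun z hz => ?_
  have hc := fun w => hΨ _ w z hz.1 hz.2
  simp only [map_mul, map_pow, map_neg, Complex.conj_conj]
  rw [neg_pow z, mul_assoc]
  split_ifs
  · rw [hc]
  · rw [hc]

/-- Arbitrary exponents `e` cover `M'` and `P'` as well as `H'` and `W'`. -/
theorem conj_det_taylorVec (hτ : Function.Involutive τ)
    (hm : ∀ c, nodeMult m (τ c) = nodeMult m c)
    (hlam : ∀ c, lam (τ c) = -conj (lam c)) (hD : ∀ c, lam c ∈ D c)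
    (hDo : ∀ i, IsOpen (D (Sum.inl i)))
    (hΨ : ∀ c w, ∀ z ∈ D c, -conj z ∈ D (τ c) →
      conj (Ψ (τ c) x t (-conj z) w) = Ψ c x t z (1 - w)) (u v : Fin 2)
    (e : Fin (dtSize b m n) → ℕ) :
    conj (Matrix.of fun j k => taylorVec m lam Ψ u v (e k) x t j).det =
      ((Equiv.Perm.sign (rowPerm m hτ hm) : ℤ) : ℂ) * (∏ j, (-1) ^ rowOrder b m n j) *
        (∏ k, (-1) ^ e k) *
        (Matrix.of fun j k => taylorVec m lam Ψ (1 - u) (1 - v) (e k) x t j).det := by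
  have h1 : ((Equiv.Perm.sign (rowPerm m hτ hm) : ℤ) : ℂ) *
      ((Equiv.Perm.sign (rowPerm m hτ hm) : ℤ) : ℂ) = 1 := by
    rw [← Int.cast_mul, Int.units_coe_mul_self, Int.cast_one]
  have h2 := Matrix.det_permute (rowPerm m hτ hm)
    ((starRingEnd ℂ).mapMatrix (Matrix.of fun j k => taylorVec m lam Ψ u v (e k) x t j))
  have h3 : ((starRingEnd ℂ).mapMatrix
      (Matrix.of fun j k => taylorVec m lam Ψ u v (e k) x t j)).submatrix (rowPerm m hτ hm) id =
      Matrix.of fun j k => (-1) ^ rowOrder b m n j * (Matrix.of fun j k => (-1) ^ e k *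
        (Matrix.of fun j k => taylorVec m lam Ψ (1 - u) (1 - v) (e k) x t j) j k) j k := by
    ext j k
    simp only [Matrix.submatrix_apply, RingHom.mapMatrix_apply, Matrix.map_apply, Matrix.of_apply,
      id]
    exact conj_taylorVec hτ hm hlam hD hDo hΨ u v (e k) j
  rw [h3, Matrix.det_mul_column, Matrix.det_mul_row] at h2
  rw [RingHom.map_det, mul_assoc, mul_assoc, h2, ← mul_assoc, h1, one_mul]

theorem colMatrix_updateCol_zero (hN : 0 < dtSize b m n) (u v : Fin 2) :
    (colMatrix fun p => taylorVec m lam Ψ u v p x t).updateCol ⟨0, hN⟩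
      (taylorVec m lam Ψ u v (dtSize b m n) x t) =
    Matrix.of fun j k => taylorVec m lam Ψ u v
      (if k = (⟨0, hN⟩ : Fin (dtSize b m n)) then dtSize b m n else dtSize b m n - 1 - k) x t j := by
  ext j k
  simp only [Matrix.updateCol_apply, colMatrix, Matrix.of_apply]
  split_ifs <;> rfl

/-- The first exponent rises from `N-1` to `N`. This one sign is the origin of the minus in `r_N =
-q_N*`. -/
theorem prod_neg_one_pow_updated (N : ℕ) (hN : 0 < N) :
    ∏ k : Fin N, (-1 : ℂ) ^ (if k = ⟨0, hN⟩ then N else N - 1 - k) =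
      -∏ k : Fin N, (-1 : ℂ) ^ (N - 1 - (k : ℕ)) := by
  have h : ∀ k : Fin N, (-1 : ℂ) ^ (if k = ⟨0, hN⟩ then N else N - 1 - k) =
      (if k = ⟨0, hN⟩ then -1 else 1) * (-1 : ℂ) ^ (N - 1 - (k : ℕ)) := by
    intro k
    split_ifs with hk
    · subst hk
      rw [← pow_succ']
      congr 1
      simp only; omega
    · rw [one_mul]
  simp only [h, Finset.prod_mul_distrib, Finset.prod_ite_eq', Finset.mem_univ, if_true, neg_mul,
    one_mul]

theorem exists_sign_conj_det (hb : 1 ≤ b) (hτ : Function.Involutive τ)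
    (hm : ∀ c, nodeMult m (τ c) = nodeMult m c)
    (hlam : ∀ c, lam (τ c) = -conj (lam c)) (hD : ∀ c, lam c ∈ D c)
    (hDo : ∀ i, IsOpen (D (Sum.inl i)))
    (hΨ : ∀ c, ∀ z ∈ D c, -conj z ∈ D (τ c) →
      conj (Ψ (τ c) x t (-conj z) 0) = Ψ c x t z 1) :
    ∃ s : ℂ, s ^ 2 = 1 ∧
      conj (taylorAt entryP m lam Ψ x t).det = s * (taylorAt entryM m lam Ψ x t).det ∧
      conj (taylorAt entryM m lam Ψ x t).det = s * (taylorAt entryP m lam Ψ x t).det ∧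
      conj (taylorAt entryH m lam Ψ x t).det = -s * (taylorAt entryW m lam Ψ x t).det := by
  have hΨ' : ∀ c w, ∀ z ∈ D c, -conj z ∈ D (τ c) →
      conj (Ψ (τ c) x t (-conj z) w) = Ψ c x t z (1 - w) := by
    intro c w z h1 h2
    fin_cases w
    · exact hΨ c z h1 h2
    · have h3 : -conj (-conj z) = z := by simp
      -- The other component follows from the given symmetry at the image node, because `τ` and `z ↦
      -- -z*` are involutions.
      have := hΨ (τ c) (-conj z) h2 (by rw [h3, hτ c]; exact h1)
      rw [h3, hτ c] at this
      simp only [Fin.mk_one, Fin.isValue, sub_self]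
      rw [← this, Complex.conj_conj]
  have key := conj_det_taylorVec hτ hm hlam hD hDo hΨ'
  have hsq : ∀ {ι : Type} (s : Finset ι) (f : ι → ℕ), (∏ i ∈ s, (-1 : ℂ) ^ f i) ^ 2 = 1 := by
    intro ι s f
    rw [← Finset.prod_pow]
    exact Finset.prod_eq_one fun i _ => by rw [← pow_mul, mul_comm, pow_mul]; simp
  refine ⟨((Equiv.Perm.sign (rowPerm m hτ hm) : ℤ) : ℂ) * (∏ j, (-1) ^ rowOrder b m n j) *
    (∏ k : Fin (dtSize b m n), (-1) ^ (dtSize b m n - 1 - (k : ℕ))), ?_, ?_, ?_, ?_⟩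
  · rw [mul_pow, mul_pow, hsq, hsq, pow_two, ← Int.cast_mul, Int.units_coe_mul_self]
    simp
  · rw [taylorAt_entryP, taylorAt_entryM]
    exact key 1 0 fun k => dtSize b m n - 1 - k
  · rw [taylorAt_entryP, taylorAt_entryM]
    exact key 0 1 fun k => dtSize b m n - 1 - k
  · rw [taylorAt_entryH hb, taylorAt_entryW hb, colMatrix_updateCol_zero, colMatrix_updateCol_zero,
      key 0 1, prod_neg_one_pow_updated]
    simp only [sub_zero, sub_self]
    ring

theorem degenerateR_eq_neg_conj {q r : ℝ → ℝ → ℂ} (hb : 1 ≤ b) (hτ : Function.Involutive τ)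
    (hm : ∀ c, nodeMult m (τ c) = nodeMult m c)
    (hlam : ∀ c, lam (τ c) = -conj (lam c)) (hD : ∀ c, lam c ∈ D c)
    (hDo : ∀ i, IsOpen (D (Sum.inl i)))
    (hΨ : ∀ c, ∀ z ∈ D c, -conj z ∈ D (τ c) →
      conj (Ψ (τ c) x t (-conj z) 0) = Ψ c x t z 1) (hqr : r x t = -conj (q x t)) :
    degenerateR r m lam Ψ x t = -conj (degenerateQ q m lam Ψ x t) := by
  obtain ⟨s, hs, hP, hM, hH⟩ := exists_sign_conj_det (m := m) hb hτ hm hlam hD hDo hΨ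
  simp only [degenerateQ, degenerateR, formulaQ, formulaR, map_add, map_mul, map_div₀, map_pow,
    hP, hM, hH, hqr, mul_pow, hs, Complex.conj_I, map_ofNat]
  linear_combination (2 * Complex.I * (taylorAt entryP m lam Ψ x t).det *
    (taylorAt entryW m lam Ψ x t).det / (taylorAt entryM m lam Ψ x t).det ^ 2) * hs

theorem isDNLSSolutionOn_of_isKNSolutionOn {q r : ℝ → ℝ → ℂ} {Ω : Set (ℝ × ℝ)} (hΩ : IsOpen Ω)
    (h : IsKNSolutionOn q r Ω) (hqr : ∀ x t, (x, t) ∈ Ω → r x t = -conj (q x t)) :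
    IsDNLSSolutionOn q Ω := by
  refine ⟨h.1, fun x t hxt => ?_⟩
  have h1 := (h.2.2 x t hxt).1
  have e : (fun y => q y t ^ 2 * r y t) =ᶠ[𝓝 x] fun y => -(q y t ^ 2 * conj (q y t)) := by
    have hc : Continuous fun y : ℝ => (y, t) := by fun_prop
    filter_upwards [hc.continuousAt.preimage_mem_nhds (hΩ.mem_nhds hxt)] with y hy
    rw [hqr y t hy, mul_neg]
  rw [e.deriv_eq, deriv.fun_neg] at h1
  linear_combination h1

theorem isDNLSSolutionOn_degenerateQ {q r : ℝ → ℝ → ℂ} {Ω : Set (ℝ × ℝ)} (hb : 1 ≤ b)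
    (hΩ : IsOpen Ω) (hKN : IsKNSolutionOn q r Ω) (hD : ∀ c, lam c ∈ D c)
    (hDo : ∀ i, IsOpen (D (Sum.inl i)))
    (hΨ : ∀ c, IsEigenfunctionFamily q r Ω (D c) (Ψ c))
    (hqr : ∀ x t, (x, t) ∈ Ω → r x t = -conj (q x t)) (hτ : Function.Involutive τ)
    (hm : ∀ c, nodeMult m (τ c) = nodeMult m c)
    (hlam : ∀ c, lam (τ c) = -conj (lam c))
    (hsym : ∀ c, ∀ z ∈ D c, -conj z ∈ D (τ c) → ∀ x t : ℝ, (x, t) ∈ Ω →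
      conj (Ψ (τ c) x t (-conj z) 0) = Ψ c x t z 1) :
    IsDNLSSolutionOn (degenerateQ q m lam Ψ)
      {p ∈ Ω | (taylorAt entryP m lam Ψ p.1 p.2).det ≠ 0} := by
  -- By conjugation `|P'|` and `|M'|` vanish together, so one condition suffices in the reduced
  -- case.
  have hset : {p ∈ Ω | (taylorAt entryP m lam Ψ p.1 p.2).det ≠ 0} =
      {p ∈ Ω | (taylorAt entryP m lam Ψ p.1 p.2).det ≠ 0 ∧
        (taylorAt entryM m lam Ψ p.1 p.2).det ≠ 0} := by
    ext p
    refine ⟨fun h => ⟨h.1, h.2, fun h0 => h.2 ?_⟩, fun h => ⟨h.1, h.2.1⟩⟩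
    obtain ⟨s, -, hP, -, -⟩ := exists_sign_conj_det (m := m) hb hτ hm hlam hD hDo
      fun c z hz hz' => hsym c z hz hz' p.1 p.2 h.1
    rw [h0, mul_zero] at hP
    exact (map_eq_zero _).1 hP
  refine isDNLSSolutionOn_of_isKNSolutionOn (r := degenerateR r m lam Ψ) ?_ ?_ fun x t h => ?_
  · simp only [taylorAt_entryP]
    exact isOpen_nonsingular hΩ (contDiffOn_det_taylor (m := m) hΩ hD hDo hΨ 1 0)
  · rw [hset]
    exact isKNSolutionOn_degenerate hb hΩ hKN hD hDo hΨ
  · exact degenerateR_eq_neg_conj hb hτ hm hlam hD hDo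
      (fun c z hz hz' => hsym c z hz hz' x t h.1) (hqr x t h.1)

end Reflection

/-! ### The zero seed -/

section ZeroSeed

open ComplexConjugate

theorem iteratedDeriv_polynomial_eval (d : ℕ) (p : Polynomial ℂ) :
    iteratedDeriv d (fun z => p.eval z) = fun z => (Polynomial.derivative^[d] p).eval z := by
  induction d with
  | zero => simp
  | succ d ih =>
    rw [iteratedDeriv_succ, ih, Function.iterate_succ_apply']
    ext z
    exact Polynomial.deriv _

theorem isKNSolutionOn_zero : IsKNSolutionOn (fun _ _ => 0) (fun _ _ => 0) Set.univ :=
  ⟨contDiffOn_const, contDiffOn_const, fun x t _ => by simp⟩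

theorem contDiff_zeroSeedEigenfunction :
    ContDiff ℝ ∞ (fun w : (ℝ × ℝ) × ℂ => zeroSeedEigenfunction w.1.1 w.1.2 w.2) := by
  have hz : ContDiff ℝ ∞ fun w : (ℝ × ℝ) × ℂ => w.2 := contDiff_snd
  have hx : ContDiff ℝ ∞ fun w : (ℝ × ℝ) × ℂ => (w.1.1 : ℂ) :=
    Complex.ofRealCLM.contDiff.comp (contDiff_fst.comp contDiff_fst)
  have ht : ContDiff ℝ ∞ fun w : (ℝ × ℝ) × ℂ => (w.1.2 : ℂ) :=
    Complex.ofRealCLM.contDiff.comp (contDiff_snd.comp contDiff_fst)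
  have h : ContDiff ℝ ∞ fun w : (ℝ × ℝ) × ℂ =>
      Complex.I * (w.2 ^ 2 * w.1.1 + 2 * w.2 ^ 4 * w.1.2) :=
    contDiff_const.mul (((hz.pow 2).mul hx).add ((contDiff_const.mul (hz.pow 4)).mul ht))
  refine contDiff_pi.2 fun i => ?_
  fin_cases i
  · exact h.cexp
  · exact h.neg.cexp

theorem isEigenfunctionFamily_zeroSeed :
    IsEigenfunctionFamily (fun _ _ => 0) (fun _ _ => 0) Set.univ Set.univ
      zeroSeedEigenfunction where
  smooth := contDiff_zeroSeedEigenfunction.contDiffOn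
  holomorphic x t _ := by
    refine differentiableOn_pi.2 fun i => ?_
    fin_cases i
    · exact Differentiable.differentiableOn (by
        simp only [zeroSeedEigenfunction]; dsimp; fun_prop)
    · exact Differentiable.differentiableOn (by
        simp only [zeroSeedEigenfunction]; dsimp; fun_prop)
  lax_x x t _ z _ := by
    have h : HasDerivAt (fun y : ℝ => Complex.I * (z ^ 2 * y + 2 * z ^ 4 * t))
        (Complex.I * z ^ 2) x := by
      have := ((((hasDerivAt_id' x).ofReal_comp).const_mul (z ^ 2)).add_const
        (2 * z ^ 4 * (t : ℂ))).const_mul Complex.I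
      simpa using this
    refine hasDerivAt_pi.2 fun i => ?_
    fin_cases i
    · refine HasDerivAt.congr_deriv h.cexp ?_
      simp [zeroSeedEigenfunction, laxU, sigma, potential, Matrix.mulVec, dotProduct,
        Fin.sum_univ_two]
      ring
    · refine HasDerivAt.congr_deriv h.neg.cexp ?_
      simp [zeroSeedEigenfunction, laxU, sigma, potential, Matrix.mulVec, dotProduct,
        Fin.sum_univ_two]
      ring
  lax_t x t _ z _ := by
    have h : HasDerivAt (fun s : ℝ => Complex.I * (z ^ 2 * x + 2 * z ^ 4 * s))
        (Complex.I * (2 * z ^ 4)) t := by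
      have := ((((hasDerivAt_id' t).ofReal_comp).const_mul (2 * z ^ 4)).const_add
        (z ^ 2 * (x : ℂ))).const_mul Complex.I
      simpa using this
    refine hasDerivAt_pi.2 fun i => ?_
    fin_cases i
    · refine HasDerivAt.congr_deriv h.cexp ?_
      simp [zeroSeedEigenfunction, laxV, sigma, potential, Matrix.mulVec, dotProduct,
        Fin.sum_univ_two, pow_succ]
      ring
    · refine HasDerivAt.congr_deriv h.neg.cexp ?_
      simp [zeroSeedEigenfunction, laxV, sigma, potential, Matrix.mulVec, dotProduct,
        Fin.sum_univ_two, pow_succ]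
      ring

theorem conj_zeroSeedEigenfunction (x t : ℝ) (z : ℂ) :
    conj (zeroSeedEigenfunction x t (-conj z) 0) = zeroSeedEigenfunction x t z 1 := by
  simp only [zeroSeedEigenfunction, Matrix.cons_val_zero, Matrix.cons_val_one,
    ← Complex.exp_conj, map_mul, map_add, map_pow, map_neg, Complex.conj_conj, Complex.conj_I,
    Complex.conj_ofReal, map_ofNat]
  congr 1
  ring

variable {b n : ℕ} {m : Fin b → ℕ} {lam : Node b n → ℂ}

/-- The involution of the nodes that exchanges the members of each pair. -/
def nodeSwap : Node b n → Node b n :=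
  Sum.map (fun i => pairNode (pairIndex i) ((i : ℕ) + 1)) id

theorem nodeSwap_involutive : Function.Involutive (nodeSwap (b := b) (n := n)) := by
  rintro (i | i)
  · simp only [nodeSwap, Sum.map_inl, Sum.inl.injEq, Fin.ext_iff, pairNode, pairIndex]
    omega
  · rfl

theorem nodeMult_nodeSwap (c : Node b n) : nodeMult m (nodeSwap c) = nodeMult m c := by
  rcases c with i | i
  · simp [nodeSwap, nodeMult, pairIndex_pairNode]
  · rfl

/-- Free nodes are fixed by the involution because an imaginary `λ` satisfies `λ = -λ*`. -/
theorem lam_nodeSwap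
    (hpair : ∀ l : Fin b, lam (Sum.inl (pairNode l 1)) = -conj (lam (Sum.inl (pairNode l 0))))
    (hfree : ∀ j : Fin (2 * n), (lam (Sum.inr j)).re = 0) (c : Node b n) :
    lam (nodeSwap c) = -conj (lam c) := by
  rcases c with i | i
  · rcases Nat.mod_two_eq_zero_or_one (i : ℕ) with h | h
    · have h1 : i = pairNode (pairIndex i) 0 := by
        simp only [Fin.ext_iff, pairNode, pairIndex]; omega
      have h2 : pairNode (pairIndex i) ((i : ℕ) + 1) = pairNode (pairIndex i) 1 :=
        pairNode_eq_iff.2 ⟨rfl, by omega⟩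
      simp only [nodeSwap, Sum.map_inl, h2, hpair, ← h1]
    · have h1 : i = pairNode (pairIndex i) 1 := by
        simp only [Fin.ext_iff, pairNode, pairIndex]; omega
      have h2 : pairNode (pairIndex i) ((i : ℕ) + 1) = pairNode (pairIndex i) 0 :=
        pairNode_eq_iff.2 ⟨rfl, by omega⟩
      have h3 := hpair (pairIndex i)
      rw [← h1] at h3
      simp only [nodeSwap, Sum.map_inl, h2, h3, map_neg, Complex.conj_conj, neg_neg]
  · refine Complex.ext ?_ ?_
    · simp [nodeSwap, hfree]
    · simp [nodeSwap]

/-! ### Nonvanishing at the origin: the confluent Vandermonde determinant -/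

theorem sum_rootMultiplicity_le {ι : Type*} [Fintype ι] {f : ι → ℂ} (hf : Function.Injective f)
    (p : Polynomial ℂ) : ∑ i, p.rootMultiplicity (f i) ≤ p.natDegree := by
  classical
  calc ∑ i, p.rootMultiplicity (f i) = ∑ a ∈ Finset.univ.image f, p.roots.count a := by
        rw [Finset.sum_image fun _ _ _ _ h => hf h]
        simp
    _ ≤ ∑ a ∈ Finset.univ.image f ∪ p.roots.toFinset, p.roots.count a :=
        Finset.sum_le_sum_of_subset Finset.subset_union_left
    _ = ∑ a ∈ p.roots.toFinset, p.roots.count a := by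
        refine (Finset.sum_subset Finset.subset_union_right fun a _ ha => ?_).symm
        exact Multiset.count_eq_zero.2 fun h => ha (Multiset.mem_toFinset.2 h)
    _ = p.roots.card := Multiset.toFinset_sum_count_eq _
    _ ≤ p.natDegree := p.card_roots'

/-- The confluent Vandermonde determinant of distinct nodes does not vanish. -/
theorem det_confluentVandermonde_ne_zero (hlam : Function.Injective lam) :
    (Matrix.of fun j k : Fin (dtSize b m n) => taylorCoeff (rowOrder b m n j)
      (lam (rowNode b m n j)) (fun z => z ^ (dtSize b m n - 1 - (k : ℕ)))).det ≠ 0 := by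
  intro h0
  obtain ⟨v, hv, h⟩ := Matrix.exists_mulVec_eq_zero_iff.2 h0
  -- A kernel vector is the coefficient list of a nonzero polynomial of degree below `N`. The rows
  -- make it vanish at each node to the order of the multiplicity, and these multiplicities add up
  -- to `N`.
  set p : Polynomial ℂ :=
    ∑ k : Fin (dtSize b m n), Polynomial.C (v k) * Polynomial.X ^ (dtSize b m n - 1 - (k : ℕ))
    with hp
  have hcoeff : ∀ k : Fin (dtSize b m n), p.coeff (dtSize b m n - 1 - (k : ℕ)) = v k := by
    intro k
    rw [hp, Polynomial.finsetSum_coeff, Finset.sum_eq_single k]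
    · simp
    · intro i _ hik
      rw [Polynomial.coeff_C_mul_X_pow, if_neg]
      intro e
      exact hik (Fin.ext (by have := i.2; have := k.2; omega))
    · simp
  have hp0 : p ≠ 0 := fun e => hv (funext fun k => by rw [← hcoeff k, e]; rfl)
  obtain ⟨k₀, hk₀⟩ := Function.ne_iff.1 hv
  have hdeg : p.natDegree < dtSize b m n := by
    have hN : 0 < dtSize b m n := k₀.pos
    refine lt_of_le_of_lt (Polynomial.natDegree_sum_le_of_forall_le (n := dtSize b m n - 1)
      Finset.univ _ fun k _ => ?_) (Nat.sub_lt hN one_pos)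
    exact (Polynomial.natDegree_C_mul_X_pow_le _ _).trans (Nat.sub_le _ _)
  have hroot : ∀ c : Node b n, nodeMult m c ≤ p.rootMultiplicity (lam c) := by
    intro c
    have hpos : 0 < nodeMult m c := by rcases c with i | i <;> simp [nodeMult]
    have key : nodeMult m c - 1 < p.rootMultiplicity (lam c) := by
      refine Polynomial.lt_rootMultiplicity_of_isRoot_iterate_derivative hp0 fun d hd => ?_
      obtain ⟨j, rfl, rfl⟩ := exists_row (m := m) c (d := d) (by omega)
      have hj := congrFun h j
      simp only [Matrix.mulVec, dotProduct, Matrix.of_apply, Pi.zero_apply, taylorCoeff_eq] at hj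
      have hX : ∀ (d e : ℕ) (μ : ℂ), iteratedDeriv d (fun z : ℂ => z ^ e) μ =
          (Polynomial.derivative^[d] (Polynomial.X ^ e : Polynomial ℂ)).eval μ := fun d e μ => by
        rw [← congrFun (iteratedDeriv_polynomial_eval d (Polynomial.X ^ e)) μ]
        simp
      have hf : ((rowOrder b m n j).factorial : ℂ) ≠ 0 := by
        exact_mod_cast (rowOrder b m n j).factorial_ne_zero
      rw [Polynomial.IsRoot.def, hp, Polynomial.iterate_derivative_sum, Polynomial.eval_finsetSum]
      simp only [Polynomial.iterate_derivative_C_mul, Polynomial.eval_mul, Polynomial.eval_C,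
        ← hX]
      -- Clears the factorial that distinguishes a Taylor coefficient from a derivative.
      have h2 := congrArg (fun a => ((rowOrder b m n j).factorial : ℂ) * a) hj
      simp only [Finset.mul_sum, mul_zero] at h2
      rw [← h2]
      refine Finset.sum_congr rfl fun k _ => ?_
      field_simp
    omega
  have := (Finset.sum_le_sum fun c (_ : c ∈ Finset.univ) => hroot c).trans
    (sum_rootMultiplicity_le hlam p)
  rw [sum_nodeMult] at this
  omega

/-- At `(0, 0)` both exponentials are identically `1` in `λ`, so only the powers of `λ` remain in
the rows. -/
theorem det_taylorAt_zeroSeed_ne_zero (hlam : Function.Injective lam) :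
    (taylorAt entryP m lam (fun _ => zeroSeedEigenfunction) 0 0).det ≠ 0 := by
  convert det_confluentVandermonde_ne_zero (m := m) hlam using 2
  ext j k
  simp [taylorAt, taylorMatrix, taylorCoeff, limitParams, entryP, zeroSeedEigenfunction]

theorem isDNLSSolutionOn_zeroSeed (hb : 1 ≤ b)
    (hpair : ∀ l : Fin b, lam (Sum.inl (pairNode l 1)) = -conj (lam (Sum.inl (pairNode l 0))))
    (hfree : ∀ j : Fin (2 * n), (lam (Sum.inr j)).re = 0) :
    IsDNLSSolutionOn (degenerateQ (fun _ _ => 0) m lam (fun _ => zeroSeedEigenfunction))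
      {p : ℝ × ℝ | (taylorAt entryP m lam (fun _ => zeroSeedEigenfunction) p.1 p.2).det ≠ 0} := by
  have h := isDNLSSolutionOn_degenerateQ (m := m) (lam := lam) (D := fun _ => Set.univ)
    (Ψ := fun _ => zeroSeedEigenfunction) hb isOpen_univ isKNSolutionOn_zero
    (fun _ => Set.mem_univ _) (fun _ => isOpen_univ) (fun _ => isEigenfunctionFamily_zeroSeed)
    (fun _ _ _ => by simp) nodeSwap_involutive nodeMult_nodeSwap (lam_nodeSwap hpair hfree)
    (fun _ z _ _ x t _ => conj_zeroSeedEigenfunction x t z)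
  simpa only [Set.mem_univ, true_and] using h

end ZeroSeed

end KaupNewell

end

theorem theorem3 (b n : ℕ) (hb : 1 ≤ b) (m : Fin b → ℕ) (lam : KaupNewell.Node b n → ℂ) :
    (∀ (Ω : Set (ℝ × ℝ)) (q r : ℝ → ℝ → ℂ) (D : KaupNewell.Node b n → Set ℂ)
        (Ψ : KaupNewell.Node b n → ℝ → ℝ → ℂ → Fin 2 → ℂ),
        IsOpen Ω →
        KaupNewell.IsKNSolutionOn q r Ω →
        (∀ c, lam c ∈ D c) →
        (∀ i, IsOpen (D (Sum.inl i))) →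
        (∀ c, KaupNewell.IsEigenfunctionFamily q r Ω (D c) (Ψ c)) →
        -- the degenerate transformation is the limit of the `N`-fold transformation
        (∀ x t : ℝ, (x, t) ∈ Ω →
          ((KaupNewell.taylorAt KaupNewell.entryP m lam Ψ x t).det ≠ 0 →
            (∀ᶠ Λ in 𝓝[KaupNewell.admissibleParams m lam] (KaupNewell.limitParams m lam),
              (KaupNewell.nfoldAt KaupNewell.entryP m Ψ Λ x t).det ≠ 0) ∧
            Filter.Tendsto (fun Λ => KaupNewell.nfoldQ q m Ψ Λ x t)
              (𝓝[KaupNewell.admissibleParams m lam] (KaupNewell.limitParams m lam))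
              (𝓝 (KaupNewell.degenerateQ q m lam Ψ x t))) ∧
          ((KaupNewell.taylorAt KaupNewell.entryM m lam Ψ x t).det ≠ 0 →
            (∀ᶠ Λ in 𝓝[KaupNewell.admissibleParams m lam] (KaupNewell.limitParams m lam),
              (KaupNewell.nfoldAt KaupNewell.entryM m Ψ Λ x t).det ≠ 0) ∧
            Filter.Tendsto (fun Λ => KaupNewell.nfoldR r m Ψ Λ x t)
              (𝓝[KaupNewell.admissibleParams m lam] (KaupNewell.limitParams m lam))
              (𝓝 (KaupNewell.degenerateR r m lam Ψ x t)))) ∧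
        -- it gives a new solution of the Kaup-Newell system
        KaupNewell.IsKNSolutionOn (KaupNewell.degenerateQ q m lam Ψ)
          (KaupNewell.degenerateR r m lam Ψ)
          {p ∈ Ω | (KaupNewell.taylorAt KaupNewell.entryP m lam Ψ p.1 p.2).det ≠ 0 ∧
            (KaupNewell.taylorAt KaupNewell.entryM m lam Ψ p.1 p.2).det ≠ 0} ∧
        -- under the reduction `r = -q*` it gives a new solution of the derivative NLS equation
        ((∀ x t : ℝ, (x, t) ∈ Ω → r x t = -(starRingEnd ℂ) (q x t)) →
          (∃ τ : KaupNewell.Node b n → KaupNewell.Node b n,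
            (∀ c, τ (τ c) = c) ∧
            (∀ c, KaupNewell.nodeMult m (τ c) = KaupNewell.nodeMult m c) ∧
            (∀ c, lam (τ c) = -(starRingEnd ℂ) (lam c)) ∧
            (∀ c, ∀ z ∈ D c, -(starRingEnd ℂ) z ∈ D (τ c) → ∀ x t : ℝ, (x, t) ∈ Ω →
              (starRingEnd ℂ) (Ψ (τ c) x t (-(starRingEnd ℂ) z) 0) = Ψ c x t z 1)) →
          KaupNewell.IsDNLSSolutionOn (KaupNewell.degenerateQ q m lam Ψ)
            {p ∈ Ω | (KaupNewell.taylorAt KaupNewell.entryP m lam Ψ p.1 p.2).det ≠ 0} ∧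
          ∀ x t : ℝ, (x, t) ∈ Ω →
            (KaupNewell.taylorAt KaupNewell.entryP m lam Ψ x t).det ≠ 0 →
            KaupNewell.degenerateR r m lam Ψ x t =
              -(starRingEnd ℂ) (KaupNewell.degenerateQ q m lam Ψ x t))) ∧
    -- higher-order hybrid-pattern solitons from the zero seed, without (`n = 0`) and with
    -- (`n ≠ 0`) an `n`-periodic background
    (Function.Injective lam →
      (∀ l : Fin b, lam (Sum.inl (KaupNewell.pairNode l 1)) =
        -(starRingEnd ℂ) (lam (Sum.inl (KaupNewell.pairNode l 0)))) →
      (∀ j : Fin (2 * n), (lam (Sum.inr j)).re = 0) →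
      (KaupNewell.taylorAt KaupNewell.entryP m lam
        (fun _ => KaupNewell.zeroSeedEigenfunction) 0 0).det ≠ 0 ∧
      KaupNewell.IsDNLSSolutionOn
        (KaupNewell.degenerateQ (fun _ _ => 0) m lam
          (fun _ => KaupNewell.zeroSeedEigenfunction))
        {p : ℝ × ℝ | (KaupNewell.taylorAt KaupNewell.entryP m lam
          (fun _ => KaupNewell.zeroSeedEigenfunction) p.1 p.2).det ≠ 0}) := by
  refine ⟨fun Ω q r D Ψ hΩ hKN hD hDo hΨ => ⟨fun x t h => ⟨fun hP => ?_, fun hM => ?_⟩, ?_, ?_⟩,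
    fun hinj hpair hfree => ⟨?_, ?_⟩⟩
  · exact KaupNewell.tendsto_nfoldQ q hD hDo (fun c => (hΨ c).holomorphic x t h) hP
  · exact KaupNewell.tendsto_nfoldR r hD hDo (fun c => (hΨ c).holomorphic x t h) hM
  · exact KaupNewell.isKNSolutionOn_degenerate hb hΩ hKN hD hDo hΨ
  · rintro hqr ⟨τ, hτ, hm, hlam, hsym⟩
    refine ⟨KaupNewell.isDNLSSolutionOn_degenerateQ hb hΩ hKN hD hDo hΨ hqr hτ hm hlam hsym,
      fun x t h _ => ?_⟩
    exact KaupNewell.degenerateR_eq_neg_conj hb hτ hm hlam hD hDo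
      (fun c z hz hz' => hsym c z hz hz' x t h) (hqr x t h)
  · exact KaupNewell.det_taylorAt_zeroSeed_ne_zero hinj
  · exact KaupNewell.isDNLSSolutionOn_zeroSeed hb hpair hfree
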